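/- Let $n\ge 3$. On $\mathbb R^{n+2}$, with standard basis $\eta_0,\dots,\eta_{n+1}$, let $\langle v,w\rangle=\sum_{A=1}^n v^Aw^A-v^0w^{n+1}-v^{n+1}w^0$, let $L^+=\{v:\langle v,v\rangle=0,\ v^0+v^{n+1}>0\}$, and let $\mathbb Q_n\subset\mathbb P^{n+1}(\mathbb R)$ be the projectivization of $L^+$ (the conformal $n$-sphere). Let $\mathrm{M\ddot ob}(n)$ be the group of matrices with determinant $1$ that preserve $\langle\cdot,\cdot\rangle$ and $L^+$. A conformal $k$-sphere in $\mathbb Q_n$ is the image, under an element of $\mathrm{M\ddot ob}(n)$, of the projectivization of $L^+\cap\langle\eta_0,\dots,\eta_k,\eta_{n+1}\rangle$. Let $I\subseteq\mathbb R$ be a non-empty open interval and $f:I\to\mathbb Q_n$ a smooth immersion. A frame along $f$ is a smooth map $e=(e_0|e_1|\dots|e_{n+1}):U\to\mathrm{M\ddot ob}(n)$ on an open set $U\subseteq I$ with $[e_0]=f$; put $\phi=(\phi^a_b)=e^{-1}de$. Let $2\le\alpha\le n$ and $3\le b,c\le n$. A Darboux frame is a frame with $\phi^\alpha_0=0$ and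 $\phi^\alpha_1=0$; then $\phi^1_0$ does not vanish, and we write $\phi^0_\alpha=p^\alpha\phi^1_0$. Such frames exist near every point. The form $\big(\sum_\alpha(p^\alpha)^2\big)^{1/4}|\phi^1_0|$ does not depend on the Darboux frame; its integral over a compact interval $\mathcal D\subseteq I$ is the conformal arclength $G_{\mathcal D}(f)$. The immersion $f$ is $1$-generic if $\sum_\alpha(p^\alpha)^2\ne0$ at every point of $I$. An admissible variation of $f$ with support in the compact set $K\subseteq I$ is a smooth map $v:I\times(-\varepsilon,\varepsilon)\to\mathbb Q_n$, $\varepsilon>0$, such that every $f_t=v(\cdot,t)$ is an immersion, $f_0=f$, and $f_t=f$ on $I\setminus K$. The curve $f$ is a conformal geodesic if, for every compact interval $\mathcal D\subseteq I$ and every admissible variation with support in $\mathcal D$, $\frac{d}{dt}\big|_{t=0}G_{\mathcal D}(f_t)$ exists and equals $0$. A special third order frame is a Darboux frame with $\phi^0_2=\phi^1_0$, $\phi^0_b=0$ and $\phi^0_0=0$. For such a frame let $ds=\phi^1_0$, $\phi^b_2=q^b\,ds$, $X=\sum_b q^be_b$, $\frac{\nabla X}{ds}=\sum_b\Big(\frac{dq^b}{ds}+\sum_c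 q^c\phi^b_c\big(\tfrac{d}{ds}\big)\Big)e_b$, and $$V(s)=\Big\langle e_0,e_1,e_2,e_{n+1},X,\frac{\nabla X}{ds}\Big\rangle .$$ Theorem. Let $f:I\to\mathbb Q_n$ be a $1$-generic conformal geodesic. Then special third order frames along $f$ exist near every point of $I$, and there is one linear subspace $V\subseteq\mathbb R^{n+2}$ such that $V(s)=V$ at every point of $I$ and for every special third order frame. The subspace $V$ is time-like (that is, $\langle\cdot,\cdot\rangle$ restricted to $V$ is Lorentzian, of signature $(\dim V-1,1)$), $\dim V\in\{4,5,6\}$, and the projectivization of $V\cap L^+$ is a conformal sphere of dimension $\dim V-2\in\{2,3,4\}$ that contains $f(I)$. -/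

import Mathlib

open scoped ContDiff

namespace ConfGeo

/-- The vector space `ℝ^{n+2}`, with coordinates `v 0, v 1, …, v n, v (n+1)`. -/
abbrev Ambient (n : ℕ) : Type := Fin (n + 2) → ℝ

/-- Square matrices of size `n + 2`. -/
abbrev Mat (n : ℕ) : Type := Matrix (Fin (n + 2)) (Fin (n + 2)) ℝ

/-- The real projective space `ℙ^{n+1}`. -/
abbrev Proj (n : ℕ) : Type := Projectivization ℝ (Ambient n)

/-- The Lorentzian matrix with entries `S_{0,n+1} = S_{n+1,0} = -1`, `S_{AA} = 1` for
`1 ≤ A ≤ n`, and `0` elsewhere. -/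
def lorentzMatrix (n : ℕ) : Mat n :=
  Matrix.of fun i j =>
    if (i = 0 ∧ j = Fin.last (n + 1)) ∨ (i = Fin.last (n + 1) ∧ j = 0) then -1
    else if i = j ∧ i ≠ 0 ∧ i ≠ Fin.last (n + 1) then 1
    else 0

/-- The Lorentzian scalar product of `ℝ^{n+2}`. -/
def lorentz {n : ℕ} (v w : Ambient n) : ℝ :=
  dotProduct v (Matrix.mulVec (lorentzMatrix n) w)

/-- The positive light cone `L⁺`. -/
def lightCone (n : ℕ) : Set (Ambient n) :=
  {v | lorentz v v = 0 ∧ 0 < v 0 + v (Fin.last (n + 1))}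

/-- The Möbius group: Lorentz matrices that preserve the orientation and the positive
light cone (this is the identity component of the Lorentz group). -/
def moebius (n : ℕ) : Set (Mat n) :=
  {G | G.transpose * lorentzMatrix n * G = lorentzMatrix n ∧ G.det = 1 ∧
    ∀ v ∈ lightCone n, Matrix.mulVec G v ∈ lightCone n}

/-- `v` is a vector of homogeneous coordinates of the point `p`. -/
def Represents {n : ℕ} (v : Ambient n) (p : Proj n) : Prop :=
  ∃ h : v ≠ 0, Projectivization.mk ℝ v h = p

/-- The Darboux hyperquadric, i.e. the conformal sphere `Q_n`. -/
def quadric (n : ℕ) : Set (Proj n) :=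
  {p | ∀ v, Represents v p → lorentz v v = 0}

/-! ### Subspaces and conformal spheres -/

/-- `V` is time-like: the scalar product restricted to `V` is Lorentzian, that is, `V` contains
a vector of negative square on whose orthogonal complement in `V` the product is positive
definite. -/
def IsTimelike {n : ℕ} (V : Submodule ℝ (Ambient n)) : Prop :=
  ∃ v ∈ V, lorentz v v < 0 ∧ ∀ w ∈ V, lorentz v w = 0 → w ≠ 0 → 0 < lorentz w w

/-- The projection to `Q_n` of the intersection of `V` with the positive light cone. -/
def projectedCone {n : ℕ} (V : Submodule ℝ (Ambient n)) : Set (Proj n) :=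
  {p | ∃ v ∈ V, v ∈ lightCone n ∧ Represents v p}

/-- The subspace `⟨η_0, η_1, …, η_k, η_{n+1}⟩` spanned by vectors of the standard basis. -/
def standardSubspace (n k : ℕ) : Submodule ℝ (Ambient n) :=
  Submodule.span ℝ
    {v | ∃ i : Fin (n + 2), ((i : ℕ) ≤ k ∨ i = Fin.last (n + 1)) ∧ v = Pi.single i 1}

/-- A conformal `k`-sphere in `Q_n`: the image, under an element of the Möbius group, of the
standard `Q_k ⊆ Q_n`. -/
def IsConformalSphere (n k : ℕ) (Q : Set (Proj n)) : Prop :=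
  k ≤ n ∧ ∃ G ∈ moebius n,
    Q = {p | ∃ v ∈ standardSubspace n k, v ∈ lightCone n ∧ Represents (Matrix.mulVec G v) p}

/-! ### Smooth maps and immersions -/

/-- A map into projective space is smooth on `Ω` if it has smooth homogeneous coordinates
near every point of `Ω`. -/
def SmoothMapOn {n : ℕ} {E : Type} [NormedAddCommGroup E] [NormedSpace ℝ E]
    (f : E → Proj n) (Ω : Set E) : Prop :=
  ∀ x ∈ Ω, ∃ U : Set E, IsOpen U ∧ x ∈ U ∧ U ⊆ Ω ∧
    ∃ F : E → Ambient n, ContDiffOn ℝ ∞ F U ∧ ∀ y ∈ U, Represents (F y) (f y)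

/-- `f : I → Q_n` is a smooth immersion: in homogeneous coordinates `F`, the vectors `F` and `F'`
are linearly independent, i.e. the velocity of `f = [F]` is not zero. -/
def IsImmersion {n : ℕ} (I : Set ℝ) (f : ℝ → Proj n) : Prop :=
  (∀ x ∈ I, f x ∈ quadric n) ∧
  ∀ x ∈ I, ∃ U : Set ℝ, IsOpen U ∧ x ∈ U ∧ U ⊆ I ∧
    ∃ F : ℝ → Ambient n, ContDiffOn ℝ ∞ F U ∧ (∀ y ∈ U, Represents (F y) (f y)) ∧
      LinearIndependent ℝ ![F x, deriv F x]

/-! ### Frames along a curve -/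

/-- The `a`-th column `e_a` of the frame `e`. -/
def column {n : ℕ} (e : ℝ → Mat n) (a : Fin (n + 2)) (x : ℝ) : Ambient n :=
  fun i => e x i a

/-- The pull-back `φ = e⁻¹ de` of the Maurer-Cartan form, evaluated on `d/dx`. The entry
`maurerCartan e x a b` is `φ^a_b`. -/
noncomputable def maurerCartan {n : ℕ} (e : ℝ → Mat n) (x : ℝ) : Mat n :=
  (e x)⁻¹ * Matrix.of fun i j => deriv (fun y => e y i j) x

/-- The indices `2 ≤ α ≤ n`. -/
def normalIndices (n : ℕ) : Finset (Fin (n + 2)) :=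
  Finset.univ.filter fun a => 2 ≤ (a : ℕ) ∧ (a : ℕ) ≤ n

/-- The indices `3 ≤ b ≤ n`. -/
def thetaIndices (n : ℕ) : Finset (Fin (n + 2)) :=
  Finset.univ.filter fun a => 3 ≤ (a : ℕ) ∧ (a : ℕ) ≤ n

/-- A zeroth order frame along `f : I → Q_n` on the open set `U ⊆ I`: a smooth map `e` into the
Möbius group with `[e_0] = f`. -/
structure IsZerothOrderFrame {n : ℕ} (I : Set ℝ) (f : ℝ → Proj n) (U : Set ℝ)
    (e : ℝ → Mat n) : Prop where
  isOpen : IsOpen U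
  subset : U ⊆ I
  smooth : ∀ i j, ContDiffOn ℝ ∞ (fun x => e x i j) U
  mem_moebius : ∀ x ∈ U, e x ∈ moebius n
  represents : ∀ x ∈ U, Represents (column e 0 x) (f x)

/-- A second order frame, or Darboux frame: `φ^α_0 = 0` (first order) and `φ^α_1 = 0`, for
`2 ≤ α ≤ n`. -/
structure IsDarbouxFrame {n : ℕ} (I : Set ℝ) (f : ℝ → Proj n) (U : Set ℝ)
    (e : ℝ → Mat n) : Prop extends IsZerothOrderFrame I f U e where
  first_order : ∀ x ∈ U, ∀ a ∈ normalIndices n, maurerCartan e x a 0 = 0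
  second_order : ∀ x ∈ U, ∀ a ∈ normalIndices n, maurerCartan e x a 1 = 0

/-- The functions `p^α` of a Darboux frame, given by `φ^0_α = p^α φ^1_0`. -/
noncomputable def pCoeff {n : ℕ} (e : ℝ → Mat n) (x : ℝ) (a : Fin (n + 2)) : ℝ :=
  maurerCartan e x 0 a / maurerCartan e x 1 0

/-- The immersion `f` is `1`-generic at `q`: `∑_α (p^α)² ≠ 0` at `q`, in a Darboux frame
around `q`. -/
def IsOneGenericAt {n : ℕ} (I : Set ℝ) (f : ℝ → Proj n) (q : ℝ) : Prop :=
  ∃ (U : Set ℝ) (e : ℝ → Mat n), q ∈ U ∧ IsDarbouxFrame I f U e ∧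
    ∑ a ∈ normalIndices n, pCoeff e q a ^ 2 ≠ 0

/-- The immersion `f` is `1`-generic: it is so at each point of `I`. -/
def IsOneGeneric {n : ℕ} (I : Set ℝ) (f : ℝ → Proj n) : Prop :=
  ∀ q ∈ I, IsOneGenericAt I f q

/-- A third order frame: a Darboux frame with `φ^0_2 = φ^1_0` and `φ^0_b = 0` for
`3 ≤ b ≤ n`. -/
structure IsThirdOrderFrame {n : ℕ} (I : Set ℝ) (f : ℝ → Proj n) (U : Set ℝ)
    (e : ℝ → Mat n) : Prop extends IsDarbouxFrame I f U e where
  third_order_two : ∀ x ∈ U, maurerCartan e x 0 2 = maurerCartan e x 1 0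
  third_order : ∀ x ∈ U, ∀ b ∈ thetaIndices n, maurerCartan e x 0 b = 0

/-- A special third order frame: a third order frame with `φ^0_0 = 0`. -/
structure IsSpecialThirdOrderFrame {n : ℕ} (I : Set ℝ) (f : ℝ → Proj n) (U : Set ℝ)
    (e : ℝ → Mat n) : Prop extends IsThirdOrderFrame I f U e where
  special : ∀ x ∈ U, maurerCartan e x 0 0 = 0

/-- The functions `q^b` of a third order frame, given by `φ^b_2 = q^b φ^1_0`. -/
noncomputable def qCoeff {n : ℕ} (e : ℝ → Mat n) (b : Fin (n + 2)) (x : ℝ) : ℝ :=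
  maurerCartan e x b 2 / maurerCartan e x 1 0

/-- The vector `∑_b w^b e_b` of the bundle `Θ`, which is spanned by the `e_b`, `3 ≤ b ≤ n`. -/
noncomputable def thetaSection {n : ℕ} (e : ℝ → Mat n) (w : Fin (n + 2) → ℝ → ℝ) (x : ℝ) :
    Ambient n :=
  ∑ b ∈ thetaIndices n, w b x • column e b x

/-- The components of the derivative `∇/ds` of the section `∑_b w^b e_b` of `Θ`, where
`∇ e_b = φ^c_b ⊗ e_c` and `ds = φ^1_0`. -/
noncomputable def covDeriv {n : ℕ} (e : ℝ → Mat n) (w : Fin (n + 2) → ℝ → ℝ) :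
    Fin (n + 2) → ℝ → ℝ :=
  fun b x => (deriv (w b) x + ∑ c ∈ thetaIndices n, w c x * maurerCartan e x b c) /
    maurerCartan e x 1 0

/-- The section `X = q^b e_b` of `Θ`. -/
noncomputable def sectionX {n : ℕ} (e : ℝ → Mat n) (x : ℝ) : Ambient n :=
  thetaSection e (qCoeff e) x

/-- The section `∇X/ds` of `Θ`. -/
noncomputable def sectionNablaX {n : ℕ} (e : ℝ → Mat n) (x : ℝ) : Ambient n :=
  thetaSection e (covDeriv e (qCoeff e)) x

/-- The subspace `⟨e_0, e_1, e_2, e_{n+1}, X, ∇X/ds⟩` at the point `x`. -/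
noncomputable def spaceV {n : ℕ} (e : ℝ → Mat n) (x : ℝ) : Submodule ℝ (Ambient n) :=
  Submodule.span ℝ {column e 0 x, column e 1 x, column e 2 x, column e (Fin.last (n + 1)) x,
    sectionX e x, sectionNablaX e x}

/-! ### The conformal arclength functional and its critical points -/

/-- The conformal arclength element `(∑_α (p^α)²)^{1/4} |φ^1_0|` computed in the frame `e`. The
absolute value makes it independent of the direction of `e_1`, i.e. it selects the increasing
arclength. -/
noncomputable def frameArclengthElement {n : ℕ} (e : ℝ → Mat n) (x : ℝ) : ℝ :=
  (∑ a ∈ normalIndices n, pCoeff e x a ^ 2) ^ (1 / 4 : ℝ) * |maurerCartan e x 1 0|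

/-- The conformal arclength element `ds/dx` of the immersion `f`: its value in a Darboux frame
around `x` (all Darboux frames give the same value). -/
noncomputable def arclengthElement {n : ℕ} (I : Set ℝ) (f : ℝ → Proj n) (x : ℝ) : ℝ :=
  Classical.epsilon fun r : ℝ => ∃ (U : Set ℝ) (e : ℝ → Mat n), x ∈ U ∧
    IsDarbouxFrame I f U e ∧ r = frameArclengthElement e x

/-- The conformal arclength of `f` on the compact interval `[a, b] ⊆ I`. -/
noncomputable def conformalArclength {n : ℕ} (I : Set ℝ) (a b : ℝ) (f : ℝ → Proj n) : ℝ :=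
  ∫ x in a..b, arclengthElement I f x

/-- `v : I × (-ε, ε) → Q_n` is an admissible variation of `f`, constant outside the compact set
`K ⊆ I`. -/
structure IsAdmissibleVariation {n : ℕ} (I : Set ℝ) (f : ℝ → Proj n) (ε : ℝ) (K : Set ℝ)
    (v : ℝ × ℝ → Proj n) : Prop where
  pos : 0 < ε
  isCompact : IsCompact K
  subset : K ⊆ I
  smooth : SmoothMapOn v (I ×ˢ Set.Ioo (-ε) ε)
  immersion : ∀ t ∈ Set.Ioo (-ε) ε, IsImmersion I fun x => v (x, t)
  initial : ∀ x ∈ I, v (x, 0) = f x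
  outside : ∀ x ∈ I \ K, ∀ t ∈ Set.Ioo (-ε) ε, v (x, t) = f x

/-- `f` is a conformal geodesic: a critical point of the conformal arclength on each compact
interval `[a, b] ⊆ I`, for the admissible variations supported in `[a, b]`. -/
def IsConformalGeodesic {n : ℕ} (I : Set ℝ) (f : ℝ → Proj n) : Prop :=
  ∀ a b : ℝ, a ≤ b → Set.Icc a b ⊆ I →
    ∀ (ε : ℝ) (K : Set ℝ) (v : ℝ × ℝ → Proj n), IsAdmissibleVariation I f ε K v →
      K ⊆ Set.Icc a b →
        HasDerivAt (fun t => conformalArclength I a b fun x => v (x, t)) 0 0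

end ConfGeo

open scoped ContDiff

namespace ConfGeo

variable {n : ℕ}

/-! ### Lorentzian linear algebra -/

/-! The proof replaces frames by light-like lifts. A lift F of f is determined up to a factor μ, and
rescaling by μ multiplies the Gram determinant of F, F', F'', F''' by μ^8 and ⟨F',F'⟩ by μ^2. Hence
(-Gram)^{1/4} / ⟨F',F'⟩ does not depend on the lift, and in a Darboux frame it is the conformal
arclength element (`IsDarbouxFrame.frameArclengthElement_eq`). For a 1-generic curve the Gram
determinant is negative, so exactly one lift in the positive cone satisfies Gram = -⟨F',F'⟩^6. By
uniqueness this lift is global, and it is the column e_0 of every special third order frame.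

For this F let D be the derivative with respect to arclength. There are vectors T, N, P (`tangent`,
`polar`, `principal`) and a function K (`curv`) with DF = T, DT = KF + N, DN = KT + P. Here F and N
are light-like with product -1, T and P are unit vectors, and all other products vanish. Completing
F, T, P, N to a Möbius frame yields special third order frames. Their structure equations and those
of F are both triangular (`IsChain`), so V(s) is the span of F and its first five derivatives, which
is also the span of F, T, N, P, DP, D²P (`IsConfLift.spaceV_eq_oscSpace`).

If W is orthogonal to F and N, then F + tW + (t²/2)⟨W,W⟩N stays light-like and gives an admissible
variation. Differentiating its arclength and integrating by parts
(`IsTransverse.hasDerivAt_boundaryTerm`) leaves the integral of ⟨E,W⟩ with E = D³P - 2K DP - (DK)P,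
up to a constant factor. Testing with a bump function times the projection of E orthogonal to F and
N shows that E lies in the span of F and N (`IsConfLift.transverseEulerField_eq_zero`).

So D³P is a combination of F, N, P, DP: the six vectors solve a linear differential equation and
their span is constant (`span_le_of_deriv_mem`). The span has dimension at least 4, because F, T, P,
N are independent, and at most 6. Since it contains F and N it is time-like, and a Gram–Schmidt
basis starting from F and N, completed to a Möbius matrix, identifies its projectivized cone with a
conformal sphere (`isConformalSphere_of_mem`). -/

theorem lorentz_eq (v w : Ambient n) :
    lorentz v w = ∑ i : Fin n, v i.castSucc.succ * w i.castSucc.succ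
      - v 0 * w (Fin.last (n + 1)) - v (Fin.last (n + 1)) * w 0 := by
  have h0 : ∀ i : Fin n, i.castSucc.succ ≠ Fin.last (n + 1) := fun i h => by
    have := congrArg Fin.val h
    simp at this
    omega
  have h1 : Fin.last (n + 1) ≠ 0 := by simp [Fin.ext_iff]
  have hS : ∀ i, (lorentzMatrix n).mulVec w i = if i = 0 then - w (Fin.last (n + 1)) else
      if i = Fin.last (n + 1) then - w 0 else w i := by
    intro i
    simp only [Matrix.mulVec, dotProduct, lorentzMatrix, Matrix.of_apply]
    rcases eq_or_ne i 0 with rfl | hi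
    · rw [Finset.sum_eq_single (Fin.last (n + 1))] <;> simp +contextual [h1, h1.symm]
    · rcases eq_or_ne i (Fin.last (n + 1)) with rfl | hl
      · rw [Finset.sum_eq_single 0] <;> simp +contextual [h1]
      · rw [Finset.sum_eq_single i] <;> simp +contextual [hi, hl, eq_comm]
  simp only [lorentz, dotProduct, hS]
  rw [Fin.sum_univ_succ, Fin.sum_univ_castSucc]
  simp [h0, Fin.succ_last]
  ring

theorem lorentz_comm (v w : Ambient n) : lorentz v w = lorentz w v := by
  simp only [lorentz_eq, mul_comm]
  ring

@[simp] theorem lorentz_add_left (u v w : Ambient n) :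
    lorentz (u + v) w = lorentz u w + lorentz v w := by simp [lorentz, add_dotProduct]

@[simp] theorem lorentz_add_right (u v w : Ambient n) :
    lorentz u (v + w) = lorentz u v + lorentz u w := by
  simp [lorentz, Matrix.mulVec_add]

@[simp] theorem lorentz_smul_left (c : ℝ) (v w : Ambient n) :
    lorentz (c • v) w = c * lorentz v w := by simp [lorentz]

@[simp] theorem lorentz_smul_right (c : ℝ) (v w : Ambient n) :
    lorentz v (c • w) = c * lorentz v w := by simp [lorentz, Matrix.mulVec_smul]

/-- The Lorentzian scalar product as a bilinear map. -/
def lorentzB (n : ℕ) : Ambient n →ₗ[ℝ] Ambient n →ₗ[ℝ] ℝ :=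
  LinearMap.mk₂ ℝ lorentz lorentz_add_left lorentz_smul_left lorentz_add_right lorentz_smul_right

theorem lorentzB_apply (v w : Ambient n) : lorentzB n v w = lorentz v w := rfl

@[simp] theorem lorentz_neg_left (v w : Ambient n) : lorentz (-v) w = -lorentz v w := by
  simp [← lorentzB_apply]

@[simp] theorem lorentz_neg_right (v w : Ambient n) : lorentz v (-w) = -lorentz v w := by
  simp [← lorentzB_apply]

@[simp] theorem lorentz_sub_left (u v w : Ambient n) :
    lorentz (u - v) w = lorentz u w - lorentz v w := by simp [← lorentzB_apply]

@[simp] theorem lorentz_sub_right (u v w : Ambient n) :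
    lorentz u (v - w) = lorentz u v - lorentz u w := by simp [← lorentzB_apply]

@[simp] theorem lorentz_zero_left (w : Ambient n) : lorentz 0 w = 0 := by
  simp [← lorentzB_apply]

@[simp] theorem lorentz_zero_right (w : Ambient n) : lorentz w 0 = 0 := by
  simp [← lorentzB_apply]

theorem lorentz_sum_left {ι : Type*} (s : Finset ι) (v : ι → Ambient n) (w : Ambient n) :
    lorentz (∑ i ∈ s, v i) w = ∑ i ∈ s, lorentz (v i) w := by
  simp [← lorentzB_apply]

theorem lorentz_sum_right {ι : Type*} (s : Finset ι) (v : ι → Ambient n) (w : Ambient n) :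
    lorentz w (∑ i ∈ s, v i) = ∑ i ∈ s, lorentz w (v i) := by
  simp [← lorentzB_apply]

/-! ### Causal character of vectors, tested against a fixed time axis. -/

theorem last_ne_zero : Fin.last (n + 1) ≠ 0 := by simp [Fin.ext_iff]

/-- The vector `η_0 + η_{n+1}`. -/
def timeAxis (n : ℕ) : Ambient n := Pi.single 0 1 + Pi.single (Fin.last (n + 1)) 1

theorem lorentz_timeAxis (v : Ambient n) :
    lorentz v (timeAxis n) = -(v 0 + v (Fin.last (n + 1))) := by
  have h0 : ∀ i : Fin n, i.castSucc.succ ≠ Fin.last (n + 1) := fun i h => by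
    have := congrArg Fin.val h
    simp at this
    omega
  simp [lorentz_eq, timeAxis, h0, last_ne_zero.symm]
  ring

/-- On the hyperplane v^{n+1} = -v^0 the mixed term -2 v^0 v^{n+1} becomes 2(v^0)², and the form is
a sum of squares. All signature arguments reduce to this one. -/
theorem lorentz_self_pos_of_timeAxis {v : Ambient n} (h : lorentz v (timeAxis n) = 0)
    (hv : v ≠ 0) : 0 < lorentz v v := by
  rw [lorentz_timeAxis] at h
  have hl : v (Fin.last (n + 1)) = - v 0 := by linarith
  have hs : 0 ≤ ∑ i : Fin n, v i.castSucc.succ * v i.castSucc.succ :=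
    Finset.sum_nonneg fun i _ => mul_self_nonneg _
  have e : lorentz v v = ∑ i : Fin n, v i.castSucc.succ * v i.castSucc.succ
      + 2 * (v 0 * v 0) := by rw [lorentz_eq, hl]; ring
  rw [e]
  by_contra hc
  have h0 : v 0 = 0 := by
    have : v 0 * v 0 = 0 := by nlinarith [mul_self_nonneg (v 0)]
    simpa using this
  have h1 : ∑ i : Fin n, v i.castSucc.succ * v i.castSucc.succ = 0 := by
    nlinarith [mul_self_nonneg (v 0)]
  rw [Finset.sum_eq_zero_iff_of_nonneg fun i _ => mul_self_nonneg _] at h1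
  apply hv
  ext i
  refine Fin.cases h0 (fun j => ?_) i
  refine Fin.lastCases ?_ (fun k => ?_) j
  · rw [Fin.succ_last, hl, h0]; simp
  · simpa using h1 k (Finset.mem_univ _)

theorem lorentz_self_nonneg_of_timeAxis {v : Ambient n} (h : lorentz v (timeAxis n) = 0) :
    0 ≤ lorentz v v := by
  rcases eq_or_ne v 0 with rfl | hv
  · simp
  · exact (lorentz_self_pos_of_timeAxis h hv).le

/-- Subtracting a multiple cu moves w into the orthogonal complement of the time axis, where squares
are nonnegative. The square there is ⟨w,w⟩ + c²⟨u,u⟩, so ⟨w,w⟩ > 0 when c ≠ 0; when c = 0, w itself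
lies in that complement. -/
theorem lorentz_self_pos_of_timelike {u w : Ambient n} (hu : lorentz u u < 0)
    (huw : lorentz u w = 0) (hw : w ≠ 0) : 0 < lorentz w w := by
  have hT : lorentz u (timeAxis n) ≠ 0 := fun h =>
    absurd (lorentz_self_nonneg_of_timeAxis h) (not_le.2 hu)
  set c := lorentz w (timeAxis n) / lorentz u (timeAxis n) with hc
  have h1 : lorentz (w - c • u) (timeAxis n) = 0 := by
    simp [hc, hT]
  have h2 : lorentz (w - c • u) (w - c • u) = lorentz w w + c ^ 2 * lorentz u u := by
    simp [huw, lorentz_comm w u]; ring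
  by_cases h0 : c = 0
  · have := lorentz_self_pos_of_timeAxis h1 (by simpa [h0] using hw)
    simpa [h2, h0] using this
  · have h3 := lorentz_self_nonneg_of_timeAxis h1
    have : 0 < c ^ 2 := by positivity
    nlinarith

theorem lorentz_timeAxis_ne_zero {v : Ambient n} (hv : v ≠ 0) (h : lorentz v v = 0) :
    lorentz v (timeAxis n) ≠ 0 := fun hT => (lorentz_self_pos_of_timeAxis hT hv).ne' h

/-- Adding a multiple of v to w does not change the square of w, so w may be moved into the
complement of the time axis. Applied to a lift and its derivative, this makes the velocity of an
immersion space-like. -/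
theorem lorentz_self_pos_of_null {v w : Ambient n} (hv : lorentz v v = 0)
    (hvw : lorentz v w = 0) (hli : LinearIndependent ℝ ![v, w]) : 0 < lorentz w w := by
  have hv0 : v ≠ 0 := by simpa using hli.ne_zero 0
  have hT := lorentz_timeAxis_ne_zero hv0 hv
  set c := lorentz w (timeAxis n) / lorentz v (timeAxis n) with hc
  have h1 : lorentz (w - c • v) (timeAxis n) = 0 := by simp [hc, hT]
  have h2 : lorentz (w - c • v) (w - c • v) = lorentz w w := by
    simp [hv, hvw, lorentz_comm w v]
  rw [← h2]
  refine lorentz_self_pos_of_timeAxis h1 fun h => ?_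
  have := LinearIndependent.pair_iff.1 hli (-c) 1 (by simpa [sub_eq_neg_add] using h)
  simp at this

theorem mem_lightCone_iff {v : Ambient n} :
    v ∈ lightCone n ↔ lorentz v v = 0 ∧ lorentz v (timeAxis n) < 0 := by
  rw [lorentz_timeAxis, neg_lt_zero]
  rfl

theorem lightCone_ne_zero {v : Ambient n} (h : v ∈ lightCone n) : v ≠ 0 := by
  rintro rfl
  simp [lightCone] at h

theorem linearIndependent_of_null {v w : Ambient n} (hv0 : v ≠ 0) (hv : lorentz v v = 0)
    (hw : 0 < lorentz w w) : LinearIndependent ℝ ![v, w] := by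
  rw [LinearIndependent.pair_iff' hv0]
  rintro a rfl
  simp [hv] at hw

/-- A vector in the light cone and a timelike vector on the positive side have negative product. -/
theorem lorentz_neg_of_timelike {u v : Ambient n} (hu : lorentz u u < 0)
    (huT : lorentz u (timeAxis n) < 0) (hv : v ∈ lightCone n) : lorentz v u < 0 := by
  rw [mem_lightCone_iff] at hv
  -- With this c > 0 the vector v - cu has nonnegative square, which reads 2c⟨v,u⟩ ≤ c²⟨u,u⟩ < 0.
  set c := lorentz v (timeAxis n) / lorentz u (timeAxis n) with hc
  have hcpos : 0 < c := div_pos_of_neg_of_neg hv.2 huT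
  have h1 : lorentz (v - c • u) (timeAxis n) = 0 := by simp [hc, huT.ne]
  have h2 := lorentz_self_nonneg_of_timeAxis h1
  simp [hv.1, lorentz_comm u v] at h2
  nlinarith [mul_pos hcpos hcpos]

/-! ### Lorentz matrices -/

theorem lorentzMatrix_mul_self : lorentzMatrix n * lorentzMatrix n = 1 := by
  have key : ∀ v w : Ambient n, lorentz v ((lorentzMatrix n).mulVec w) = dotProduct v w := by
    intro v w
    have h0 : ∀ i : Fin n, i.castSucc.succ ≠ Fin.last (n + 1) := fun i h => by
      have := congrArg Fin.val h
      simp at this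
      omega
    have hS : ∀ i, (lorentzMatrix n).mulVec w i = lorentz (Pi.single i 1) w := by
      intro i; simp [lorentz]
    simp only [lorentz_eq, hS]
    rw [dotProduct, Fin.sum_univ_succ, Fin.sum_univ_castSucc]
    simp [h0, last_ne_zero.symm, Pi.single_apply]
    ring
  ext i j
  have := key (Pi.single i 1) (Pi.single j 1)
  rw [lorentz, Matrix.mulVec_mulVec] at this
  simpa [Matrix.one_apply, Pi.single_apply, eq_comm] using this

theorem lorentz_mulVec {G : Mat n} (hG : G.transpose * lorentzMatrix n * G = lorentzMatrix n)
    (v w : Ambient n) : lorentz (G.mulVec v) (G.mulVec w) = lorentz v w := by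
  unfold lorentz
  rw [Matrix.mulVec_mulVec, ← Matrix.vecMul_transpose, ← Matrix.dotProduct_mulVec,
    Matrix.mulVec_mulVec, ← Matrix.mul_assoc, hG]

theorem lorentzMatrix_apply (i j : Fin (n + 2)) :
    lorentzMatrix n i j = lorentz (Pi.single i 1) (Pi.single j 1) := by
  simp [lorentz]

/-- The Gram matrix of the columns of a matrix. -/
theorem transpose_mul_lorentzMatrix_mul (G : Mat n) (a b : Fin (n + 2)) :
    (G.transpose * lorentzMatrix n * G) a b = lorentz (fun i => G i a) (fun i => G i b) := by
  rw [Matrix.mul_assoc, Matrix.mul_apply_eq_vecMul, lorentz, Matrix.dotProduct_mulVec]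
  simp [Matrix.vecMul, dotProduct, Matrix.mul_apply, Finset.sum_mul, Finset.mul_sum]
  rw [Finset.sum_comm]
  simp [mul_assoc]

/-- G sends the time axis to the sum of these two columns, so G⁻¹(time axis) is time-like on the
positive side. The product of Gv with the time axis equals that of v with G⁻¹(time axis), hence is
negative for v in the positive cone. -/
theorem mem_moebius_of {G : Mat n} (hG : G.transpose * lorentzMatrix n * G = lorentzMatrix n)
    (hdet : G.det = 1) (h0 : (fun i => G i 0) ∈ lightCone n)
    (hl : (fun i => G i (Fin.last (n + 1))) ∈ lightCone n) : G ∈ moebius n := by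
  refine ⟨hG, hdet, fun v hv => ?_⟩
  have hGT : G.mulVec (timeAxis n) = (fun i => G i 0) + fun i => G i (Fin.last (n + 1)) := by
    ext i; simp [timeAxis, Matrix.mulVec_add]
  have hTT : lorentz (timeAxis n) (timeAxis n) < 0 := by
    rw [lorentz_timeAxis]; simp [timeAxis, last_ne_zero.symm]
  rw [mem_lightCone_iff] at h0 hl
  set J : Mat n := G⁻¹ with hJ
  have hGJ : G * J = 1 := by
    rw [hJ, Matrix.mul_nonsing_inv]; simp [hdet]
  have h1 : ∀ w, G.mulVec (J.mulVec w) = w := fun w => by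
    rw [Matrix.mulVec_mulVec, hGJ, Matrix.one_mulVec]
  have hJ1 : ∀ u w, lorentz u (J.mulVec w) = lorentz (G.mulVec u) w := fun u w => by
    rw [← lorentz_mulVec hG, h1]
  refine mem_lightCone_iff.2 ⟨by rw [lorentz_mulVec hG]; exact hv.1, ?_⟩
  rw [← hJ1]
  refine lorentz_neg_of_timelike ?_ ?_ hv
  · rw [hJ1, h1]; exact hTT
  · rw [lorentz_comm, hJ1, hGT, lorentz_add_left]; linarith

/-! ### Smoothness of the scalar product -/

/-- The Lorentzian scalar product as a continuous bilinear map. -/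
noncomputable def lorentzL (n : ℕ) : Ambient n →L[ℝ] Ambient n →L[ℝ] ℝ :=
  LinearMap.toContinuousBilinearMap (lorentzB n)

theorem _root_.ContDiffOn.lorentz {E : Type*} [NormedAddCommGroup E] [NormedSpace ℝ E]
    {k : WithTop ℕ∞} {u v : E → Ambient n} {s : Set E}
    (hu : ContDiffOn ℝ k u s) (hv : ContDiffOn ℝ k v s) :
    ContDiffOn ℝ k (fun x => lorentz (u x) (v x)) s :=
  (lorentzL n).isBoundedBilinearMap.contDiff.comp_contDiffOn (hu.prodMk hv)

theorem _root_.HasDerivAt.lorentz {u v : ℝ → Ambient n} {u' v' : Ambient n} {x : ℝ}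
    (hu : HasDerivAt u u' x) (hv : HasDerivAt v v' x) :
    HasDerivAt (fun x => lorentz (u x) (v x)) (lorentz (u x) v' + lorentz u' (v x)) x :=
  (lorentzL n).hasDerivAt_of_bilinear (fun _ => hu) (fun _ => hv)

theorem _root_.ContDiffOn.hasDerivAt_of_isOpen {E : Type*} [NormedAddCommGroup E]
    [NormedSpace ℝ E] {u : ℝ → E} {U : Set ℝ} (hu : ContDiffOn ℝ ∞ u U) (hU : IsOpen U) {x : ℝ}
    (hx : x ∈ U) : HasDerivAt u (deriv u x) x :=
  ((hu.contDiffAt (hU.mem_nhds hx)).differentiableAt (by simp)).hasDerivAt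

theorem _root_.ContDiffOn.deriv_infty {E : Type*} [NormedAddCommGroup E]
    [NormedSpace ℝ E] {u : ℝ → E} {U : Set ℝ} (hu : ContDiffOn ℝ ∞ u U) (hU : IsOpen U) :
    ContDiffOn ℝ ∞ (deriv u) U :=
  hu.deriv_of_isOpen hU (by simp)

/-! ### Completion of partial frames -/

theorem lorentzMatrix_zero_zero : lorentzMatrix n 0 0 = 0 := by
  simp [lorentzMatrix, last_ne_zero.symm]

theorem lorentzMatrix_zero_last : lorentzMatrix n 0 (Fin.last (n + 1)) = -1 := by
  simp [lorentzMatrix]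

theorem lorentzMatrix_last_zero : lorentzMatrix n (Fin.last (n + 1)) 0 = -1 := by
  simp [lorentzMatrix]

theorem lorentzMatrix_last_last :
    lorentzMatrix n (Fin.last (n + 1)) (Fin.last (n + 1)) = 0 := by
  simp [lorentzMatrix]

theorem lorentzMatrix_self {a : Fin (n + 2)} (h0 : a ≠ 0) (hl : a ≠ Fin.last (n + 1)) :
    lorentzMatrix n a a = 1 := by
  simp [lorentzMatrix, h0, hl]

theorem lorentzMatrix_of_ne {a b : Fin (n + 2)} (h0 : a ≠ 0) (hl : a ≠ Fin.last (n + 1))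
    (hab : a ≠ b) : lorentzMatrix n a b = 0 := by
  simp [lorentzMatrix, h0, hl, hab]

theorem lorentzMatrix_symm (a b : Fin (n + 2)) : lorentzMatrix n a b = lorentzMatrix n b a := by
  rw [lorentzMatrix_apply, lorentz_comm, ← lorentzMatrix_apply]

/-- The vectors `e a`, `a ∈ A`, have the scalar products of the columns of a Lorentz matrix. -/
def IsPartialFrame (A : Finset (Fin (n + 2))) (e : Fin (n + 2) → Ambient n) : Prop :=
  ∀ a ∈ A, ∀ b ∈ A, lorentz (e a) (e b) = lorentzMatrix n a b

/-- By dimension, pairing with the e_a has a kernel in V. A kernel vector is orthogonal to the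
time-like e_0 + e_{n+1}, hence space-like, and can be normalized. -/
theorem exists_unit_orthogonal (V : Submodule ℝ (Ambient n)) {A : Finset (Fin (n + 2))}
    {e : Fin (n + 2) → Ambient n} (he : IsPartialFrame A e) (h0 : 0 ∈ A)
    (hl : Fin.last (n + 1) ∈ A) (hA : A.card < Module.finrank ℝ V) :
    ∃ w ∈ V, (∀ a ∈ A, lorentz (e a) w = 0) ∧ lorentz w w = 1 := by
  let g : V →ₗ[ℝ] (A → ℝ) := LinearMap.pi fun a => (lorentzB n (e a)).comp V.subtype
  have hker : LinearMap.ker g ≠ ⊥ := LinearMap.ker_ne_bot_of_finrank_lt (by simpa using hA)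
  obtain ⟨w, hw, hw0⟩ := Submodule.exists_mem_ne_zero_of_ne_bot hker
  have hw1 : ∀ a ∈ A, lorentz (e a) w = 0 := fun a ha => by
    have := congrFun (LinearMap.mem_ker.1 hw) ⟨a, ha⟩
    exact this
  have hpos : 0 < lorentz (w : Ambient n) w := by
    refine lorentz_self_pos_of_timelike (u := e 0 + e (Fin.last (n + 1))) ?_ ?_ ?_
    · simp only [lorentz_add_left, lorentz_add_right, he _ h0 _ h0, he _ h0 _ hl, he _ hl _ h0,
        he _ hl _ hl, lorentzMatrix_zero_zero, lorentzMatrix_zero_last, lorentzMatrix_last_zero,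
        lorentzMatrix_last_last]
      norm_num
    · simp [hw1 _ h0, hw1 _ hl]
    · simpa using hw0
  refine ⟨(√(lorentz (w : Ambient n) w))⁻¹ • w, V.smul_mem _ w.2, fun a ha => ?_, ?_⟩
  · simp [hw1 a ha]
  · have := Real.mul_self_sqrt hpos.le
    have h2 := (Real.sqrt_pos.2 hpos).ne'
    simp only [lorentz_smul_left, lorentz_smul_right]
    field_simp
    nlinarith

/-- Once A contains both light-like indices, the discarded indices carry only diagonal entries. The
Gram matrix of a partial frame is therefore its own inverse, which makes the orthogonal projection
explicit. -/
theorem sum_lorentzMatrix_mul {A : Finset (Fin (n + 2))} (h0 : 0 ∈ A)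
    (hl : Fin.last (n + 1) ∈ A) {a : Fin (n + 2)} (ha : a ∈ A) (c : Fin (n + 2)) :
    ∑ b ∈ A, lorentzMatrix n a b * lorentzMatrix n b c = if a = c then 1 else 0 := by
  have h1 : ∑ b ∈ A, lorentzMatrix n a b * lorentzMatrix n b c =
      ∑ b, lorentzMatrix n a b * lorentzMatrix n b c := by
    refine Finset.sum_subset (Finset.subset_univ _) fun b _ hb => ?_
    have hb0 : b ≠ 0 := fun h => hb (h ▸ h0)
    have hbl : b ≠ Fin.last (n + 1) := fun h => hb (h ▸ hl)
    have hba : b ≠ a := fun h => hb (h ▸ ha)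
    rw [lorentzMatrix_symm, lorentzMatrix_of_ne hb0 hbl hba, zero_mul]
  rw [h1, ← Matrix.mul_apply, lorentzMatrix_mul_self, Matrix.one_apply]

/-- Gram–Schmidt with a parameter: a unit normal at x₀ is projected to the orthogonal complement of
the partial frame at nearby points, then normalized where its square is still positive. -/
theorem exists_partialFrame_insert {A : Finset (Fin (n + 2))} {e : Fin (n + 2) → ℝ → Ambient n}
    {U : Set ℝ} (hU : IsOpen U) {x₀ : ℝ} (hx₀ : x₀ ∈ U) (hs : ∀ a, ContDiffOn ℝ ∞ (e a) U)
    (he : ∀ x ∈ U, IsPartialFrame A fun a => e a x) (h0 : 0 ∈ A) (hl : Fin.last (n + 1) ∈ A)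
    {j : Fin (n + 2)} (hj : j ∉ A) :
    ∃ U' ⊆ U, IsOpen U' ∧ x₀ ∈ U' ∧ ∃ e' : Fin (n + 2) → ℝ → Ambient n,
      (∀ a ∈ A, e' a = e a) ∧ (∀ a, ContDiffOn ℝ ∞ (e' a) U') ∧
      ∀ x ∈ U', IsPartialFrame (insert j A) fun a => e' a x := by
  have hj0 : j ≠ 0 := fun h => hj (h ▸ h0)
  have hjl : j ≠ Fin.last (n + 1) := fun h => hj (h ▸ hl)
  obtain ⟨w₀, -, hw₀, hw₁⟩ := exists_unit_orthogonal ⊤ (he x₀ hx₀) h0 hl (by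
    have : A.card < (Finset.univ : Finset (Fin (n + 2))).card :=
      Finset.card_lt_card ⟨Finset.subset_univ _, fun h => hj (h (Finset.mem_univ j))⟩
    simpa using this)
  set w : ℝ → Ambient n := fun x => w₀ - ∑ a ∈ A, ∑ b ∈ A,
    (lorentzMatrix n a b * lorentz w₀ (e a x)) • e b x with hw
  have hws : ContDiffOn ℝ ∞ w U := by
    refine contDiffOn_const.sub (ContDiffOn.sum fun a _ => ContDiffOn.sum fun b _ => ?_)
    exact (contDiffOn_const.mul (contDiffOn_const.lorentz (hs a))).smul (hs b)
  have hwx : w x₀ = w₀ := by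
    simp only [hw, sub_eq_self]
    refine Finset.sum_eq_zero fun a ha => Finset.sum_eq_zero fun b _ => ?_
    rw [lorentz_comm, hw₀ a ha]; simp
  have hwo : ∀ x ∈ U, ∀ c ∈ A, lorentz (e c x) (w x) = 0 := by
    intro x hx c hc
    simp only [hw, lorentz_sub_right, lorentz_sum_right, lorentz_smul_right]
    have : ∀ a ∈ A, ∑ b ∈ A, lorentzMatrix n a b * lorentz w₀ (e a x) * lorentz (e c x) (e b x)
        = if a = c then lorentz w₀ (e a x) else 0 := by
      intro a ha
      have h2 := sum_lorentzMatrix_mul h0 hl ha c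
      rw [← mul_one (lorentz w₀ (e a x)), ← mul_ite_zero, ← h2, Finset.mul_sum]
      refine Finset.sum_congr rfl fun b hb => ?_
      rw [lorentz_comm (e c x), he x hx b hb c hc]; ring
    rw [Finset.sum_congr rfl this]
    simp [hc, lorentz_comm]
  have hopen : IsOpen (U ∩ (fun x => lorentz (w x) (w x)) ⁻¹' Set.Ioi 0) :=
    (hws.lorentz hws).continuousOn.isOpen_inter_preimage hU isOpen_Ioi
  refine ⟨_, Set.inter_subset_left, hopen, ⟨hx₀, by simp [hwx, hw₁]⟩,
    Function.update e j fun x => (√(lorentz (w x) (w x)))⁻¹ • w x, fun a ha => ?_, fun a => ?_,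
    fun x hx a ha b hb => ?_⟩
  · exact Function.update_of_ne (fun h : a = j => hj (h ▸ ha)) _ _
  · rcases eq_or_ne a j with rfl | h
    · rw [Function.update_self]
      refine ContDiffOn.smul (ContDiffOn.inv (ContDiffOn.sqrt ?_ fun x hx => hx.2.ne')
        fun x hx => (Real.sqrt_pos.2 hx.2).ne') (hws.mono Set.inter_subset_left)
      exact (hws.lorentz hws).mono Set.inter_subset_left
    · rw [Function.update_of_ne h]
      exact (hs a).mono Set.inter_subset_left
  · have hxw : 0 < lorentz (w x) (w x) := hx.2
    have h2 := (Real.sqrt_pos.2 hxw).ne'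
    have h3 := Real.mul_self_sqrt hxw.le
    beta_reduce
    rcases Finset.mem_insert.1 ha with rfl | ha' <;> rcases Finset.mem_insert.1 hb with rfl | hb'
    · simp only [Function.update_self, lorentz_smul_left, lorentz_smul_right,
        lorentzMatrix_self hj0 hjl]
      field_simp
      nlinarith
    · have : b ≠ a := fun h => hj (h ▸ hb')
      rw [Function.update_self, Function.update_of_ne this, lorentz_smul_left, lorentz_comm _ (e b x),
        hwo x hx.1 b hb', lorentzMatrix_of_ne hj0 hjl this.symm, mul_zero]
    · have : a ≠ b := fun h => hj (h ▸ ha')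
      rw [Function.update_self, Function.update_of_ne this, lorentz_smul_right,
        hwo x hx.1 a ha', lorentzMatrix_symm, lorentzMatrix_of_ne hj0 hjl this.symm, mul_zero]
    · rw [Function.update_of_ne (fun h : a = j => hj (h ▸ ha')),
        Function.update_of_ne (fun h : b = j => hj (h ▸ hb'))]
      exact he x hx.1 a ha' b hb'

theorem exists_partialFrame_univ {x₀ : ℝ} {A : Finset (Fin (n + 2))} (h0 : 0 ∈ A)
    (hl : Fin.last (n + 1) ∈ A) {e : Fin (n + 2) → ℝ → Ambient n}
    {U : Set ℝ} (hU : IsOpen U) (hx₀ : x₀ ∈ U) (hs : ∀ a, ContDiffOn ℝ ∞ (e a) U)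
    (he : ∀ x ∈ U, IsPartialFrame A fun a => e a x) :
    ∃ U' ⊆ U, IsOpen U' ∧ x₀ ∈ U' ∧ ∃ e' : Fin (n + 2) → ℝ → Ambient n,
      (∀ a ∈ A, e' a = e a) ∧ (∀ a, ContDiffOn ℝ ∞ (e' a) U') ∧
      ∀ x ∈ U', IsPartialFrame Finset.univ fun a => e' a x := by
  induction hm : Aᶜ.card generalizing A e U with
  | zero =>
    have hA : A = Finset.univ := by
      rwa [Finset.card_eq_zero, Finset.compl_eq_empty_iff] at hm
    exact ⟨U, subset_rfl, hU, hx₀, e, fun _ _ => rfl, hs, hA ▸ he⟩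
  | succ m ih =>
    obtain ⟨j, hj⟩ := Finset.card_pos.1 (by omega : 0 < Aᶜ.card)
    obtain ⟨U₁, hU₁, hO₁, hx₁, e₁, hA₁, hs₁, he₁⟩ :=
      exists_partialFrame_insert hU hx₀ hs he h0 hl (Finset.mem_compl.1 hj)
    obtain ⟨U₂, hU₂, hO₂, hx₂, e₂, hA₂, hs₂, he₂⟩ :=
      ih (Finset.mem_insert_of_mem h0) (Finset.mem_insert_of_mem hl) hO₁ hx₁ hs₁ he₁ (by
        rw [Finset.compl_insert, Finset.card_erase_of_mem hj, hm]; rfl)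
    exact ⟨U₂, hU₂.trans hU₁, hO₂, hx₂, e₂, fun a ha =>
      (hA₂ a (Finset.mem_insert_of_mem ha)).trans (hA₁ a ha), hs₂, he₂⟩

/-! ### Smooth frames in the Möbius group. -/

theorem det_mul_self_of_lorentz {G : Mat n}
    (hG : G.transpose * lorentzMatrix n * G = lorentzMatrix n) : G.det * G.det = 1 := by
  have h1 := congrArg Matrix.det (lorentzMatrix_mul_self (n := n))
  have h2 := congrArg Matrix.det hG
  simp only [Matrix.det_mul, Matrix.det_transpose, Matrix.det_one] at h1 h2
  linear_combination (1 - G.det * G.det) * h1 + (lorentzMatrix n).det * h2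

/-- A smooth partial frame that does not use the index `j` extends to a smooth map into the
Möbius group. -/
theorem exists_moebius_frame {x₀ : ℝ} {A : Finset (Fin (n + 2))} (h0 : 0 ∈ A)
    (hl : Fin.last (n + 1) ∈ A) {j : Fin (n + 2)} (hj : j ∉ A) {e : Fin (n + 2) → ℝ → Ambient n}
    {U : Set ℝ} (hU : IsOpen U) (hx₀ : x₀ ∈ U) (hs : ∀ a, ContDiffOn ℝ ∞ (e a) U)
    (he : ∀ x ∈ U, IsPartialFrame A fun a => e a x)
    (hc0 : ∀ x ∈ U, e 0 x ∈ lightCone n) (hcl : ∀ x ∈ U, e (Fin.last (n + 1)) x ∈ lightCone n) :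
    ∃ U' ⊆ U, IsOpen U' ∧ x₀ ∈ U' ∧ ∃ E : ℝ → Mat n,
      (∀ i k, ContDiffOn ℝ ∞ (fun x => E x i k) U') ∧ (∀ x ∈ U', E x ∈ moebius n) ∧
      ∀ a ∈ A, column E a = e a := by
  obtain ⟨U₁, hU₁, hO₁, hx₁, e₁, hA₁, hs₁, he₁⟩ := exists_partialFrame_univ h0 hl hU hx₀ hs he
  have hj0 : j ≠ 0 := fun h => hj (h ▸ h0)
  have hjl : j ≠ Fin.last (n + 1) := fun h => hj (h ▸ hl)
  have hsm : ∀ i k, ContDiffOn ℝ ∞ (fun x => e₁ k x i) U₁ := fun i k =>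
    (contDiffOn_pi.1 (hs₁ k)) i
  have hLor : ∀ x ∈ U₁, (Matrix.of fun i k => e₁ k x i).transpose * lorentzMatrix n *
      (Matrix.of fun i k => e₁ k x i) = lorentzMatrix n := by
    intro x hx
    ext a b
    rw [transpose_mul_lorentzMatrix_mul]
    exact he₁ x hx a (Finset.mem_univ _) b (Finset.mem_univ _)
  -- This determinant is ±1. Multiplying the free column j by the constant s gives determinant 1 at
  -- x₀ without affecting the prescribed columns or the scalar products; on the open set where the
  -- determinant is positive it remains 1.
  set s : ℝ := (Matrix.of fun i k => e₁ k x₀ i).det with hsdef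
  have hss : s * s = 1 := det_mul_self_of_lorentz (hLor x₀ hx₁)
  set E : ℝ → Mat n := fun x => Matrix.of fun i k => if k = j then s * e₁ k x i else e₁ k x i
    with hE
  have hEdet : ∀ x, (E x).det = s * (Matrix.of fun i k => e₁ k x i).det := by
    intro x
    have : E x = (Matrix.of fun i k => e₁ k x i).updateCol j (s • fun i => e₁ j x i) := by
      ext i k
      by_cases h : k = j
      · subst h; simp [hE]
      · simp [hE, h]
    rw [this, Matrix.det_updateCol_smul]
    congr 2
    ext i k
    by_cases h : k = j
    · subst h; simp
    · simp [h]
  have hEs : ∀ i k, ContDiffOn ℝ ∞ (fun x => E x i k) U₁ := by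
    intro i k
    by_cases h : k = j
    · simpa [hE, h] using contDiffOn_const.mul (hsm i j)
    · simpa [hE, h] using hsm i k
  have hcol : ∀ a, a ≠ j → ∀ x, (fun i => E x i a) = e₁ a x := fun a ha x => by
    ext i; simp [hE, ha]
  have hEL : ∀ x ∈ U₁, (E x).transpose * lorentzMatrix n * E x = lorentzMatrix n := by
    intro x hx
    ext a b
    have h := he₁ x hx a (Finset.mem_univ _) b (Finset.mem_univ _)
    have hcj : (fun i => E x i j) = s • e₁ j x := by ext i; simp [hE]
    rw [transpose_mul_lorentzMatrix_mul]
    by_cases ha : a = j <;> by_cases hb : b = j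
    · subst ha; subst hb
      rw [hcj, lorentz_smul_left, lorentz_smul_right, h, ← mul_assoc, hss, one_mul]
    · subst ha
      rw [hcj, hcol b hb, lorentz_smul_left, h, lorentzMatrix_of_ne hj0 hjl (Ne.symm hb), mul_zero]
    · subst hb
      rw [hcj, hcol a ha, lorentz_smul_right, h, lorentzMatrix_symm,
        lorentzMatrix_of_ne hj0 hjl (Ne.symm ha), mul_zero]
    · rw [hcol a ha, hcol b hb, h]
  have hdc : ContinuousOn (fun x => (E x).det) U₁ := by
    have : ContinuousOn E U₁ :=
      continuousOn_pi.2 fun i => continuousOn_pi.2 fun k => (hEs i k).continuousOn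
    exact (Continuous.matrix_det continuous_id).comp_continuousOn this
  refine ⟨U₁ ∩ (fun x => (E x).det) ⁻¹' Set.Ioi 0, Set.inter_subset_left.trans hU₁,
    hdc.isOpen_inter_preimage hO₁ isOpen_Ioi, ⟨hx₁, ?pos⟩, E,
    fun i k => (hEs i k).mono Set.inter_subset_left, fun x hx => ?_, fun a ha => ?_⟩
  case pos => rw [Set.mem_preimage, hEdet, ← hsdef, hss]; exact one_pos (α := ℝ)
  · refine mem_moebius_of (hEL x hx.1) ?_ ?_ ?_
    · have h1 := det_mul_self_of_lorentz (hEL x hx.1)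
      have h2 : 0 < (E x).det := hx.2
      nlinarith
    · rw [hcol 0 hj0.symm, hA₁ 0 h0]; exact hc0 x (hU₁ hx.1)
    · rw [hcol _ hjl.symm, hA₁ _ hl]; exact hcl x (hU₁ hx.1)
  · ext1 x
    rw [← hA₁ a ha, ← hcol a (fun h => hj (h ▸ ha)) x]
    rfl

/-! ### Combinations with smooth coefficients -/

section SmoothComb

variable {E : Type*} [NormedAddCommGroup E] [NormedSpace ℝ E]

/-- On `U`, the map `G` is a combination of `Y 0, …, Y (k - 1)` with smooth coefficients. -/
def SmoothComb (U : Set ℝ) (Y : ℕ → ℝ → E) (k : ℕ) (G : ℝ → E) : Prop :=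
  ∃ b : ℕ → ℝ → ℝ, (∀ j, ContDiffOn ℝ ∞ (b j) U) ∧
    ∀ x ∈ U, G x = ∑ j ∈ Finset.range k, b j x • Y j x

variable {U : Set ℝ} {Y : ℕ → ℝ → E} {k : ℕ} {G H : ℝ → E}

theorem SmoothComb.congr (hG : SmoothComb U Y k G) (h : ∀ x ∈ U, H x = G x) :
    SmoothComb U Y k H := by
  obtain ⟨b, hb, hG⟩ := hG
  exact ⟨b, hb, fun x hx => (h x hx).trans (hG x hx)⟩

theorem SmoothComb.zero : SmoothComb U Y k (fun _ => 0) :=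
  ⟨fun _ _ => 0, fun _ => contDiffOn_const, fun _ _ => by simp⟩

theorem SmoothComb.add (hG : SmoothComb U Y k G) (hH : SmoothComb U Y k H) :
    SmoothComb U Y k (fun x => G x + H x) := by
  obtain ⟨b, hb, hG⟩ := hG
  obtain ⟨c, hc, hH⟩ := hH
  refine ⟨fun j x => b j x + c j x, fun j => (hb j).add (hc j), fun x hx => ?_⟩
  simp [hG x hx, hH x hx, add_smul, Finset.sum_add_distrib]

theorem SmoothComb.smul (hG : SmoothComb U Y k G) {a : ℝ → ℝ} (ha : ContDiffOn ℝ ∞ a U) :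
    SmoothComb U Y k (fun x => a x • G x) := by
  obtain ⟨b, hb, hG⟩ := hG
  refine ⟨fun j x => a x * b j x, fun j => ha.mul (hb j), fun x hx => ?_⟩
  simp [hG x hx, mul_smul, Finset.smul_sum]

theorem SmoothComb.const_smul (hG : SmoothComb U Y k G) (a : ℝ) :
    SmoothComb U Y k (fun x => a • G x) := hG.smul contDiffOn_const

theorem SmoothComb.neg (hG : SmoothComb U Y k G) : SmoothComb U Y k (fun x => -G x) :=
  (hG.const_smul (-1)).congr fun x _ => by simp

theorem SmoothComb.sub (hG : SmoothComb U Y k G) (hH : SmoothComb U Y k H) :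
    SmoothComb U Y k (fun x => G x - H x) :=
  (hG.add hH.neg).congr fun _ _ => sub_eq_add_neg _ _

theorem SmoothComb.sum {ι : Type*} {s : Finset ι} {G : ι → ℝ → E}
    (hG : ∀ i ∈ s, SmoothComb U Y k (G i)) : SmoothComb U Y k (fun x => ∑ i ∈ s, G i x) := by
  classical
  induction s using Finset.induction_on with
  | empty => simpa using SmoothComb.zero
  | insert i s hi ih =>
    simp only [Finset.sum_insert hi]
    exact (hG i (Finset.mem_insert_self _ _)).add
      (ih fun j hj => hG j (Finset.mem_insert_of_mem hj))

theorem SmoothComb.basis {j : ℕ} (hj : j < k) : SmoothComb U Y k (Y j) := by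
  refine ⟨fun i _ => if i = j then 1 else 0, fun i => contDiffOn_const, fun x _ => ?_⟩
  simp [hj]

theorem SmoothComb.mono (hG : SmoothComb U Y k G) {l : ℕ} (h : k ≤ l) : SmoothComb U Y l G := by
  obtain ⟨b, hb, hG⟩ := hG
  exact (SmoothComb.sum fun j hj => (SmoothComb.basis
    (lt_of_lt_of_le (Finset.mem_range.1 hj) h)).smul (hb j)).congr hG

theorem SmoothComb.mem_span (hG : SmoothComb U Y k G) {x : ℝ} (hx : x ∈ U) :
    G x ∈ Submodule.span ℝ ((fun j => Y j x) '' Set.Iio k) := by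
  obtain ⟨b, -, hG⟩ := hG
  rw [hG x hx]
  exact Submodule.sum_mem _ fun j hj => Submodule.smul_mem _ _
    (Submodule.subset_span ⟨j, Finset.mem_range.1 hj, rfl⟩)

theorem deriv_congr_of_isOpen (hU : IsOpen U) (h : ∀ x ∈ U, G x = H x) {x : ℝ} (hx : x ∈ U) :
    deriv G x = deriv H x :=
  Filter.EventuallyEq.deriv_eq (Filter.eventually_of_mem (hU.mem_nhds hx) h)

theorem SmoothComb.deriv (hU : IsOpen U) (hG : SmoothComb U Y k G)
    (hY : ∀ j < k, ContDiffOn ℝ ∞ (Y j) U) {l : ℕ} (hkl : k ≤ l)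
    (hl : ∀ j < k, SmoothComb U Y l (deriv (Y j))) : SmoothComb U Y l (deriv G) := by
  obtain ⟨b, hb, hG⟩ := hG
  have h1 : SmoothComb U Y l (fun x => ∑ j ∈ Finset.range k,
      (b j x • _root_.deriv (Y j) x + _root_.deriv (b j) x • Y j x)) :=
    SmoothComb.sum fun j hj => ((hl j (Finset.mem_range.1 hj)).smul (hb j)).add
      ((SmoothComb.basis (lt_of_lt_of_le (Finset.mem_range.1 hj) hkl)).smul
        ((hb j).deriv_infty hU))
  refine h1.congr fun x hx => ?_
  rw [deriv_congr_of_isOpen hU hG hx]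
  refine HasDerivAt.deriv (HasDerivAt.fun_sum fun j hj => ?_)
  exact ((hb j).hasDerivAt_of_isOpen hU hx).smul
    ((hY j (Finset.mem_range.1 hj)).hasDerivAt_of_isOpen hU hx)

/-! ### Chains -/

/-- On `U`, the derivative of `Y k` is `c k • Y (k + 1)` up to a combination of
`Y 0, …, Y k` with smooth coefficients, for `k < m`. -/
structure IsChain (U : Set ℝ) (Y : ℕ → ℝ → E) (c : ℕ → ℝ → ℝ) (m : ℕ) : Prop where
  isOpen : IsOpen U
  smooth : ∀ k ≤ m, ContDiffOn ℝ ∞ (Y k) U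
  coeff : ∀ k < m, ContDiffOn ℝ ∞ (c k) U
  step : ∀ k < m, SmoothComb U Y (k + 1) fun x => deriv (Y k) x - c k x • Y (k + 1) x

theorem IsChain.deriv_mem {c : ℕ → ℝ → ℝ} {m : ℕ} (h : IsChain U Y c m) {k : ℕ} (hk : k < m) :
    SmoothComb U Y (k + 2) (deriv (Y k)) :=
  (((h.step k hk).mono (Nat.le_succ _)).add
    ((SmoothComb.basis (Nat.lt_succ_self (k + 1))).smul (h.coeff k hk))).congr fun x _ => by simp

/-- Each differentiation raises the top index by one and multiplies the leading coefficient by c k,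
while lower terms produce at most Y k. The jet of Y 0 is thus a triangular transform of the chain.
-/
theorem IsChain.iteratedDeriv {c : ℕ → ℝ → ℝ} {m : ℕ} (h : IsChain U Y c m) {k : ℕ}
    (hk : k ≤ m) : SmoothComb U Y k fun x =>
      iteratedDeriv k (Y 0) x - (∏ i ∈ Finset.range k, c i x) • Y k x := by
  induction k with
  | zero => exact SmoothComb.zero.congr fun x _ => by simp
  | succ k ih =>
    have hk' : k < m := hk
    obtain hI := ih hk'.le
    have hp : ContDiffOn ℝ ∞ (fun x => ∏ i ∈ Finset.range k, c i x) U :=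
      contDiffOn_prod fun i hi => h.coeff i ((Finset.mem_range.1 hi).trans hk')
    have hd := hI.deriv h.isOpen (fun j hj => h.smooth j (by omega)) (Nat.le_succ k)
      fun j hj => (h.deriv_mem (by omega : j < m)).mono (by omega)
    have hD : SmoothComb U Y (k + 1) fun x =>
        (∏ i ∈ Finset.range k, c i x) • (deriv (Y k) x - c k x • Y (k + 1) x) +
        deriv (fun x => ∏ i ∈ Finset.range k, c i x) x • Y k x :=
      ((h.step k hk').smul hp).add
        ((SmoothComb.basis (Nat.lt_succ_self k)).smul (hp.deriv_infty h.isOpen))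
    refine (hd.add hD).congr fun x hx => ?_
    have hit : ContDiffOn ℝ ∞ (_root_.iteratedDeriv k (Y 0)) U := by
      obtain ⟨b, hb, hG⟩ := hI
      refine ContDiffOn.congr (f := fun x => ∑ j ∈ Finset.range k, b j x • Y j x +
        (∏ i ∈ Finset.range k, c i x) • Y k x) ?_ fun x hx => by rw [← hG x hx]; simp
      exact (ContDiffOn.sum fun j hj => (hb j).smul
        (h.smooth j ((Finset.mem_range.1 hj).trans hk').le)).add (hp.smul (h.smooth k hk'.le))
    have e := (((hit.hasDerivAt_of_isOpen h.isOpen hx)).sub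
      ((hp.hasDerivAt_of_isOpen h.isOpen hx).smul
        ((h.smooth k hk'.le).hasDerivAt_of_isOpen h.isOpen hx))).deriv
    rw [show deriv (fun x => _root_.iteratedDeriv k (Y 0) x -
      (∏ i ∈ Finset.range k, c i x) • Y k x) x = _ from e, iteratedDeriv_succ,
      Finset.prod_range_succ, mul_smul, smul_sub]
    abel

/-- A triangular change of vectors with nonzero diagonal preserves the span. Two chains with the
same first member can then be compared through its derivatives, without relating the other members
directly. -/
theorem span_image_Iio_eq {u v : ℕ → E} {m : ℕ} {c : ℕ → ℝ} (hc : ∀ k < m, c k ≠ 0)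
    (h : ∀ k < m, v k - c k • u k ∈ Submodule.span ℝ (u '' Set.Iio k)) :
    Submodule.span ℝ (v '' Set.Iio m) = Submodule.span ℝ (u '' Set.Iio m) := by
  induction m with
  | zero => simp
  | succ m ih =>
    have hI := ih (fun k hk => hc k (by omega)) fun k hk => h k (by omega)
    have hIio : (Set.Iio (m + 1) : Set ℕ) = insert m (Set.Iio m) := by
      ext; simp
    rw [hIio, Set.image_insert_eq, Set.image_insert_eq, Submodule.span_insert,
      Submodule.span_insert, hI]
    have hm := h m (Nat.lt_succ_self m)
    apply le_antisymm
    · refine sup_le ?_ le_sup_right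
      rw [Submodule.span_singleton_le_iff_mem, ← sub_add_cancel (v m) (c m • u m)]
      exact Submodule.add_mem _ (Submodule.mem_sup_right hm)
        (Submodule.smul_mem _ _ (Submodule.mem_sup_left (Submodule.mem_span_singleton_self _)))
    · refine sup_le ?_ le_sup_right
      rw [Submodule.span_singleton_le_iff_mem]
      have : u m = (c m)⁻¹ • (v m - (v m - c m • u m)) := by
        rw [sub_sub_cancel, smul_smul, inv_mul_cancel₀ (hc m (Nat.lt_succ_self m)), one_smul]
      rw [this]
      exact Submodule.smul_mem _ _ (Submodule.sub_mem _
        (Submodule.mem_sup_left (Submodule.mem_span_singleton_self _))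
        (Submodule.mem_sup_right hm))

/-- The osculating space of a chain is spanned by the derivatives of its first member. -/
theorem IsChain.span_eq {c : ℕ → ℝ → ℝ} {m : ℕ} (h : IsChain U Y c m) {x : ℝ} (hx : x ∈ U)
    (hc : ∀ k < m, c k x ≠ 0) :
    Submodule.span ℝ ((fun k => _root_.iteratedDeriv k (Y 0) x) '' Set.Iio (m + 1)) =
      Submodule.span ℝ ((fun k => Y k x) '' Set.Iio (m + 1)) := by
  refine span_image_Iio_eq (c := fun k => ∏ i ∈ Finset.range k, c i x) (fun k hk => ?_)
    fun k hk => (h.iteratedDeriv (by omega)).mem_span hx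
  exact Finset.prod_ne_zero_iff.2 fun i hi => hc i (by have := Finset.mem_range.1 hi; omega)

/-- A family of vectors that satisfies a linear differential equation spans a constant space. -/
theorem span_le_of_deriv_mem [FiniteDimensional ℝ E] {I : Set ℝ} (hI : IsOpen I)
    (hI' : I.OrdConnected) {Y : ℕ → ℝ → E} {m : ℕ}
    (hY : ∀ j < m, ContDiffOn ℝ ∞ (Y j) I)
    (h : ∀ j < m, SmoothComb I Y m (deriv (Y j))) {x y : ℝ} (hx : x ∈ I) (hy : y ∈ I) :
    Submodule.span ℝ ((fun k => Y k y) '' Set.Iio m) ≤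
      Submodule.span ℝ ((fun k => Y k x) '' Set.Iio m) := by
  choose! A hA hd using h
  rw [Submodule.span_le]
  rintro _ ⟨j, hj, rfl⟩
  by_contra hcon
  -- A functional that kills the span at x but not Y j y. Its values on the Y i solve a homogeneous
  -- linear system with zero data at x, so they vanish at y as well.
  obtain ⟨l, hl0, hl⟩ := Submodule.exists_le_ker_of_notMem hcon
  apply hl0
  let L : E →L[ℝ] ℝ := LinearMap.toContinuousLinearMap l
  -- The uniqueness theorem wants the initial point x in the interior, so the interval between x and
  -- y is enlarged slightly inside the open set I.
  obtain ⟨a, b, ha, hb, hab, hxab, hyab⟩ : ∃ a b, a ∈ I ∧ b ∈ I ∧ Set.Icc a b ⊆ I ∧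
      x ∈ Set.Ioo a b ∧ y ∈ Set.Icc a b := by
    have hmin : min x y ∈ I := by rcases min_choice x y with h | h <;> rw [h] <;> assumption
    have hmax : max x y ∈ I := by rcases max_choice x y with h | h <;> rw [h] <;> assumption
    obtain ⟨ε, hε, hε'⟩ := Metric.isOpen_iff.1 hI _ hmin
    obtain ⟨δ, hδ, hδ'⟩ := Metric.isOpen_iff.1 hI _ hmax
    have h1 : min x y - ε / 2 ∈ I := hε' (by
      rw [Metric.mem_ball, Real.dist_eq, sub_sub_cancel_left, abs_neg, abs_of_pos] <;> linarith)
    have h2 : max x y + δ / 2 ∈ I := hδ' (by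
      rw [Metric.mem_ball, Real.dist_eq, add_sub_cancel_left, abs_of_pos] <;> linarith)
    refine ⟨_, _, h1, h2, hI'.out h1 h2, ⟨?_, ?_⟩, ?_, ?_⟩ <;>
      linarith [min_le_left x y, min_le_right x y, le_max_left x y, le_max_right x y]
  let v : ℝ → (Fin m → ℝ) → (Fin m → ℝ) := fun t z i => ∑ k : Fin m, A i k t * z k
  -- The sum of all absolute entries dominates every row sum, hence the operator norm for the sup
  -- norm; compactness then gives one Lipschitz constant.
  let S : ℝ → ℝ := fun t => ∑ i : Fin m, ∑ k : Fin m, |A i k t|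
  have hS : ContinuousOn S (Set.Icc a b) := continuousOn_finsetSum _ fun i _ =>
    continuousOn_finsetSum _ fun k _ => ((hA i i.2 k).continuousOn.mono hab).abs
  obtain ⟨C, hC⟩ := isCompact_Icc.bddAbove_image hS
  have hC' : ∀ t ∈ Set.Icc a b, S t ≤ C := fun t ht => hC ⟨t, ht, rfl⟩
  have hlip : ∀ t ∈ Set.Ioo a b, LipschitzOnWith C.toNNReal (v t) Set.univ := by
    intro t ht
    refine LipschitzOnWith.of_dist_le_mul fun z _ w _ => ?_
    refine (dist_pi_le_iff (by positivity)).2 fun i => ?_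
    have h1 : v t z i - v t w i = ∑ k : Fin m, A i k t * (z k - w k) := by
      simp [v, mul_sub, Finset.sum_sub_distrib]
    rw [Real.dist_eq, h1]
    refine (Finset.abs_sum_le_sum_abs _ _).trans ?_
    calc ∑ k : Fin m, |A i k t * (z k - w k)|
        ≤ ∑ k : Fin m, |A i k t| * dist z w := by
          refine Finset.sum_le_sum fun k _ => ?_
          rw [abs_mul, ← Real.dist_eq]
          gcongr
          exact dist_le_pi_dist z w k
      _ = (∑ k : Fin m, |A i k t|) * dist z w := by rw [Finset.sum_mul]
      _ ≤ C.toNNReal * dist z w := by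
          gcongr
          refine le_trans ?_ (Real.le_coe_toNNReal C)
          refine le_trans ?_ (hC' t (Set.Ioo_subset_Icc_self ht))
          exact Finset.single_le_sum (f := fun i : Fin m => ∑ k : Fin m, |A i k t|)
            (fun i _ => Finset.sum_nonneg fun k _ => abs_nonneg _) (Finset.mem_univ i)
  have hcont : ContinuousOn (fun t (i : Fin m) => L (Y i t)) (Set.Icc a b) :=
    continuousOn_pi.2 fun i => L.continuous.comp_continuousOn
      ((hY i i.2).continuousOn.mono hab)
  have key := ODE_solution_unique_of_mem_Icc (v := v) (s := fun _ => Set.univ) (t₀ := x)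
    (f := fun t (i : Fin m) => L (Y i t)) (g := fun _ => 0) hlip hxab hcont (fun t ht => ?_)
    (fun _ _ => Set.mem_univ _) continuousOn_const (fun t ht => ?_)
    (fun _ _ => Set.mem_univ _) ?_ hyab
  · exact congrFun key ⟨j, hj⟩
  · rw [hasDerivAt_pi]
    intro i
    have htI : t ∈ I := hab (Set.Ioo_subset_Icc_self ht)
    have h1 := L.hasFDerivAt.comp_hasDerivAt t ((hY i i.2).hasDerivAt_of_isOpen hI htI)
    have h2 : L (deriv (Y i) t) = v t (fun i => L (Y i t)) i := by
      rw [hd i i.2 t htI, map_sum, ← Fin.sum_univ_eq_sum_range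
        (fun k => L (A i k t • Y k t))]
      simp [v]
    exact h2 ▸ h1
  · have : v t 0 = 0 := by ext i; simp [v]
    rw [this]
    exact hasDerivAt_const _ _
  · ext i
    exact hl (Submodule.subset_span ⟨i, i.2, rfl⟩)

end SmoothComb

/-! ### Gram determinants -/

/-- The determinant of the Gram matrix of `v 0, v 1, v 2, v 3`. -/
noncomputable def gramDet (v : ℕ → Ambient n) : ℝ :=
  (Matrix.of fun i j : Fin 4 => lorentz (v i) (v j)).det

/-- The two Gram matrices are related by T · Tᵗ with T lower triangular of diagonal c. -/
theorem gramDet_triangular {u v : ℕ → Ambient n} {c : ℕ → ℝ}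
    (h : ∀ k < 4, ∃ t : ℕ → ℝ, v k - c k • u k = ∑ j ∈ Finset.range k, t j • u j) :
    gramDet v = (∏ k ∈ Finset.range 4, c k) ^ 2 * gramDet u := by
  choose! t ht using h
  let T : Matrix (Fin 4) (Fin 4) ℝ := Matrix.of fun i j =>
    if i = j then c i else if j < i then t i j else 0
  have hv : ∀ i : Fin 4, v i = ∑ j, T i j • u j := by
    intro i
    rw [← sub_add_cancel (v i) (c i • u i), ht i i.2]
    fin_cases i <;> simp [T, Fin.sum_univ_four, Finset.sum_range_succ]
  have hT : T.det = ∏ k ∈ Finset.range 4, c k := by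
    rw [Matrix.det_of_isLowerTriangular, ← Fin.prod_univ_eq_prod_range]
    · simp [T]
    · intro i j hij
      have hij' : i < j := hij
      simp [T, hij'.ne, hij'.le]
  have hG : (Matrix.of fun i j : Fin 4 => lorentz (v i) (v j)) =
      T * (Matrix.of fun i j : Fin 4 => lorentz (u i) (u j)) * T.transpose := by
    ext i j
    simp only [Matrix.of_apply, hv, Matrix.mul_apply, Matrix.transpose_apply, lorentz_sum_left,
      lorentz_sum_right, lorentz_smul_left, lorentz_smul_right, Finset.sum_mul, Finset.mul_sum]
    refine Finset.sum_congr rfl fun _ _ => Finset.sum_congr rfl fun _ _ => by ring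
  rw [gramDet, hG, Matrix.det_mul, Matrix.det_mul, Matrix.det_transpose, hT, gramDet]
  ring

/-- The leading coefficients of the first four derivatives are 1, c₀, c₀c₁, c₀c₁c₂. Only they
matter, so Gram determinants of jets can be computed in any convenient adapted chain. -/
theorem IsChain.gramDet_eq {U : Set ℝ} {Y : ℕ → ℝ → Ambient n} {c : ℕ → ℝ → ℝ}
    (h : IsChain U Y c 3) {x : ℝ} (hx : x ∈ U) :
    gramDet (fun k => _root_.iteratedDeriv k (Y 0) x) =
      (c 0 x ^ 3 * c 1 x ^ 2 * c 2 x) ^ 2 * gramDet fun k => Y k x := by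
  rw [gramDet_triangular (u := fun k => Y k x)
    (c := fun k => ∏ i ∈ Finset.range k, c i x) fun k hk => ?_]
  · simp only [Finset.prod_range_succ, Finset.prod_range_zero]
    ring
  · obtain ⟨b, -, hb⟩ := h.iteratedDeriv (by omega : k ≤ 3)
    exact ⟨fun j => b j x, hb x hx⟩

/-! ### Indices -/

theorem val_one : ((1 : Fin (n + 2)) : ℕ) = 1 := by simp

theorem val_two (hn : 3 ≤ n) : ((2 : Fin (n + 2)) : ℕ) = 2 :=
  Nat.mod_eq_of_lt (by omega : 2 < n + 2)

theorem one_ne_last (hn : 3 ≤ n) : (1 : Fin (n + 2)) ≠ Fin.last (n + 1) := by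
  rw [Ne, Fin.ext_iff, val_one, Fin.val_last]; omega

theorem two_ne_last (hn : 3 ≤ n) : (2 : Fin (n + 2)) ≠ Fin.last (n + 1) := by
  rw [Ne, Fin.ext_iff, val_two hn, Fin.val_last]; omega

theorem two_ne_zero' (hn : 3 ≤ n) : (2 : Fin (n + 2)) ≠ 0 := by
  rw [Ne, Fin.ext_iff, val_two hn]; simp

theorem two_ne_one (hn : 3 ≤ n) : (2 : Fin (n + 2)) ≠ 1 := by
  rw [Ne, Fin.ext_iff, val_two hn, val_one]; simp

theorem mem_normalIndices {a : Fin (n + 2)} :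
    a ∈ normalIndices n ↔ 2 ≤ (a : ℕ) ∧ (a : ℕ) ≤ n := by simp [normalIndices]

theorem mem_thetaIndices {a : Fin (n + 2)} :
    a ∈ thetaIndices n ↔ 3 ≤ (a : ℕ) ∧ (a : ℕ) ≤ n := by simp [thetaIndices]

theorem normal_ne {a : Fin (n + 2)} (ha : a ∈ normalIndices n) :
    a ≠ 0 ∧ a ≠ 1 ∧ a ≠ Fin.last (n + 1) := by
  rw [mem_normalIndices] at ha
  refine ⟨?_, ?_, ?_⟩ <;> rw [Ne, Fin.ext_iff]
  · rw [Fin.val_zero]; omega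
  · rw [val_one]; omega
  · rw [Fin.val_last]; omega

theorem theta_ne_two (hn : 3 ≤ n) {a : Fin (n + 2)} (ha : a ∈ thetaIndices n) : a ≠ 2 := by
  rw [mem_thetaIndices] at ha
  rw [Ne, Fin.ext_iff, val_two hn]; omega

theorem theta_subset_normal : thetaIndices n ⊆ normalIndices n := fun a ha => by
  rw [mem_thetaIndices] at ha
  rw [mem_normalIndices]; omega

theorem two_mem_normal (hn : 3 ≤ n) : (2 : Fin (n + 2)) ∈ normalIndices n := by
  rw [mem_normalIndices, val_two hn]; omega

theorem sum_normal {M : Type*} [AddCommMonoid M] (hn : 3 ≤ n) (g : Fin (n + 2) → M) :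
    ∑ a ∈ normalIndices n, g a = g 2 + ∑ a ∈ thetaIndices n, g a := by
  have h : normalIndices n = insert 2 (thetaIndices n) := by
    ext a
    rw [Finset.mem_insert, mem_normalIndices, mem_thetaIndices, Fin.ext_iff, val_two hn]
    omega
  rw [h, Finset.sum_insert fun h => theta_ne_two hn h rfl]

theorem sum_index {M : Type*} [AddCommMonoid M] (hn : 3 ≤ n) (g : Fin (n + 2) → M) :
    ∑ a, g a = g 0 + (g 1 + (g (Fin.last (n + 1)) + ∑ a ∈ normalIndices n, g a)) := by
  have h : (Finset.univ : Finset (Fin (n + 2))) =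
      insert 0 (insert 1 (insert (Fin.last (n + 1)) (normalIndices n))) := by
    ext a
    simp only [Finset.mem_univ, Finset.mem_insert, true_iff]
    rw [mem_normalIndices, Fin.ext_iff, Fin.ext_iff, Fin.ext_iff, Fin.val_zero, val_one,
      Fin.val_last]
    omega
  rw [h, Finset.sum_insert, Finset.sum_insert, Finset.sum_insert]
  · exact fun h => (normal_ne h).2.2 rfl
  · rw [Finset.mem_insert, not_or]
    exact ⟨one_ne_last hn, fun h => (normal_ne h).2.1 rfl⟩
  · rw [Finset.mem_insert, Finset.mem_insert, not_or, not_or]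
    exact ⟨by simp, last_ne_zero.symm, fun h => (normal_ne h).1 rfl⟩

/-! ### Structure equations of frames -/

section Frame

variable {I : Set ℝ} {f : ℝ → Proj n} {U : Set ℝ} {e : ℝ → Mat n}

theorem IsZerothOrderFrame.column_smooth (h : IsZerothOrderFrame I f U e) (a : Fin (n + 2)) :
    ContDiffOn ℝ ∞ (column e a) U :=
  contDiffOn_pi.2 fun i => h.smooth i a

theorem IsZerothOrderFrame.lorentz_column (h : IsZerothOrderFrame I f U e) {x : ℝ} (hx : x ∈ U)
    (a b : Fin (n + 2)) : lorentz (column e a x) (column e b x) = lorentzMatrix n a b := by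
  rw [← (h.mem_moebius x hx).1, transpose_mul_lorentzMatrix_mul]; rfl

theorem IsZerothOrderFrame.deriv_column_apply (h : IsZerothOrderFrame I f U e) {x : ℝ}
    (hx : x ∈ U) (a i : Fin (n + 2)) : deriv (column e a) x i = deriv (fun y => e y i a) x := by
  have := (h.column_smooth a).hasDerivAt_of_isOpen h.isOpen hx
  exact ((hasDerivAt_pi.1 this i).deriv).symm

theorem IsZerothOrderFrame.deriv_column (h : IsZerothOrderFrame I f U e) {x : ℝ} (hx : x ∈ U)
    (b : Fin (n + 2)) :
    deriv (column e b) x = ∑ a, maurerCartan e x a b • column e a x := by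
  have h1 : e x * maurerCartan e x = Matrix.of fun i j => deriv (fun y => e y i j) x := by
    rw [maurerCartan, ← Matrix.mul_assoc, Matrix.mul_nonsing_inv, Matrix.one_mul]
    rw [(h.mem_moebius x hx).2.1]; exact isUnit_one
  ext i
  rw [h.deriv_column_apply hx]
  have h2 := congrFun (congrFun h1 i) b
  rw [Matrix.mul_apply] at h2
  simp only [Matrix.of_apply] at h2
  rw [← h2, Finset.sum_apply]
  exact Finset.sum_congr rfl fun a _ => mul_comm _ _

theorem IsZerothOrderFrame.lorentz_deriv (h : IsZerothOrderFrame I f U e) {x : ℝ} (hx : x ∈ U)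
    (a b : Fin (n + 2)) : lorentz (column e a x) (deriv (column e b) x) =
      ∑ c, lorentzMatrix n a c * maurerCartan e x c b := by
  rw [h.deriv_column hx, lorentz_sum_right]
  exact Finset.sum_congr rfl fun c _ => by
    rw [lorentz_smul_right, h.lorentz_column hx, mul_comm]

theorem IsZerothOrderFrame.maurerCartan_zero (h : IsZerothOrderFrame I f U e) {x : ℝ}
    (hx : x ∈ U) (b : Fin (n + 2)) : maurerCartan e x 0 b =
      -lorentz (column e (Fin.last (n + 1)) x) (deriv (column e b) x) := by
  rw [h.lorentz_deriv hx, Finset.sum_eq_single 0]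
  · simp [lorentzMatrix_last_zero]
  · intro c _ hc
    rcases eq_or_ne c (Fin.last (n + 1)) with rfl | hl
    · rw [lorentzMatrix_last_last, zero_mul]
    · rw [lorentzMatrix_symm, lorentzMatrix_of_ne hc hl hl, zero_mul]
  · simp

theorem IsZerothOrderFrame.maurerCartan_last (h : IsZerothOrderFrame I f U e) {x : ℝ}
    (hx : x ∈ U) (b : Fin (n + 2)) : maurerCartan e x (Fin.last (n + 1)) b =
      -lorentz (column e 0 x) (deriv (column e b) x) := by
  rw [h.lorentz_deriv hx, Finset.sum_eq_single (Fin.last (n + 1))]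
  · simp [lorentzMatrix_zero_last]
  · intro c _ hc
    rcases eq_or_ne c 0 with rfl | h0
    · rw [lorentzMatrix_zero_zero, zero_mul]
    · rw [lorentzMatrix_symm, lorentzMatrix_of_ne h0 hc h0, zero_mul]
  · simp

theorem IsZerothOrderFrame.maurerCartan_of_ne (h : IsZerothOrderFrame I f U e) {x : ℝ}
    (hx : x ∈ U) {a : Fin (n + 2)} (h0 : a ≠ 0) (hl : a ≠ Fin.last (n + 1)) (b : Fin (n + 2)) :
    maurerCartan e x a b = lorentz (column e a x) (deriv (column e b) x) := by
  rw [h.lorentz_deriv hx, Finset.sum_eq_single a]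
  · simp [lorentzMatrix_self h0 hl]
  · intro c _ hc
    rw [lorentzMatrix_of_ne h0 hl hc.symm, zero_mul]
  · simp

theorem IsZerothOrderFrame.skew (h : IsZerothOrderFrame I f U e) {x : ℝ} (hx : x ∈ U)
    (a b : Fin (n + 2)) : lorentz (column e a x) (deriv (column e b) x) =
      -lorentz (column e b x) (deriv (column e a) x) := by
  have h1 := (((h.column_smooth a).hasDerivAt_of_isOpen h.isOpen hx).lorentz
    ((h.column_smooth b).hasDerivAt_of_isOpen h.isOpen hx)).deriv
  rw [deriv_congr_of_isOpen h.isOpen (fun y hy => h.lorentz_column hy a b) hx, deriv_const] at h1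
  rw [lorentz_comm (column e b x)]
  linarith

/-- Each entry is, up to sign, a scalar product of a column with the derivative of a column, so the
inverse matrix in the definition need not be differentiated. -/
theorem IsZerothOrderFrame.maurerCartan_smooth (h : IsZerothOrderFrame I f U e)
    (a b : Fin (n + 2)) : ContDiffOn ℝ ∞ (fun x => maurerCartan e x a b) U := by
  have key : ∀ c, ContDiffOn ℝ ∞ (fun x => lorentz (column e c x) (deriv (column e b) x)) U :=
    fun c => (h.column_smooth c).lorentz ((h.column_smooth b).deriv_infty h.isOpen)
  rcases eq_or_ne a 0 with rfl | h0
  · exact (key _).neg.congr fun x hx => h.maurerCartan_zero hx b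
  rcases eq_or_ne a (Fin.last (n + 1)) with rfl | hl
  · exact (key _).neg.congr fun x hx => h.maurerCartan_last hx b
  · exact (key _).congr fun x hx => h.maurerCartan_of_ne hx h0 hl b

theorem IsZerothOrderFrame.deriv_column' (h : IsZerothOrderFrame I f U e) (hn : 3 ≤ n) {x : ℝ}
    (hx : x ∈ U) (b : Fin (n + 2)) :
    deriv (column e b) x = maurerCartan e x 0 b • column e 0 x +
      (maurerCartan e x 1 b • column e 1 x +
      (maurerCartan e x (Fin.last (n + 1)) b • column e (Fin.last (n + 1)) x +
      ∑ a ∈ normalIndices n, maurerCartan e x a b • column e a x)) := by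
  rw [h.deriv_column hx, sum_index hn]

theorem IsZerothOrderFrame.column_zero_mem (h : IsZerothOrderFrame I f U e) {x : ℝ} (hx : x ∈ U) :
    column e 0 x ∈ lightCone n := by
  have h1 := (h.mem_moebius x hx).2.2 (Pi.single 0 1) ⟨by
    rw [← lorentzMatrix_apply, lorentzMatrix_zero_zero], by simp⟩
  rwa [Matrix.mulVec_single_one] at h1

variable (hn : 3 ≤ n)
include hn

/-- The Darboux conditions remove the normal components; the component along e_{n+1} vanishes
because ⟨e_0,e_0⟩ is constant. The next two structure equations follow in the same way from
skewness. -/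
theorem IsDarbouxFrame.deriv_zero (h : IsDarbouxFrame I f U e) {x : ℝ} (hx : x ∈ U) :
    deriv (column e 0) x = maurerCartan e x 0 0 • column e 0 x +
      maurerCartan e x 1 0 • column e 1 x := by
  have h0 := h.toIsZerothOrderFrame
  have hl : maurerCartan e x (Fin.last (n + 1)) 0 = 0 := by
    have := h0.skew hx 0 0
    rw [h0.maurerCartan_last hx]; linarith
  rw [h0.deriv_column' hn hx, hl, Finset.sum_eq_zero fun a ha => by
    rw [h.first_order x hx a ha, zero_smul]]
  simp

theorem IsDarbouxFrame.deriv_one (h : IsDarbouxFrame I f U e) {x : ℝ} (hx : x ∈ U) :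
    deriv (column e 1) x = maurerCartan e x 0 1 • column e 0 x +
      maurerCartan e x 1 0 • column e (Fin.last (n + 1)) x := by
  have h0 := h.toIsZerothOrderFrame
  have h1 : maurerCartan e x 1 1 = 0 := by
    have := h0.skew hx 1 1
    rw [h0.maurerCartan_of_ne hx (by simp) (one_ne_last hn)]; linarith
  have hl : maurerCartan e x (Fin.last (n + 1)) 1 = maurerCartan e x 1 0 := by
    rw [h0.maurerCartan_last hx, h0.maurerCartan_of_ne hx (by simp) (one_ne_last hn),
      h0.skew hx 0 1, neg_neg]
  rw [h0.deriv_column' hn hx, hl, h1, Finset.sum_eq_zero fun a ha => by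
    rw [h.second_order x hx a ha, zero_smul]]
  simp

theorem IsDarbouxFrame.deriv_last (h : IsDarbouxFrame I f U e) {x : ℝ} (hx : x ∈ U) :
    deriv (column e (Fin.last (n + 1))) x = maurerCartan e x 0 1 • column e 1 x -
      maurerCartan e x 0 0 • column e (Fin.last (n + 1)) x +
      ∑ a ∈ normalIndices n, maurerCartan e x 0 a • column e a x := by
  have h0 := h.toIsZerothOrderFrame
  have h1 : maurerCartan e x 0 (Fin.last (n + 1)) = 0 := by
    have := h0.skew hx (Fin.last (n + 1)) (Fin.last (n + 1))
    rw [h0.maurerCartan_zero hx]; linarith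
  have hl : ∀ a, a ≠ 0 → a ≠ Fin.last (n + 1) →
      maurerCartan e x a (Fin.last (n + 1)) = maurerCartan e x 0 a := fun a ha hal => by
    rw [h0.maurerCartan_zero hx, h0.maurerCartan_of_ne hx ha hal, h0.skew hx]
  have hll : maurerCartan e x (Fin.last (n + 1)) (Fin.last (n + 1)) = -maurerCartan e x 0 0 := by
    rw [h0.maurerCartan_zero hx, h0.maurerCartan_last hx, h0.skew hx]
  rw [h0.deriv_column' hn hx, hll, h1, hl 1 (by simp) (one_ne_last hn),
    Finset.sum_congr rfl fun a ha => by rw [hl a (normal_ne ha).1 (normal_ne ha).2.2]]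
  simp only [zero_smul, zero_add, neg_smul]
  abel

/-- The chain of a Darboux frame. -/
noncomputable def darbouxChain (e : ℝ → Mat n) : ℕ → ℝ → Ambient n
  | 0 => column e 0
  | 1 => column e 1
  | 2 => column e (Fin.last (n + 1))
  | _ => fun x => ∑ a ∈ normalIndices n, maurerCartan e x 0 a • column e a x

omit hn in
theorem SmoothComb.smul_basis {E : Type*} [NormedAddCommGroup E] [NormedSpace ℝ E] {U : Set ℝ}
    {Y : ℕ → ℝ → E} {k j : ℕ} (hj : j < k) {a : ℝ → ℝ} (ha : ContDiffOn ℝ ∞ a U) :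
    SmoothComb U Y k (fun x => a x • Y j x) := (SmoothComb.basis hj).smul ha

/-- The last coefficient is 1 because the fourth member is the whole normal part of the derivative
of e_{n+1}. Nothing is normalized here, so the chain exists also where this normal part vanishes. -/
theorem IsDarbouxFrame.isChain (h : IsDarbouxFrame I f U e) :
    IsChain U (darbouxChain e) (fun k x => if k = 2 then 1 else maurerCartan e x 1 0) 3 := by
  have h0 := h.toIsZerothOrderFrame
  have hm := h0.maurerCartan_smooth
  refine ⟨h0.isOpen, fun k hk => ?_, fun k hk => ?_, fun k hk => ?_⟩
  · interval_cases k
    · exact h0.column_smooth _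
    · exact h0.column_smooth _
    · exact h0.column_smooth _
    · exact ContDiffOn.sum fun a _ => (hm 0 a).smul (h0.column_smooth a)
  · by_cases h2 : k = 2
    · simpa [h2] using contDiffOn_const
    · simpa [h2] using hm 1 0
  · interval_cases k
    · refine (SmoothComb.smul_basis (Y := darbouxChain e) (j := 0) (by norm_num) (hm 0 0)).congr
        fun x hx => ?_
      simp [darbouxChain, h.deriv_zero hn hx]
    · refine (SmoothComb.smul_basis (Y := darbouxChain e) (j := 0) (by norm_num) (hm 0 1)).congr
        fun x hx => ?_
      simp [darbouxChain, h.deriv_one hn hx]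
    · refine ((SmoothComb.smul_basis (Y := darbouxChain e) (j := 1) (by norm_num) (hm 0 1)).sub
        (SmoothComb.smul_basis (Y := darbouxChain e) (j := 2) (by norm_num) (hm 0 0))).congr
        fun x hx => ?_
      simp [darbouxChain, h.deriv_last hn hx]

omit hn in
-- The Gram matrix splits into a hyperbolic plane of determinant -1, a unit vector and v 3.
theorem gramDet_of_orthogonal {v : ℕ → Ambient n} (h00 : lorentz (v 0) (v 0) = 0)
    (h01 : lorentz (v 0) (v 1) = 0) (h02 : lorentz (v 0) (v 2) = -1)
    (h03 : lorentz (v 0) (v 3) = 0) (h11 : lorentz (v 1) (v 1) = 1)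
    (h12 : lorentz (v 1) (v 2) = 0) (h13 : lorentz (v 1) (v 3) = 0)
    (h22 : lorentz (v 2) (v 2) = 0) (h23 : lorentz (v 2) (v 3) = 0) :
    gramDet v = -lorentz (v 3) (v 3) := by
  simp [gramDet, Matrix.det_succ_row_zero, Fin.sum_univ_succ, h00, h01, h02, h03, h11, h12, h13,
    h22, h23, lorentz_comm (v 1) (v 0), lorentz_comm (v 2) (v 0), lorentz_comm (v 3) (v 0),
    lorentz_comm (v 2) (v 1), lorentz_comm (v 3) (v 1), lorentz_comm (v 3) (v 2)]
  simp [Fin.succAbove]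

theorem IsDarbouxFrame.gramDet_eq (h : IsDarbouxFrame I f U e) {x : ℝ} (hx : x ∈ U) :
    gramDet (fun k => iteratedDeriv k (column e 0) x) =
      -(maurerCartan e x 1 0 ^ 10 * ∑ a ∈ normalIndices n, maurerCartan e x 0 a ^ 2) := by
  have h0 := h.toIsZerothOrderFrame
  have hz : ∀ b, (∀ a ∈ normalIndices n, lorentzMatrix n b a = 0) →
      lorentz (column e b x) (∑ a ∈ normalIndices n, maurerCartan e x 0 a • column e a x) = 0 :=
    fun b hb => by
      rw [lorentz_sum_right]
      exact Finset.sum_eq_zero fun a ha => by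
        rw [lorentz_smul_right, h0.lorentz_column hx, hb a ha, mul_zero]
  have hS : ∀ b, ∀ a ∈ normalIndices n, b ≠ a → lorentzMatrix n b a = 0 := fun b a ha hba => by
    rw [lorentzMatrix_symm, lorentzMatrix_of_ne (normal_ne ha).1 (normal_ne ha).2.2 hba.symm]
  have h3 : lorentz (∑ a ∈ normalIndices n, maurerCartan e x 0 a • column e a x)
      (∑ a ∈ normalIndices n, maurerCartan e x 0 a • column e a x) =
      ∑ a ∈ normalIndices n, maurerCartan e x 0 a ^ 2 := by
    rw [lorentz_sum_left]
    refine Finset.sum_congr rfl fun a ha => ?_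
    rw [lorentz_smul_left, lorentz_sum_right, Finset.sum_eq_single a]
    · rw [lorentz_smul_right, h0.lorentz_column hx, lorentzMatrix_self (normal_ne ha).1
        (normal_ne ha).2.2]; ring
    · intro b hb hba
      rw [lorentz_smul_right, h0.lorentz_column hx, hS a b hb hba.symm, mul_zero]
    · exact fun h => absurd ha h
  have key := (h.isChain hn).gramDet_eq hx
  rw [gramDet_of_orthogonal (v := fun k => darbouxChain e k x)] at key
  · refine key.trans ?_
    simp only [darbouxChain, h3]
    rw [if_neg (by norm_num), if_neg (by norm_num), if_pos trivial]
    ring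
  · simp only [darbouxChain, h0.lorentz_column hx, lorentzMatrix_zero_zero]
  · simp only [darbouxChain, h0.lorentz_column hx]
    rw [lorentzMatrix_symm, lorentzMatrix_of_ne (by simp) (one_ne_last hn) (by simp)]
  · simp only [darbouxChain, h0.lorentz_column hx, lorentzMatrix_zero_last]
  · exact hz 0 fun a ha => hS _ _ ha (normal_ne ha).1.symm
  · simp only [darbouxChain, h0.lorentz_column hx]
    rw [lorentzMatrix_self (by simp) (one_ne_last hn)]
  · simp only [darbouxChain, h0.lorentz_column hx]
    rw [lorentzMatrix_of_ne (by simp) (one_ne_last hn) (one_ne_last hn)]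
  · exact hz 1 fun a ha => hS _ _ ha (normal_ne ha).2.1.symm
  · simp only [darbouxChain, h0.lorentz_column hx, lorentzMatrix_last_last]
  · exact hz _ fun a ha => hS _ _ ha (normal_ne ha).2.2.symm

theorem IsDarbouxFrame.lorentz_deriv_zero (h : IsDarbouxFrame I f U e) {x : ℝ} (hx : x ∈ U) :
    lorentz (deriv (column e 0) x) (deriv (column e 0) x) = maurerCartan e x 1 0 ^ 2 := by
  have h0 := h.toIsZerothOrderFrame
  have h01 : lorentzMatrix n 0 1 = 0 := by
    rw [lorentzMatrix_symm, lorentzMatrix_of_ne (by simp) (one_ne_last hn) (by simp)]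
  rw [h.deriv_zero hn hx]
  simp only [lorentz_add_left, lorentz_add_right, lorentz_smul_left, lorentz_smul_right,
    h0.lorentz_column hx, lorentzMatrix_zero_zero, h01, lorentzMatrix_symm 1 0,
    lorentzMatrix_self (a := 1) (by simp) (one_ne_last hn)]
  ring

end Frame

/-! ### Null lifts -/

theorem Represents.smul {v : Ambient n} {p : Proj n} (h : Represents v p) {c : ℝ} (hc : c ≠ 0) :
    Represents (c • v) p := by
  obtain ⟨hv, rfl⟩ := h
  refine ⟨smul_ne_zero hc hv, ?_⟩
  rw [Projectivization.mk_eq_mk_iff']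
  exact ⟨c, rfl⟩

theorem Represents.exists_smul {v w : Ambient n} {p : Proj n} (hv : Represents v p)
    (hw : Represents w p) : ∃ c : ℝ, w = c • v := by
  obtain ⟨hv, rfl⟩ := hv
  obtain ⟨hw, h⟩ := hw
  obtain ⟨c, hc⟩ := (Projectivization.mk_eq_mk_iff' ℝ _ _ _ _).1 h
  exact ⟨c, hc.symm⟩

/-- `F` is a smooth light-like lift of `f` on the open set `U`. -/
structure IsNullLift (U : Set ℝ) (f : ℝ → Proj n) (F : ℝ → Ambient n) : Prop where
  isOpen : IsOpen U
  smooth : ContDiffOn ℝ ∞ F U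
  represents : ∀ x ∈ U, Represents (F x) (f x)
  null : ∀ x ∈ U, lorentz (F x) (F x) = 0

section NullLift

variable {I : Set ℝ} {f : ℝ → Proj n} {U : Set ℝ} {F G : ℝ → Ambient n}

theorem IsNullLift.mono (h : IsNullLift U f F) {V : Set ℝ} (hV : IsOpen V) (hVU : V ⊆ U) :
    IsNullLift V f F :=
  ⟨hV, h.smooth.mono hVU, fun x hx => h.represents x (hVU hx), fun x hx => h.null x (hVU hx)⟩

theorem IsNullLift.ne_zero (h : IsNullLift U f F) {x : ℝ} (hx : x ∈ U) : F x ≠ 0 :=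
  (h.represents x hx).1

theorem IsNullLift.hasDerivAt (h : IsNullLift U f F) {x : ℝ} (hx : x ∈ U) :
    HasDerivAt F (deriv F x) x := h.smooth.hasDerivAt_of_isOpen h.isOpen hx

theorem IsNullLift.lorentz_deriv (h : IsNullLift U f F) {x : ℝ} (hx : x ∈ U) :
    lorentz (F x) (deriv F x) = 0 := by
  have h1 := ((h.hasDerivAt hx).lorentz (h.hasDerivAt hx)).deriv
  rw [deriv_congr_of_isOpen h.isOpen h.null hx, deriv_const, lorentz_comm (deriv F x)] at h1
  linarith

theorem IsNullLift.rescale (h : IsNullLift U f F) {μ : ℝ → ℝ} (hμ : ContDiffOn ℝ ∞ μ U)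
    (hμ0 : ∀ x ∈ U, μ x ≠ 0) : IsNullLift U f fun x => μ x • F x :=
  ⟨h.isOpen, hμ.smul h.smooth, fun x hx => (h.represents x hx).smul (hμ0 x hx), fun x hx => by
    simp [h.null x hx]⟩

/-- The terms containing μ' drop out because F is light-like and orthogonal to F'. -/
theorem IsNullLift.speed_rescale (h : IsNullLift U f F) {μ : ℝ → ℝ} (hμ : ContDiffOn ℝ ∞ μ U)
    {x : ℝ} (hx : x ∈ U) :
    lorentz (deriv (fun x => μ x • F x) x) (deriv (fun x => μ x • F x) x) =
      μ x ^ 2 * lorentz (deriv F x) (deriv F x) := by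
  have h1 := ((hμ.hasDerivAt_of_isOpen h.isOpen hx).smul (h.hasDerivAt hx)).deriv
  rw [show deriv (fun x => μ x • F x) x = _ from h1]
  simp only [lorentz_add_left, lorentz_add_right, lorentz_smul_left, lorentz_smul_right,
    h.null x hx, h.lorentz_deriv hx, lorentz_comm (deriv F x) (F x)]
  ring

theorem gramDet_smul (c : ℝ) (v : ℕ → Ambient n) :
    gramDet (fun k => c • v k) = c ^ 8 * gramDet v := by
  rw [gramDet_triangular (u := v) (c := fun _ => c) fun k _ => ⟨fun _ => 0, by simp⟩]
  rw [Finset.prod_const, Finset.card_range]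
  ring

theorem contDiffOn_iteratedDeriv {E : Type*} [NormedAddCommGroup E] [NormedSpace ℝ E]
    {u : ℝ → E} (hU : IsOpen U) (hu : ContDiffOn ℝ ∞ u U) (k : ℕ) :
    ContDiffOn ℝ ∞ (iteratedDeriv k u) U := by
  induction k with
  | zero => simpa using hu
  | succ k ih => rw [iteratedDeriv_succ]; exact ih.deriv_infty hU

/-- The vectors μF, μF', μF'', μF''' form a chain with all coefficients 1, the error at each step
being μ'/μ times the vector itself. Derivatives of μ therefore do not enter. -/
theorem IsNullLift.gramDet_rescale (h : IsNullLift U f F) {μ : ℝ → ℝ} (hμ : ContDiffOn ℝ ∞ μ U)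
    (hμ0 : ∀ x ∈ U, μ x ≠ 0) {x : ℝ} (hx : x ∈ U) :
    gramDet (fun k => iteratedDeriv k (fun x => μ x • F x) x) =
      μ x ^ 8 * gramDet fun k => iteratedDeriv k F x := by
  have hs := fun k => contDiffOn_iteratedDeriv h.isOpen h.smooth k
  have hi : ContDiffOn ℝ ∞ (fun x => (μ x)⁻¹) U := hμ.inv hμ0
  have hc : IsChain U (fun k x => μ x • iteratedDeriv k F x) (fun _ _ => 1) 3 := by
    refine ⟨h.isOpen, fun k _ => hμ.smul (hs k), fun _ _ => contDiffOn_const, fun k _ => ?_⟩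
    refine (SmoothComb.smul_basis (Y := fun k x => μ x • iteratedDeriv k F x) (j := k)
      (Nat.lt_succ_self k)
      ((hμ.deriv_infty h.isOpen).mul hi)).congr fun x hx => ?_
    have h1 := ((hμ.hasDerivAt_of_isOpen h.isOpen hx).smul
      ((hs k).hasDerivAt_of_isOpen h.isOpen hx)).deriv
    rw [show deriv (fun x => μ x • iteratedDeriv k F x) x = _ from h1, iteratedDeriv_succ,
      one_smul, smul_smul, mul_assoc, inv_mul_cancel₀ (hμ0 x hx), mul_one]
    simp
  have := hc.gramDet_eq hx
  simp only [iteratedDeriv_zero] at this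
  rw [this, gramDet_smul]
  norm_num

/-- Nonzero light-like vectors pair nontrivially with the time axis, so the quotient of these
pairings is a smooth formula for the factor. -/
theorem IsNullLift.exists_scale (hF : IsNullLift U f F) (hG : IsNullLift U f G) :
    ∃ μ : ℝ → ℝ, ContDiffOn ℝ ∞ μ U ∧ (∀ x ∈ U, μ x ≠ 0) ∧ ∀ x ∈ U, G x = μ x • F x := by
  have hT : ∀ x ∈ U, lorentz (F x) (timeAxis n) ≠ 0 := fun x hx =>
    lorentz_timeAxis_ne_zero (hF.ne_zero hx) (hF.null x hx)
  have hμ : ∀ x ∈ U, G x =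
      (lorentz (G x) (timeAxis n) * (lorentz (F x) (timeAxis n))⁻¹) • F x := fun x hx => by
    obtain ⟨c, hc⟩ := (hF.represents x hx).exists_smul (hG.represents x hx)
    conv_lhs => rw [hc]
    rw [hc, lorentz_smul_left, mul_assoc, mul_inv_cancel₀ (hT x hx), mul_one]
  have hi : ContDiffOn ℝ ∞ (fun x => (lorentz (F x) (timeAxis n))⁻¹) U :=
    (hF.smooth.lorentz contDiffOn_const).inv hT
  refine ⟨_, (hG.smooth.lorentz contDiffOn_const).mul hi, fun x hx h0 => ?_, hμ⟩
  exact hG.ne_zero hx ((hμ x hx).trans (by rw [h0, zero_smul]))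

theorem iteratedDeriv_congr_of_isOpen {E : Type*} [NormedAddCommGroup E] [NormedSpace ℝ E]
    {u v : ℝ → E} (hU : IsOpen U) (h : ∀ x ∈ U, u x = v x) {x : ℝ} (hx : x ∈ U) (k : ℕ) :
    iteratedDeriv k u x = iteratedDeriv k v x :=
  Filter.EventuallyEq.iteratedDeriv_eq k (Filter.eventually_of_mem (hU.mem_nhds hx) h)

/-- Two light-like lifts of the same curve are related by a factor `μ`, which changes the speed and
the Gram determinant as stated. -/
theorem IsNullLift.compare (hF : IsNullLift U f F) (hG : IsNullLift U f G) {x : ℝ} (hx : x ∈ U) :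
    ∃ μ : ℝ, μ ≠ 0 ∧ G x = μ • F x ∧
      lorentz (deriv G x) (deriv G x) = μ ^ 2 * lorentz (deriv F x) (deriv F x) ∧
      gramDet (fun k => iteratedDeriv k G x) = μ ^ 8 * gramDet fun k => iteratedDeriv k F x := by
  obtain ⟨μ, hμ, hμ0, h⟩ := hF.exists_scale hG
  refine ⟨μ x, hμ0 x hx, h x hx, ?_, ?_⟩
  · rw [deriv_congr_of_isOpen hF.isOpen h hx, hF.speed_rescale hμ hx]
  · rw [← hF.gramDet_rescale hμ hμ0 hx]
    congr 1
    funext k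
    exact iteratedDeriv_congr_of_isOpen hF.isOpen h hx k

theorem IsImmersion.exists_nullLift (h : IsImmersion I f) {x : ℝ} (hx : x ∈ I) :
    ∃ U F, x ∈ U ∧ U ⊆ I ∧ IsNullLift U f F ∧ 0 < lorentz (deriv F x) (deriv F x) := by
  obtain ⟨U, hU, hxU, hUI, F, hF, hr, hl⟩ := h.2 x hx
  have hN : IsNullLift U f F := ⟨hU, hF, hr, fun y hy => h.1 y (hUI hy) _ (hr y hy)⟩
  exact ⟨U, F, hxU, hUI, hN, lorentz_self_pos_of_null (hN.null x hxU) (hN.lorentz_deriv hxU) hl⟩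

theorem IsNullLift.speed_pos (hF : IsNullLift U f F) (h : IsImmersion I f) (hUI : U ⊆ I) {x : ℝ}
    (hx : x ∈ U) : 0 < lorentz (deriv F x) (deriv F x) := by
  obtain ⟨V, G, hxV, -, hG, hpos⟩ := h.exists_nullLift (hUI hx)
  have hO := hF.isOpen.inter hG.isOpen
  obtain ⟨μ, hμ, -, h1, -⟩ := (hF.mono hO Set.inter_subset_left).compare
    (hG.mono hO Set.inter_subset_right) ⟨hx, hxV⟩
  have : 0 < μ ^ 2 := by positivity
  by_contra hc
  nlinarith

theorem IsNullLift.isImmersion (hI : ∀ x ∈ I, f x ∈ quadric n)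
    (h : ∀ x ∈ I, ∃ U F, x ∈ U ∧ U ⊆ I ∧ IsNullLift U f F ∧
      0 < lorentz (deriv F x) (deriv F x)) : IsImmersion I f := by
  refine ⟨hI, fun x hx => ?_⟩
  obtain ⟨U, F, hxU, hUI, hF, hpos⟩ := h x hx
  exact ⟨U, hF.isOpen, hxU, hUI, F, hF.smooth, hF.represents,
    linearIndependent_of_null (hF.ne_zero hxU) (hF.null x hxU) hpos⟩

theorem mem_quadric_of_represents {v : Ambient n} {p : Proj n} (hv : Represents v p)
    (h : lorentz v v = 0) : p ∈ quadric n := fun w hw => by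
  obtain ⟨c, rfl⟩ := hv.exists_smul hw
  simp [h]

/-! ### The conformal arclength element in terms of lifts. -/

theorem IsZerothOrderFrame.isNullLift {e : ℝ → Mat n} (h : IsZerothOrderFrame I f U e) :
    IsNullLift U f (column e 0) :=
  ⟨h.isOpen, h.column_smooth 0, h.represents, fun x hx => by
    rw [h.lorentz_column hx, lorentzMatrix_zero_zero]⟩

/-- The conformal arclength element, computed in a light-like lift. -/
noncomputable def liftElement (F : ℝ → Ambient n) (x : ℝ) : ℝ :=
  (-gramDet fun k => iteratedDeriv k F x) ^ (1 / 4 : ℝ) / lorentz (deriv F x) (deriv F x)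

theorem rpow_quarter_mul {c a : ℝ} (hc : 0 ≤ c) (a_nonneg : 0 ≤ a) :
    (c ^ 4 * a) ^ (1 / 4 : ℝ) = c * a ^ (1 / 4 : ℝ) := by
  rw [Real.mul_rpow (by positivity) a_nonneg, ← Real.rpow_natCast c 4, ← Real.rpow_mul hc]
  norm_num

/-- For a negative base the real power is the power of the absolute value times a cosine that
ignores c, so homogeneity persists. No sign of the Gram determinant has to be known when lifts are
compared. -/
theorem neg_rpow_quarter_mul {c : ℝ} (hc : 0 < c) (a : ℝ) :
    (-(c ^ 4 * a)) ^ (1 / 4 : ℝ) = c * (-a) ^ (1 / 4 : ℝ) := by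
  rcases le_total a 0 with ha | ha
  · rw [← mul_neg, rpow_quarter_mul hc.le (by linarith)]
  · rw [Real.rpow_def_of_nonpos (by nlinarith [pow_pos hc 4, mul_nonneg (pow_pos hc 4).le ha]),
      Real.rpow_def_of_nonpos (by linarith)]
    rcases ha.eq_or_lt with rfl | ha
    · simp
    · have hc4 : (0 : ℝ) < c ^ 4 * a := by positivity
      rw [if_neg (by linarith), if_neg (by linarith), Real.log_neg_eq_log, Real.log_neg_eq_log,
        Real.log_mul (by positivity) ha.ne', add_mul, Real.exp_add, Real.log_pow]
      have : ((4 : ℕ) : ℝ) * Real.log c * (1 / 4) = Real.log c := by push_cast; ring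
      rw [this, Real.exp_log hc, mul_assoc]

/-- The weights match: the fourth root of μ^8 cancels the factor μ² of the squared speed. -/
theorem IsNullLift.liftElement_eq (hF : IsNullLift U f F) {V : Set ℝ} (hG : IsNullLift V f G)
    {x : ℝ} (hx : x ∈ U) (hx' : x ∈ V) : liftElement G x = liftElement F x := by
  have hO := hF.isOpen.inter hG.isOpen
  obtain ⟨μ, hμ, -, h1, h2⟩ := (hF.mono hO Set.inter_subset_left).compare
    (hG.mono hO Set.inter_subset_right) ⟨hx, hx'⟩
  have hμ2 : 0 < μ ^ 2 := by positivity
  rw [liftElement, liftElement, h1, h2, show μ ^ 8 = (μ ^ 2) ^ 4 by ring,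
    neg_rpow_quarter_mul hμ2, mul_div_mul_left _ _ hμ2.ne']

theorem IsDarbouxFrame.frameArclengthElement_eq (hn : 3 ≤ n) {e : ℝ → Mat n}
    (h : IsDarbouxFrame I f U e) {x : ℝ} (hx : x ∈ U) (hσ : maurerCartan e x 1 0 ≠ 0) :
    frameArclengthElement e x = liftElement (column e 0) x := by
  rw [frameArclengthElement, liftElement, h.gramDet_eq hn hx, h.lorentz_deriv_zero hn hx, neg_neg]
  have h1 : ∑ a ∈ normalIndices n, maurerCartan e x 0 a ^ 2 =
      maurerCartan e x 1 0 ^ 2 * ∑ a ∈ normalIndices n, pCoeff e x a ^ 2 := by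
    rw [Finset.mul_sum]
    refine Finset.sum_congr rfl fun a _ => ?_
    rw [pCoeff]; field_simp
  have hpos : 0 < |maurerCartan e x 1 0| := abs_pos.2 hσ
  -- Ten factors come from the chain and two from φ^0_α = p^α φ^1_0. The fourth root gives |φ^1_0|³,
  -- and division by the squared speed leaves |φ^1_0|.
  rw [h1, show maurerCartan e x 1 0 ^ 10 * (maurerCartan e x 1 0 ^ 2 *
    ∑ a ∈ normalIndices n, pCoeff e x a ^ 2) = (|maurerCartan e x 1 0| ^ 3) ^ 4 *
    ∑ a ∈ normalIndices n, pCoeff e x a ^ 2 by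
      rw [← pow_mul, Even.pow_abs (by decide)]; ring,
    rpow_quarter_mul (by positivity) (Finset.sum_nonneg fun _ _ => sq_nonneg _),
    ← sq_abs (maurerCartan e x 1 0)]
  field_simp

theorem IsDarbouxFrame.coeff_ne_zero (hn : 3 ≤ n) {e : ℝ → Mat n} (hf : IsImmersion I f)
    (h : IsDarbouxFrame I f U e) {x : ℝ} (hx : x ∈ U) : maurerCartan e x 1 0 ≠ 0 := fun h0 => by
  have h1 := h.toIsZerothOrderFrame.isNullLift.speed_pos hf h.subset hx
  rw [h.lorentz_deriv_zero hn hx, h0] at h1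
  norm_num at h1

end NullLift

/-! ### The chain of a special third order frame -/

section Special

variable {I : Set ℝ} {f : ℝ → Proj n} {U : Set ℝ} {e : ℝ → Mat n} (hn : 3 ≤ n)
include hn

theorem IsThirdOrderFrame.deriv_last (h : IsThirdOrderFrame I f U e) {x : ℝ} (hx : x ∈ U) :
    deriv (column e (Fin.last (n + 1))) x = maurerCartan e x 0 1 • column e 1 x -
      maurerCartan e x 0 0 • column e (Fin.last (n + 1)) x +
      maurerCartan e x 1 0 • column e 2 x := by
  rw [h.toIsDarbouxFrame.deriv_last hn hx, sum_normal hn, h.third_order_two x hx,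
    Finset.sum_eq_zero fun a ha => by rw [h.third_order x hx a ha, zero_smul], add_zero]

theorem IsThirdOrderFrame.deriv_two (h : IsThirdOrderFrame I f U e) {x : ℝ} (hx : x ∈ U) :
    deriv (column e 2) x = maurerCartan e x 1 0 • column e 0 x +
      ∑ a ∈ thetaIndices n, maurerCartan e x a 2 • column e a x := by
  have h0 := h.toIsZerothOrderFrame
  have h2 := two_mem_normal hn
  have h12 : maurerCartan e x 1 2 = 0 := by
    rw [h0.maurerCartan_of_ne hx (by simp) (one_ne_last hn), h0.skew hx,
      ← h0.maurerCartan_of_ne hx (two_ne_zero' hn) (two_ne_last hn), h.second_order x hx 2 h2,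
      neg_zero]
  have hl2 : maurerCartan e x (Fin.last (n + 1)) 2 = 0 := by
    rw [h0.maurerCartan_last hx, h0.skew hx,
      ← h0.maurerCartan_of_ne hx (two_ne_zero' hn) (two_ne_last hn), h.first_order x hx 2 h2,
      neg_zero, neg_zero]
  have h22 : maurerCartan e x 2 2 = 0 := by
    have := h0.skew hx 2 2
    rw [h0.maurerCartan_of_ne hx (two_ne_zero' hn) (two_ne_last hn)]; linarith
  rw [h0.deriv_column' hn hx, sum_normal hn, h12, hl2, h22, h.third_order_two x hx]
  simp

theorem IsThirdOrderFrame.deriv_theta (h : IsThirdOrderFrame I f U e) {x : ℝ} (hx : x ∈ U)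
    {b : Fin (n + 2)} (hb : b ∈ thetaIndices n) :
    deriv (column e b) x = -maurerCartan e x b 2 • column e 2 x +
      ∑ a ∈ thetaIndices n, maurerCartan e x a b • column e a x := by
  have h0 := h.toIsZerothOrderFrame
  have hbn := theta_subset_normal hb
  have hb' := normal_ne hbn
  have h1 : maurerCartan e x 1 b = 0 := by
    rw [h0.maurerCartan_of_ne hx (by simp) (one_ne_last hn), h0.skew hx,
      ← h0.maurerCartan_of_ne hx hb'.1 hb'.2.2, h.second_order x hx b hbn, neg_zero]
  have hl : maurerCartan e x (Fin.last (n + 1)) b = 0 := by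
    rw [h0.maurerCartan_last hx, h0.skew hx,
      ← h0.maurerCartan_of_ne hx hb'.1 hb'.2.2, h.first_order x hx b hbn, neg_zero, neg_zero]
  have h2 : maurerCartan e x 2 b = -maurerCartan e x b 2 := by
    rw [h0.maurerCartan_of_ne hx (two_ne_zero' hn) (two_ne_last hn), h0.skew hx,
      ← h0.maurerCartan_of_ne hx hb'.1 hb'.2.2]
  rw [h0.deriv_column' hn hx, sum_normal hn, h1, hl, h2, h.third_order x hx b hb]
  simp

/-- The derivative of e_b leaves Θ only in the direction e_2, so ∇/ds records the derivative modulo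
an earlier member of the chain. -/
theorem IsThirdOrderFrame.deriv_thetaSection (h : IsThirdOrderFrame I f U e)
    {w : Fin (n + 2) → ℝ → ℝ} (hw : ∀ b, ContDiffOn ℝ ∞ (w b) U) {x : ℝ} (hx : x ∈ U)
    (hσ : maurerCartan e x 1 0 ≠ 0) :
    deriv (thetaSection e w) x = maurerCartan e x 1 0 • thetaSection e (covDeriv e w) x -
      (∑ b ∈ thetaIndices n, w b x * maurerCartan e x b 2) • column e 2 x := by
  have h0 := h.toIsZerothOrderFrame
  have h1 : HasDerivAt (thetaSection e w) (∑ b ∈ thetaIndices n,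
      (w b x • deriv (column e b) x + deriv (w b) x • column e b x)) x :=
    HasDerivAt.fun_sum fun b _ => ((hw b).hasDerivAt_of_isOpen h0.isOpen hx).smul
      ((h0.column_smooth b).hasDerivAt_of_isOpen h0.isOpen hx)
  rw [h1.deriv, Finset.sum_congr rfl fun b hb => by rw [h.deriv_theta hn hx hb]]
  have h2 : ∑ b ∈ thetaIndices n, w b x • ∑ a ∈ thetaIndices n,
      maurerCartan e x a b • column e a x = ∑ b ∈ thetaIndices n,
      (∑ c ∈ thetaIndices n, w c x * maurerCartan e x b c) • column e b x := by
    simp only [Finset.smul_sum, Finset.sum_smul, smul_smul]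
    exact Finset.sum_comm
  have h3 : maurerCartan e x 1 0 • thetaSection e (covDeriv e w) x = ∑ b ∈ thetaIndices n,
      (deriv (w b) x • column e b x +
        (∑ c ∈ thetaIndices n, w c x * maurerCartan e x b c) • column e b x) := by
    rw [thetaSection, Finset.smul_sum]
    refine Finset.sum_congr rfl fun b _ => ?_
    rw [smul_smul, covDeriv, mul_div_cancel₀ _ hσ, add_smul]
  rw [h3]
  simp only [smul_add, Finset.sum_add_distrib, h2, Finset.sum_smul, smul_smul, smul_neg, neg_smul,
    Finset.sum_neg_distrib]
  abel

/-- The chain of a special third order frame. -/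
noncomputable def thirdChain (e : ℝ → Mat n) : ℕ → ℝ → Ambient n
  | 0 => column e 0
  | 1 => column e 1
  | 2 => column e (Fin.last (n + 1))
  | 3 => column e 2
  | 4 => sectionX e
  | _ => sectionNablaX e

omit hn in
theorem spaceV_eq (e : ℝ → Mat n) (x : ℝ) :
    spaceV e x = Submodule.span ℝ ((fun k => thirdChain e k x) '' Set.Iio 6) := by
  rw [spaceV]
  congr 1
  ext v
  constructor
  · rintro (rfl | rfl | rfl | rfl | rfl | rfl)
    exacts [⟨0, by simp, rfl⟩, ⟨1, by simp, rfl⟩, ⟨3, by simp, rfl⟩, ⟨2, by simp, rfl⟩,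
      ⟨4, by simp, rfl⟩, ⟨5, by simp, rfl⟩]
  · rintro ⟨k, hk, rfl⟩
    have hk' : k < 6 := hk
    interval_cases k <;> simp [thirdChain]

/-- Each step advances with the same nonvanishing factor φ^1_0. Consequently V(s) is spanned by e_0
and its first five derivatives, a description that involves only the lift e_0. -/
theorem IsSpecialThirdOrderFrame.isChain (hf : IsImmersion I f)
    (h : IsSpecialThirdOrderFrame I f U e) :
    IsChain U (thirdChain e) (fun _ x => maurerCartan e x 1 0) 5 := by
  have h0 := h.toIsZerothOrderFrame
  have hm := h0.maurerCartan_smooth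
  have hσ : ∀ x ∈ U, maurerCartan e x 1 0 ≠ 0 := fun x hx =>
    h.toIsDarbouxFrame.coeff_ne_zero hn hf hx
  have hq : ∀ b, ContDiffOn ℝ ∞ (qCoeff e b) U := fun b => (hm b 2).div (hm 1 0) hσ
  have hc : ∀ b, ContDiffOn ℝ ∞ (covDeriv e (qCoeff e) b) U := fun b =>
    (((hq b).deriv_infty h0.isOpen).add (ContDiffOn.sum fun c _ => (hq c).mul (hm b c))).div
      (hm 1 0) hσ
  refine ⟨h0.isOpen, fun k hk => ?_, fun k hk => hm 1 0, fun k hk => ?_⟩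
  · interval_cases k
    · exact h0.column_smooth _
    · exact h0.column_smooth _
    · exact h0.column_smooth _
    · exact h0.column_smooth _
    · exact ContDiffOn.sum (s := thetaIndices n) (f := fun b x => qCoeff e b x • column e b x)
        fun b _ => (hq b).smul (h0.column_smooth b)
    · exact ContDiffOn.sum (s := thetaIndices n)
        (f := fun b x => covDeriv e (qCoeff e) b x • column e b x)
        fun b _ => (hc b).smul (h0.column_smooth b)
  · interval_cases k
    · refine SmoothComb.zero.congr fun x hx => ?_
      simp [thirdChain, h.toIsDarbouxFrame.deriv_zero hn hx, h.special x hx]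
    · refine (SmoothComb.smul_basis (Y := thirdChain e) (j := 0) (by norm_num) (hm 0 1)).congr
        fun x hx => ?_
      simp [thirdChain, h.toIsDarbouxFrame.deriv_one hn hx]
    · refine (SmoothComb.smul_basis (Y := thirdChain e) (j := 1) (by norm_num) (hm 0 1)).congr
        fun x hx => ?_
      simp [thirdChain, h.toIsThirdOrderFrame.deriv_last hn hx, h.special x hx]
    · refine (SmoothComb.smul_basis (Y := thirdChain e) (j := 0) (by norm_num) (hm 1 0)).congr
        fun x hx => ?_
      have : maurerCartan e x 1 0 • sectionX e x =
          ∑ a ∈ thetaIndices n, maurerCartan e x a 2 • column e a x := by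
        rw [sectionX, thetaSection, Finset.smul_sum]
        refine Finset.sum_congr rfl fun b _ => ?_
        rw [smul_smul, qCoeff, mul_div_cancel₀ _ (hσ x hx)]
      simp [thirdChain, h.toIsThirdOrderFrame.deriv_two hn hx, this]
    · refine (SmoothComb.smul_basis (Y := thirdChain e) (j := 3) (by norm_num)
        (ContDiffOn.sum (s := thetaIndices n) fun b _ => (hq b).mul (hm b 2)).neg).congr
        fun x hx => ?_
      have : deriv (sectionX e) x = _ :=
        h.toIsThirdOrderFrame.deriv_thetaSection hn hq hx (hσ x hx)
      simp [thirdChain, this, sectionNablaX]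

end Special

/-! ### The adapted vectors of a light-like lift -/

/-- The speed of a lift. -/
noncomputable def speed (F : ℝ → Ambient n) (x : ℝ) : ℝ := √(lorentz (deriv F x) (deriv F x))

/-- The unit tangent vector of a lift. -/
noncomputable def tangent (F : ℝ → Ambient n) (x : ℝ) : Ambient n := (speed F x)⁻¹ • deriv F x

/-- The conformal curvature function of a lift. -/
noncomputable def curv (F : ℝ → Ambient n) (x : ℝ) : ℝ :=
  -(1 / 2) * lorentz ((speed F x)⁻¹ • deriv (tangent F) x) ((speed F x)⁻¹ • deriv (tangent F) x)

/-- The light-like vector dual to a lift and orthogonal to the unit tangent vector. -/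
noncomputable def polar (F : ℝ → Ambient n) (x : ℝ) : Ambient n :=
  (speed F x)⁻¹ • deriv (tangent F) x - curv F x • F x

/-- The conformal principal normal of a lift. -/
noncomputable def principal (F : ℝ → Ambient n) (x : ℝ) : Ambient n :=
  (speed F x)⁻¹ • deriv (polar F) x - curv F x • tangent F x

/-- A light-like lift with positive speed and values in the positive light cone. -/
structure IsConeLift (U : Set ℝ) (f : ℝ → Proj n) (F : ℝ → Ambient n) : Prop
    extends IsNullLift U f F where
  cone : ∀ x ∈ U, F x ∈ lightCone n
  pos : ∀ x ∈ U, 0 < lorentz (deriv F x) (deriv F x)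

section ConeLift

variable {I : Set ℝ} {f : ℝ → Proj n} {U : Set ℝ} {F G : ℝ → Ambient n}

theorem IsConeLift.mono (h : IsConeLift U f F) {V : Set ℝ} (hV : IsOpen V) (hVU : V ⊆ U) :
    IsConeLift V f F :=
  ⟨h.toIsNullLift.mono hV hVU, fun x hx => h.cone x (hVU hx), fun x hx => h.pos x (hVU hx)⟩

theorem IsConeLift.speed_pos (h : IsConeLift U f F) {x : ℝ} (hx : x ∈ U) : 0 < speed F x :=
  Real.sqrt_pos.2 (h.pos x hx)

theorem IsConeLift.speed_sq (h : IsConeLift U f F) {x : ℝ} (hx : x ∈ U) :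
    speed F x ^ 2 = lorentz (deriv F x) (deriv F x) := Real.sq_sqrt (h.pos x hx).le

theorem IsConeLift.speed_smooth (h : IsConeLift U f F) : ContDiffOn ℝ ∞ (speed F) U :=
  ContDiffOn.sqrt ((h.smooth.deriv_infty h.isOpen).lorentz (h.smooth.deriv_infty h.isOpen))
    fun x hx => (h.pos x hx).ne'

theorem IsConeLift.inv_speed_smooth (h : IsConeLift U f F) :
    ContDiffOn ℝ ∞ (fun x => (speed F x)⁻¹) U :=
  h.speed_smooth.inv fun _ hx => (h.speed_pos hx).ne'

theorem IsConeLift.tangent_smooth (h : IsConeLift U f F) : ContDiffOn ℝ ∞ (tangent F) U :=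
  h.inv_speed_smooth.smul (h.smooth.deriv_infty h.isOpen)

theorem IsConeLift.curv_smooth (h : IsConeLift U f F) : ContDiffOn ℝ ∞ (curv F) U := by
  have h1 : ContDiffOn ℝ ∞ (fun x => (speed F x)⁻¹ • deriv (tangent F) x) U :=
    h.inv_speed_smooth.smul (h.tangent_smooth.deriv_infty h.isOpen)
  exact contDiffOn_const.mul (h1.lorentz h1)

theorem IsConeLift.polar_smooth (h : IsConeLift U f F) : ContDiffOn ℝ ∞ (polar F) U :=
  (h.inv_speed_smooth.smul (h.tangent_smooth.deriv_infty h.isOpen)).sub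
    (h.curv_smooth.smul h.smooth)

theorem IsConeLift.principal_smooth (h : IsConeLift U f F) : ContDiffOn ℝ ∞ (principal F) U :=
  (h.inv_speed_smooth.smul (h.polar_smooth.deriv_infty h.isOpen)).sub
    (h.curv_smooth.smul h.tangent_smooth)

theorem IsConeLift.deriv_lift (h : IsConeLift U f F) {x : ℝ} (hx : x ∈ U) :
    deriv F x = speed F x • tangent F x := by
  rw [tangent, smul_smul, mul_inv_cancel₀ (h.speed_pos hx).ne', one_smul]

theorem IsConeLift.deriv_tangent (h : IsConeLift U f F) {x : ℝ} (hx : x ∈ U) :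
    deriv (tangent F) x = speed F x • (curv F x • F x + polar F x) := by
  rw [polar, add_sub_cancel, smul_smul, mul_inv_cancel₀ (h.speed_pos hx).ne', one_smul]

theorem IsConeLift.deriv_polar (h : IsConeLift U f F) {x : ℝ} (hx : x ∈ U) :
    deriv (polar F) x = speed F x • (curv F x • tangent F x + principal F x) := by
  rw [principal, add_sub_cancel, smul_smul, mul_inv_cancel₀ (h.speed_pos hx).ne', one_smul]

/-- Differentiation of a constant scalar product. -/
theorem lorentz_deriv_eq (hU : IsOpen U) (hF : ContDiffOn ℝ ∞ F U) (hG : ContDiffOn ℝ ∞ G U)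
    {c : ℝ} (h : ∀ x ∈ U, lorentz (F x) (G x) = c) {x : ℝ} (hx : x ∈ U) :
    lorentz (F x) (deriv G x) = -lorentz (deriv F x) (G x) := by
  have h1 := ((hF.hasDerivAt_of_isOpen hU hx).lorentz (hG.hasDerivAt_of_isOpen hU hx)).deriv
  rw [deriv_congr_of_isOpen hU h hx, deriv_const] at h1
  linarith

variable (h : IsConeLift U f F)
include h

theorem IsConeLift.lift_tangent {x : ℝ} (hx : x ∈ U) : lorentz (F x) (tangent F x) = 0 := by
  rw [tangent, lorentz_smul_right, h.lorentz_deriv hx, mul_zero]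

theorem IsConeLift.tangent_tangent {x : ℝ} (hx : x ∈ U) :
    lorentz (tangent F x) (tangent F x) = 1 := by
  rw [tangent, lorentz_smul_right, lorentz_smul_left, ← h.speed_sq hx]
  have := (h.speed_pos hx).ne'
  field_simp

theorem IsConeLift.tangent_deriv {x : ℝ} (hx : x ∈ U) :
    lorentz (tangent F x) (deriv (tangent F) x) = 0 := by
  have := lorentz_deriv_eq h.isOpen h.tangent_smooth h.tangent_smooth
    (fun x hx => h.tangent_tangent hx) hx
  rw [lorentz_comm (deriv (tangent F) x)] at this
  linarith

theorem IsConeLift.lift_polar {x : ℝ} (hx : x ∈ U) : lorentz (F x) (polar F x) = -1 := by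
  have h1 := lorentz_deriv_eq h.isOpen h.smooth h.tangent_smooth
    (fun x hx => h.lift_tangent hx) hx
  have h2 := (h.speed_pos hx).ne'
  rw [h.deriv_lift hx, lorentz_smul_left, h.tangent_tangent hx] at h1
  rw [polar, lorentz_sub_right, lorentz_smul_right, lorentz_smul_right, h1, h.null x hx]
  field_simp
  ring

theorem IsConeLift.tangent_polar {x : ℝ} (hx : x ∈ U) :
    lorentz (tangent F x) (polar F x) = 0 := by
  rw [polar, lorentz_sub_right, lorentz_smul_right, lorentz_smul_right, h.tangent_deriv hx,
    lorentz_comm, h.lift_tangent hx]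
  ring

/-- This is what fixes the value of `curv`: since ⟨F,N⟩ = -1, the square of N + KF is ⟨N,N⟩ - 2K,
and K is defined as -1/2 times that square. -/
theorem IsConeLift.polar_polar {x : ℝ} (hx : x ∈ U) : lorentz (polar F x) (polar F x) = 0 := by
  have h1 : (speed F x)⁻¹ • deriv (tangent F) x = polar F x + curv F x • F x := by
    rw [polar, sub_add_cancel]
  have h2 : curv F x = -(1 / 2) * lorentz (polar F x + curv F x • F x)
    (polar F x + curv F x • F x) := by rw [← h1]; rfl
  simp only [lorentz_add_left, lorentz_add_right, lorentz_smul_left, lorentz_smul_right,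
    lorentz_comm (polar F x) (F x), h.lift_polar hx, h.null x hx] at h2
  linarith

/-- Light-like vectors with product -1 lie in the same half of the cone. With c the ratio of their
pairings with the time axis, N - cF is orthogonal to the axis and has square 2c, hence c ≥ 0. -/
theorem IsConeLift.polar_mem {x : ℝ} (hx : x ∈ U) : polar F x ∈ lightCone n := by
  have hF := mem_lightCone_iff.1 (h.cone x hx)
  have hN := h.polar_polar hx
  have hFN := h.lift_polar hx
  have hN0 : polar F x ≠ 0 := fun h0 => by rw [h0] at hFN; simp at hFN
  refine mem_lightCone_iff.2 ⟨hN, lt_of_le_of_ne ?_ (lorentz_timeAxis_ne_zero hN0 hN)⟩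
  set c := lorentz (polar F x) (timeAxis n) / lorentz (F x) (timeAxis n) with hc
  have h1 : lorentz (polar F x - c • F x) (timeAxis n) = 0 := by simp [hc, hF.2.ne]
  have h2 := lorentz_self_nonneg_of_timeAxis h1
  simp only [lorentz_sub_left, lorentz_sub_right, lorentz_smul_left, lorentz_smul_right, hN, hF.1,
    lorentz_comm (polar F x) (F x), hFN] at h2
  have h3 : 0 ≤ c := by linarith
  have h4 : lorentz (polar F x) (timeAxis n) = c * lorentz (F x) (timeAxis n) := by
    rw [hc, div_mul_cancel₀ _ hF.2.ne]
  rw [h4]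
  exact mul_nonpos_of_nonneg_of_nonpos h3 hF.2.le

theorem IsConeLift.lift_principal {x : ℝ} (hx : x ∈ U) : lorentz (F x) (principal F x) = 0 := by
  have h1 := lorentz_deriv_eq h.isOpen h.smooth h.polar_smooth (fun x hx => h.lift_polar hx) hx
  rw [h.deriv_lift hx, lorentz_smul_left, h.tangent_polar hx] at h1
  rw [principal, lorentz_sub_right, lorentz_smul_right, lorentz_smul_right, h1,
    h.lift_tangent hx]
  ring

theorem IsConeLift.tangent_principal {x : ℝ} (hx : x ∈ U) :
    lorentz (tangent F x) (principal F x) = 0 := by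
  have h1 := lorentz_deriv_eq h.isOpen h.tangent_smooth h.polar_smooth
    (fun x hx => h.tangent_polar hx) hx
  have h2 := (h.speed_pos hx).ne'
  rw [h.deriv_tangent hx, lorentz_smul_left, lorentz_add_left, lorentz_smul_left,
    h.lift_polar hx, h.polar_polar hx] at h1
  rw [principal, lorentz_sub_right, lorentz_smul_right, lorentz_smul_right, h1,
    h.tangent_tangent hx]
  field_simp
  ring

theorem IsConeLift.polar_principal {x : ℝ} (hx : x ∈ U) :
    lorentz (polar F x) (principal F x) = 0 := by
  have h1 := lorentz_deriv_eq h.isOpen h.polar_smooth h.polar_smooth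
    (fun x hx => h.polar_polar hx) hx
  rw [lorentz_comm (deriv (polar F) x)] at h1
  rw [principal, lorentz_sub_right, lorentz_smul_right, lorentz_smul_right,
    lorentz_comm (polar F x) (tangent F x), h.tangent_polar hx]
  have : lorentz (polar F x) (deriv (polar F) x) = 0 := by linarith
  rw [this]; ring

omit h in
/-- The chain of adapted vectors of a lift. -/
noncomputable def liftChain (F : ℝ → Ambient n) : ℕ → ℝ → Ambient n
  | 0 => F
  | 1 => tangent F
  | 2 => polar F
  | _ => principal F

theorem IsConeLift.isChain : IsChain U (liftChain F) (fun _ => speed F) 3 := by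
  refine ⟨h.isOpen, fun k hk => ?_, fun k hk => h.speed_smooth, fun k hk => ?_⟩
  · interval_cases k
    exacts [h.smooth, h.tangent_smooth, h.polar_smooth, h.principal_smooth]
  · interval_cases k
    · refine SmoothComb.zero.congr fun x hx => ?_
      simp [liftChain, h.deriv_lift hx]
    · refine (SmoothComb.smul_basis (Y := liftChain F) (j := 0) (by norm_num)
        (h.speed_smooth.mul h.curv_smooth)).congr fun x hx => ?_
      simp [liftChain, h.deriv_tangent hx, mul_smul]
    · refine (SmoothComb.smul_basis (Y := liftChain F) (j := 1) (by norm_num)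
        (h.speed_smooth.mul h.curv_smooth)).congr fun x hx => ?_
      simp [liftChain, h.deriv_polar hx, mul_smul]

/-- The chain coefficients all equal the speed, which contributes (s³s²s)². The normalization of the
lift by arclength is therefore exactly the condition that P be a unit vector. -/
theorem IsConeLift.gramDet_eq {x : ℝ} (hx : x ∈ U) :
    gramDet (fun k => iteratedDeriv k F x) =
      -(speed F x ^ 12 * lorentz (principal F x) (principal F x)) := by
  have key := h.isChain.gramDet_eq hx
  rw [gramDet_of_orthogonal (v := fun k => liftChain F k x) (h.null x hx) (h.lift_tangent hx)
    (h.lift_polar hx) (h.lift_principal hx) (h.tangent_tangent hx) (h.tangent_polar hx)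
    (h.tangent_principal hx) (h.polar_polar hx) (h.polar_principal hx)] at key
  refine key.trans ?_
  simp only [liftChain]
  ring

omit h

/-! ### Existence of Darboux frames -/

theorem IsImmersion.exists_coneLift (hf : IsImmersion I f) {x : ℝ} (hx : x ∈ I) :
    ∃ U F, x ∈ U ∧ U ⊆ I ∧ IsConeLift U f F := by
  obtain ⟨U, F, hxU, hUI, hF, -⟩ := hf.exists_nullLift hx
  obtain ⟨c, hc0, hc⟩ : ∃ c : ℝ, c ≠ 0 ∧ c * lorentz (F x) (timeAxis n) < 0 := by
    rcases lt_or_gt_of_ne (lorentz_timeAxis_ne_zero (hF.ne_zero hxU) (hF.null x hxU)) with h | h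
    · exact ⟨1, one_ne_zero, by linarith⟩
    · exact ⟨-1, by norm_num, by linarith⟩
  have hG := hF.rescale (μ := fun _ => c) contDiffOn_const fun _ _ => hc0
  have hO : IsOpen (U ∩ (fun y => lorentz (c • F y) (timeAxis n)) ⁻¹' Set.Iio 0) :=
    (hG.smooth.lorentz contDiffOn_const).continuousOn.isOpen_inter_preimage hF.isOpen isOpen_Iio
  refine ⟨U ∩ (fun y => lorentz (c • F y) (timeAxis n)) ⁻¹' Set.Iio 0, fun y => c • F y,
    ⟨hxU, by simpa using hc⟩, Set.inter_subset_left.trans hUI,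
    hG.mono hO Set.inter_subset_left, fun y hy => ?_, fun y hy => ?_⟩
  · exact mem_lightCone_iff.2 ⟨hG.null y hy.1, hy.2⟩
  · exact hG.speed_pos hf hUI hy.1

theorem IsPartialFrame.of_le {A : Finset (Fin (n + 2))} {e : Fin (n + 2) → Ambient n}
    (h : ∀ a ∈ A, ∀ b ∈ A, a ≤ b → lorentz (e a) (e b) = lorentzMatrix n a b) :
    IsPartialFrame A e := fun a ha b hb => by
  rcases le_total a b with hab | hab
  · exact h a ha b hb hab
  · rw [lorentz_comm, lorentzMatrix_symm, h b hb a ha hab]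

theorem lorentzMatrix_zero_of_ne {a : Fin (n + 2)} (h : a ≠ Fin.last (n + 1)) :
    lorentzMatrix n 0 a = 0 := by
  rcases eq_or_ne a 0 with rfl | h0
  · exact lorentzMatrix_zero_zero
  · rw [lorentzMatrix_symm, lorentzMatrix_of_ne h0 h h0]

/-- The adapted vectors of a lift, indexed as the columns of a frame. -/
noncomputable def adapted (F : ℝ → Ambient n) (a : Fin (n + 2)) : ℝ → Ambient n :=
  if a = 0 then F else if a = 1 then tangent F else if a = 2 then principal F else polar F

theorem IsConeLift.adapted_smooth (h : IsConeLift U f F) (a : Fin (n + 2)) :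
    ContDiffOn ℝ ∞ (adapted F a) U := by
  unfold adapted
  split_ifs
  exacts [h.smooth, h.tangent_smooth, h.principal_smooth, h.polar_smooth]

theorem adapted_zero : adapted F 0 = F := by simp [adapted]

theorem adapted_one : adapted F 1 = tangent F := by simp [adapted]

theorem adapted_two (hn : 3 ≤ n) : adapted F 2 = principal F := by
  simp [adapted, two_ne_zero' hn, two_ne_one hn]

theorem adapted_last (hn : 3 ≤ n) : adapted F (Fin.last (n + 1)) = polar F := by
  simp [adapted, (one_ne_last hn).symm, (two_ne_last hn).symm]

theorem IsConeLift.isPartialFrame (hn : 3 ≤ n) (h : IsConeLift U f F) {x : ℝ} (hx : x ∈ U) :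
    IsPartialFrame {0, 1, Fin.last (n + 1)} fun a => adapted F a x := by
  have h1l := one_ne_last hn
  intro a ha b hb
  simp only [Finset.mem_insert, Finset.mem_singleton] at ha hb
  rcases ha with rfl | rfl | rfl <;> rcases hb with rfl | rfl | rfl <;>
    simp only [adapted_zero, adapted_one, adapted_last hn, h.null x hx, h.lift_tangent hx,
      h.lift_polar hx, h.tangent_tangent hx, h.tangent_polar hx, h.polar_polar hx,
      lorentz_comm (polar F x) (F x), lorentz_comm (tangent F x) (F x),
      lorentz_comm (polar F x) (tangent F x), lorentzMatrix_zero_zero, lorentzMatrix_zero_last,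
      lorentzMatrix_last_zero, lorentzMatrix_last_last, lorentzMatrix_zero_of_ne h1l,
      lorentzMatrix_symm 1 0, lorentzMatrix_symm (Fin.last (n + 1)) 1,
      lorentzMatrix_self (a := 1) (by simp) h1l, lorentzMatrix_of_ne (a := 1) (by simp) h1l h1l]

theorem IsConeLift.isPartialFrame' (hn : 3 ≤ n) (h : IsConeLift U f F) {x : ℝ} (hx : x ∈ U)
    (hp : lorentz (principal F x) (principal F x) = 1) :
    IsPartialFrame {0, 1, 2, Fin.last (n + 1)} fun a => adapted F a x := by
  have h2l := two_ne_last hn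
  have h20 := two_ne_zero' hn
  intro a ha b hb
  have key : ∀ b ∈ ({0, 1, Fin.last (n + 1)} : Finset (Fin (n + 2))),
      lorentz (adapted F 2 x) (adapted F b x) = lorentzMatrix n 2 b := by
    intro b hb
    simp only [Finset.mem_insert, Finset.mem_singleton] at hb
    rcases hb with rfl | rfl | rfl
    · rw [adapted_two hn, adapted_zero, lorentz_comm, h.lift_principal hx,
        lorentzMatrix_of_ne h20 h2l h20]
    · rw [adapted_two hn, adapted_one, lorentz_comm, h.tangent_principal hx,
        lorentzMatrix_of_ne h20 h2l (two_ne_one hn)]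
    · rw [adapted_two hn, adapted_last hn, lorentz_comm, h.polar_principal hx,
        lorentzMatrix_of_ne h20 h2l h2l]
  have split : ∀ c ∈ ({0, 1, 2, Fin.last (n + 1)} : Finset (Fin (n + 2))),
      c = 2 ∨ c ∈ ({0, 1, Fin.last (n + 1)} : Finset (Fin (n + 2))) := by
    intro c hc
    simp only [Finset.mem_insert, Finset.mem_singleton] at hc ⊢
    tauto
  beta_reduce
  rcases split a ha with rfl | ha' <;> rcases split b hb with rfl | hb'
  · rw [adapted_two hn, hp, lorentzMatrix_self h20 h2l]
  · exact key b hb'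
  · rw [lorentz_comm, lorentzMatrix_symm]; exact key a ha'
  · exact h.isPartialFrame hn hx a ha' b hb'

/-- A smooth frame whose columns `0`, `1`, `n + 1` are the adapted vectors is a Darboux frame. -/
theorem IsConeLift.isDarbouxFrame (h : IsConeLift U f F) (hUI : U ⊆ I)
    {V : Set ℝ} (hV : IsOpen V) (hVU : V ⊆ U) {e : ℝ → Mat n}
    (hs : ∀ i j, ContDiffOn ℝ ∞ (fun x => e x i j) V) (hm : ∀ x ∈ V, e x ∈ moebius n)
    (h0 : column e 0 = F) (h1 : column e 1 = tangent F)
    (hl : column e (Fin.last (n + 1)) = polar F) : IsDarbouxFrame I f V e := by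
  have hz : IsZerothOrderFrame I f V e :=
    ⟨hV, hVU.trans hUI, hs, hm, fun x hx => h0 ▸ h.represents x (hVU hx)⟩
  refine ⟨hz, fun x hx a ha => ?_, fun x hx a ha => ?_⟩ <;>
    obtain ⟨ha0, ha1, hal⟩ := normal_ne ha
  · rw [hz.maurerCartan_of_ne hx ha0 hal, h0, h.deriv_lift (hVU hx), ← h1, lorentz_smul_right,
      hz.lorentz_column hx, lorentzMatrix_of_ne ha0 hal ha1, mul_zero]
  · rw [hz.maurerCartan_of_ne hx ha0 hal, h1, h.deriv_tangent (hVU hx),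
      ← congrFun h0 x, ← congrFun hl x,
      lorentz_smul_right, lorentz_add_right, lorentz_smul_right,
      hz.lorentz_column hx, hz.lorentz_column hx, lorentzMatrix_of_ne ha0 hal ha0,
      lorentzMatrix_of_ne ha0 hal hal]
    ring

theorem IsImmersion.exists_darbouxFrame (hn : 3 ≤ n) (hf : IsImmersion I f) {x : ℝ}
    (hx : x ∈ I) : ∃ U e, x ∈ U ∧ IsDarbouxFrame I f U e := by
  obtain ⟨U, F, hxU, hUI, hF⟩ := hf.exists_coneLift hx
  -- F, T and N alone determine the Darboux conditions; column 2 stays free for correcting the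
  -- orientation.
  have h2 : (2 : Fin (n + 2)) ∉ ({0, 1, Fin.last (n + 1)} : Finset (Fin (n + 2))) := by
    simp only [Finset.mem_insert, Finset.mem_singleton, not_or]
    exact ⟨two_ne_zero' hn, two_ne_one hn, two_ne_last hn⟩
  obtain ⟨V, hVU, hV, hxV, e, hs, hm, hc⟩ := exists_moebius_frame (by simp) (by simp) h2
    hF.isOpen hxU hF.adapted_smooth (fun x hx => hF.isPartialFrame hn hx)
    (fun x hx => by rw [adapted_zero]; exact hF.cone x hx)
    (fun x hx => by rw [adapted_last hn]; exact hF.polar_mem hx)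
  exact ⟨V, e, hxV, hF.isDarbouxFrame hUI hV hVU hs hm
    ((hc 0 (by simp)).trans adapted_zero) ((hc 1 (by simp)).trans adapted_one)
    ((hc _ (by simp)).trans (adapted_last hn))⟩

/-- Existence of a Darboux frame ensures that the choice in the definition picks an actual frame
value, and every frame value equals the lift expression. -/
theorem IsNullLift.arclengthElement_eq (hn : 3 ≤ n) (hF : IsNullLift U f F) (hf : IsImmersion I f)
    (hUI : U ⊆ I) {x : ℝ} (hx : x ∈ U) : arclengthElement I f x = liftElement F x := by
  obtain ⟨V, e, hxV, he⟩ := hf.exists_darbouxFrame hn (hUI hx)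
  obtain ⟨W, e', hxW, he', h⟩ := Classical.epsilon_spec
    (p := fun r : ℝ => ∃ (U : Set ℝ) (e : ℝ → Mat n), x ∈ U ∧ IsDarbouxFrame I f U e ∧
      r = frameArclengthElement e x) ⟨_, V, e, hxV, he, rfl⟩
  refine h.trans ?_
  rw [he'.frameArclengthElement_eq hn hxW (he'.coeff_ne_zero hn hf hxW)]
  exact hF.liftElement_eq he'.toIsZerothOrderFrame.isNullLift hx hxW

/-! ### The normalized lift of a `1`-generic curve -/

/-- A lift in the positive light cone, normalized by the conformal arclength. -/
structure IsConfLift (U : Set ℝ) (f : ℝ → Proj n) (F : ℝ → Ambient n) : Prop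
    extends IsConeLift U f F where
  gram : ∀ x ∈ U, gramDet (fun k => iteratedDeriv k F x) = -lorentz (deriv F x) (deriv F x) ^ 6

theorem IsConfLift.principal_principal (h : IsConfLift U f F) {x : ℝ} (hx : x ∈ U) :
    lorentz (principal F x) (principal F x) = 1 := by
  have h1 := h.gram x hx
  have h2 : 0 < speed F x ^ 12 := pow_pos (h.speed_pos hx) _
  rw [h.toIsConeLift.gramDet_eq hx, ← h.speed_sq hx, ← pow_mul] at h1
  have h3 := neg_inj.1 h1
  exact mul_left_cancel₀ h2.ne' (by rw [h3, mul_one])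

/-- The two sides of the normalization scale by μ^8 and μ^12, so μ^4 = 1; the positive cone selects
μ = 1. -/
theorem IsConfLift.eqOn (hF : IsConfLift U f F) {V : Set ℝ} (hG : IsConfLift V f G) {x : ℝ}
    (hx : x ∈ U) (hx' : x ∈ V) : G x = F x := by
  have hO := hF.isOpen.inter hG.isOpen
  obtain ⟨μ, hμ, h0, h1, h2⟩ := (hF.toIsNullLift.mono hO Set.inter_subset_left).compare
    (hG.toIsNullLift.mono hO Set.inter_subset_right) ⟨hx, hx'⟩
  rw [hF.gram x hx, hG.gram x hx', h1] at h2
  have hp := pow_pos (hF.pos x hx) 6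
  have hμ8 : 0 < μ ^ 8 := by positivity
  have h3 : μ ^ 8 * lorentz (deriv F x) (deriv F x) ^ 6 * (μ ^ 4 - 1) = 0 := by
    linear_combination -h2
  have h4 : μ ^ 4 - 1 = 0 := by
    rcases mul_eq_zero.1 h3 with h | h
    · exact absurd h (by positivity)
    · exact h
  have h5 : μ ^ 2 = 1 := by nlinarith [sq_nonneg μ]
  have hpos : 0 < μ := by
    have a := (mem_lightCone_iff.1 (hF.cone x hx)).2
    have b := (mem_lightCone_iff.1 (hG.cone x hx')).2
    rw [h0, lorentz_smul_left] at b
    by_contra hc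
    nlinarith
  have : μ = 1 := by nlinarith
  rw [h0, this, one_smul]

/-- In a third order frame the only nonzero φ^0_α is φ^0_2 = φ^1_0, so the Gram determinant is
-(φ^1_0)^12. -/
theorem IsConfLift.of_specialThirdOrderFrame (hn : 3 ≤ n) (hf : IsImmersion I f) {e : ℝ → Mat n}
    (h : IsSpecialThirdOrderFrame I f U e) : IsConfLift U f (column e 0) := by
  have h0 := h.toIsZerothOrderFrame
  refine ⟨⟨h0.isNullLift, fun x hx => h0.column_zero_mem hx, fun x hx =>
    h0.isNullLift.speed_pos hf h0.subset hx⟩, fun x hx => ?_⟩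
  rw [h.toIsDarbouxFrame.gramDet_eq hn hx, h.toIsDarbouxFrame.lorentz_deriv_zero hn hx,
    sum_normal hn, h.third_order_two x hx,
    Finset.sum_eq_zero fun a ha => by rw [h.third_order x hx a ha, zero_pow two_ne_zero]]
  ring

theorem IsOneGeneric.exists_confLift (hn : 3 ≤ n) (hf : IsImmersion I f) (hg : IsOneGeneric I f)
    {x : ℝ} (hx : x ∈ I) : ∃ U F, x ∈ U ∧ U ⊆ I ∧ IsConfLift U f F := by
  obtain ⟨U, F, hxU, hUI, hF⟩ := hf.exists_coneLift hx
  obtain ⟨V, e, hxV, he, hp⟩ := hg x hx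
  have hgx : 0 < -gramDet fun k => iteratedDeriv k F x := by
    have hO := hF.isOpen.inter he.isOpen
    obtain ⟨μ, hμ, -, -, h2⟩ := (he.toIsZerothOrderFrame.isNullLift.mono hO
      Set.inter_subset_right).compare (hF.toIsNullLift.mono hO Set.inter_subset_left) ⟨hxU, hxV⟩
    have hσ := he.coeff_ne_zero hn hf hxV
    rw [he.gramDet_eq hn hxV] at h2
    rw [h2]
    have h3 : 0 < ∑ a ∈ normalIndices n, maurerCartan e x 0 a ^ 2 := by
      refine lt_of_le_of_ne (Finset.sum_nonneg fun _ _ => sq_nonneg _) (Ne.symm fun h => hp ?_)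
      have : ∑ a ∈ normalIndices n, pCoeff e x a ^ 2 =
          (∑ a ∈ normalIndices n, maurerCartan e x 0 a ^ 2) / maurerCartan e x 1 0 ^ 2 := by
        rw [Finset.sum_div]
        exact Finset.sum_congr rfl fun a _ => by rw [pCoeff, div_pow]
      rw [this, h, zero_div]
    have h4 : 0 < μ ^ 8 := by positivity
    have h5 : 0 < maurerCartan e x 1 0 ^ 10 := by positivity
    have := mul_pos h4 (mul_pos h5 h3)
    linarith
  have hgs : ContDiffOn ℝ ∞ (fun x => -gramDet fun k => iteratedDeriv k F x) U := by
    have h1 : ∀ i j : ℕ, ContDiffOn ℝ ∞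
        (fun x => lorentz (iteratedDeriv i F x) (iteratedDeriv j F x)) U := fun i j =>
      (contDiffOn_iteratedDeriv hF.isOpen hF.smooth i).lorentz
        (contDiffOn_iteratedDeriv hF.isOpen hF.smooth j)
    unfold gramDet
    simp only [Matrix.det_apply', Matrix.of_apply]
    exact (ContDiffOn.sum fun σ _ => contDiffOn_const.mul (contDiffOn_prod fun i _ => h1 _ _)).neg
  set V' : Set ℝ := U ∩ (fun x => -gramDet fun k => iteratedDeriv k F x) ⁻¹' Set.Ioi 0 with hV'
  have hO : IsOpen V' := hgs.continuousOn.isOpen_inter_preimage hF.isOpen isOpen_Ioi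
  have hVU : V' ⊆ U := Set.inter_subset_left
  -- Scaling by μ turns the normalization into μ^8 (-Gram) = μ^12 ⟨F',F'⟩^6, so the required factor
  -- is the fourth root of q.
  set q : ℝ → ℝ := fun x => (-gramDet fun k => iteratedDeriv k F x) /
    lorentz (deriv F x) (deriv F x) ^ 6 with hq
  have hqpos : ∀ x ∈ V', 0 < q x := fun x hx => div_pos hx.2 (pow_pos (hF.pos x (hVU hx)) 6)
  have hqs : ContDiffOn ℝ ∞ q V' := by
    have h1 := (hF.smooth.deriv_infty hF.isOpen).lorentz (hF.smooth.deriv_infty hF.isOpen)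
    exact (hgs.mono hVU).div ((h1.mono hVU).pow 6) fun x hx =>
      (pow_pos (hF.pos x (hVU hx)) 6).ne'
  have hμs : ContDiffOn ℝ ∞ (fun x => √√(q x)) V' :=
    (hqs.sqrt fun x hx => (hqpos x hx).ne').sqrt fun x hx => (Real.sqrt_pos.2 (hqpos x hx)).ne'
  have hμpos : ∀ x ∈ V', 0 < √√(q x) := fun x hx => Real.sqrt_pos.2 (Real.sqrt_pos.2 (hqpos x hx))
  have hFV := hF.mono hO hVU
  have hN := hFV.toIsNullLift.rescale hμs fun x hx => (hμpos x hx).ne'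
  refine ⟨V', _, ⟨hxU, hgx⟩, hVU.trans hUI, ⟨hN, fun y hy => ?_, fun y hy => ?_⟩, fun y hy => ?_⟩
  · refine mem_lightCone_iff.2 ⟨hN.null y hy, ?_⟩
    rw [lorentz_smul_left]
    exact mul_neg_of_pos_of_neg (hμpos y hy) (mem_lightCone_iff.1 (hFV.cone y hy)).2
  · exact hN.speed_pos hf (hVU.trans hUI) hy
  · rw [hFV.toIsNullLift.gramDet_rescale hμs (fun x hx => (hμpos x hx).ne') hy,
      hFV.toIsNullLift.speed_rescale hμs hy]
    have h4 : √√(q y) ^ 4 = q y := by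
      rw [show √√(q y) ^ 4 = (√√(q y) ^ 2) ^ 2 by ring, Real.sq_sqrt (Real.sqrt_nonneg _),
        Real.sq_sqrt (hqpos y hy).le]
    have h5 := (pow_pos (hFV.pos y hy) 6).ne'
    have h6 : q y * lorentz (deriv F y) (deriv F y) ^ 6 = -gramDet fun k => iteratedDeriv k F y :=
      div_mul_cancel₀ _ h5
    linear_combination (√√(q y) ^ 8 * lorentz (deriv F y) (deriv F y) ^ 6) * h4 +
      √√(q y) ^ 8 * h6

/-- A `1`-generic curve has a global normalized lift. -/
theorem IsOneGeneric.exists_global_confLift (hn : 3 ≤ n) (hI : IsOpen I) (hf : IsImmersion I f)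
    (hg : IsOneGeneric I f) : ∃ F, IsConfLift I f F := by
  have hex := fun x (hx : x ∈ I) => hg.exists_confLift hn hf hx
  choose! U F hxU hUI hF using hex
  -- Uniqueness makes the local lifts agree, so evaluating the lift chosen at y in y itself is
  -- locally one smooth lift.
  have heq : ∀ x ∈ I, ∀ y ∈ U x, F y y = F x y := fun x hx y hy =>
    (hF x hx).eqOn (hF y (hUI x hx hy)) hy (hxU y (hUI x hx hy))
  have hev : ∀ x ∈ I, (fun y => F y y) =ᶠ[nhds x] F x := fun x hx =>
    Filter.eventually_of_mem ((hF x hx).isOpen.mem_nhds (hxU x hx)) (heq x hx)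
  refine ⟨fun y => F y y, ⟨⟨hI, fun x hx => ?_, fun x hx => (hF x hx).represents x (hxU x hx),
    fun x hx => (hF x hx).null x (hxU x hx)⟩, fun x hx => (hF x hx).cone x (hxU x hx),
    fun x hx => ?_⟩, fun x hx => ?_⟩
  · exact ((((hF x hx).smooth.contDiffAt ((hF x hx).isOpen.mem_nhds (hxU x hx)))).congr_of_eventuallyEq
      (hev x hx)).contDiffWithinAt
  · rw [(hev x hx).deriv_eq]
    exact (hF x hx).pos x (hxU x hx)
  · rw [(hev x hx).deriv_eq, ← (hF x hx).gram x (hxU x hx)]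
    congr 1
    funext k
    exact (hev x hx).iteratedDeriv_eq k

/-- A frame with columns F, T, P, N in positions 0, 1, 2, n+1 works: DN = KT + P gives the
conditions on φ^0_2 and φ^0_b, and ⟨N,T⟩ = 0 gives φ^0_0 = 0. -/
theorem IsConfLift.exists_specialThirdOrderFrame (hn : 3 ≤ n) (hF : IsConfLift U f F)
    (hUI : U ⊆ I) {x : ℝ} (hx : x ∈ U) :
    ∃ V e, x ∈ V ∧ IsSpecialThirdOrderFrame I f V e := by
  have hC := hF.toIsConeLift
  have hv3 : (((⟨3, by omega⟩ : Fin (n + 2)) : ℕ)) = 3 := rfl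
  -- Here n ≥ 3 provides a column not yet prescribed, needed to obtain determinant 1.
  have h3 : (⟨3, by omega⟩ : Fin (n + 2)) ∉
      ({0, 1, 2, Fin.last (n + 1)} : Finset (Fin (n + 2))) := by
    simp only [Finset.mem_insert, Finset.mem_singleton, not_or, Fin.ext_iff, Fin.val_zero,
      val_one, val_two hn, Fin.val_last]
    omega
  obtain ⟨V, hVU, hV, hxV, e, hs, hm, hc⟩ := exists_moebius_frame (by simp) (by simp) h3
    hF.isOpen hx hC.adapted_smooth
    (fun x hx => hC.isPartialFrame' hn hx (hF.principal_principal hx))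
    (fun x hx => by rw [adapted_zero]; exact hF.cone x hx)
    (fun x hx => by rw [adapted_last hn]; exact hC.polar_mem hx)
  have h0 : column e 0 = F := (hc 0 (by simp)).trans adapted_zero
  have h1 : column e 1 = tangent F := (hc 1 (by simp)).trans adapted_one
  have h2 : column e 2 = principal F := (hc 2 (by simp)).trans (adapted_two hn)
  have hl : column e (Fin.last (n + 1)) = polar F := (hc _ (by simp)).trans (adapted_last hn)
  have hD : IsDarbouxFrame I f V e := hC.isDarbouxFrame hUI hV hVU hs hm h0 h1 hl
  have hz := hD.toIsZerothOrderFrame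
  have h0a : ∀ y ∈ V, ∀ a, a ≠ 0 → a ≠ 1 → a ≠ Fin.last (n + 1) →
      maurerCartan e y 0 a = speed F y * lorentzMatrix n a 2 := by
    intro y hy a ha0 ha1 hal
    rw [hz.maurerCartan_zero hy, hz.skew hy, neg_neg, hl, hC.deriv_polar (hVU hy), ← h1, ← h2,
      lorentz_smul_right, lorentz_add_right, lorentz_smul_right, hz.lorentz_column hy,
      hz.lorentz_column hy, lorentzMatrix_of_ne ha0 hal ha1]
    ring
  refine ⟨V, e, hxV, ⟨hD, fun y hy => ?_, fun y hy b hb => ?_⟩, fun y hy => ?_⟩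
  · rw [h0a y hy 2 (two_ne_zero' hn) (two_ne_one hn) (two_ne_last hn),
      lorentzMatrix_self (two_ne_zero' hn) (two_ne_last hn),
      hz.maurerCartan_of_ne hy (by simp) (one_ne_last hn), h0, hC.deriv_lift (hVU hy), h1,
      lorentz_smul_right, hC.tangent_tangent (hVU hy)]
  · obtain ⟨hb0, hb1, hbl⟩ := normal_ne (theta_subset_normal hb)
    rw [h0a y hy b hb0 hb1 hbl, lorentzMatrix_of_ne hb0 hbl (theta_ne_two hn hb), mul_zero]
  · rw [hz.maurerCartan_zero hy, hl, h0, hC.deriv_lift (hVU hy), lorentz_smul_right,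
      lorentz_comm, hC.tangent_polar (hVU hy)]
    ring

end ConeLift

/-! ### Conformal spheres -/

theorem IsPartialFrame.linearIndependent {A : Finset (Fin (n + 2))} {e : Fin (n + 2) → Ambient n}
    (he : IsPartialFrame A e) (h0 : 0 ∈ A) (hl : Fin.last (n + 1) ∈ A) :
    LinearIndependent ℝ fun a : A => e a := by
  rw [Fintype.linearIndependent_iff]
  intro c hc d
  have h1 : ∀ b ∈ A, ∑ a : A, c a * lorentzMatrix n a b = 0 := by
    intro b hb
    have h2 := congrArg (fun v => lorentz v (e b)) hc
    simp only [lorentz_sum_left, lorentz_smul_left, lorentz_zero_left] at h2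
    rw [← h2]
    exact Finset.sum_congr rfl fun a _ => by rw [he a a.2 b hb]
  have h3 : ∑ b ∈ A, (∑ a : A, c a * lorentzMatrix n a b) * lorentzMatrix n b d = 0 :=
    Finset.sum_eq_zero fun b hb => by rw [h1 b hb, zero_mul]
  simp only [Finset.sum_mul] at h3
  rw [Finset.sum_comm] at h3
  simp only [mul_assoc, ← Finset.mul_sum] at h3
  rw [← h3, Finset.sum_eq_single d]
  · rw [sum_lorentzMatrix_mul h0 hl d.2, if_pos rfl, mul_one]
  · intro a _ had
    rw [sum_lorentzMatrix_mul h0 hl a.2, if_neg (fun h => had (Subtype.ext h)), mul_zero]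
  · simp

theorem IsPartialFrame.card_le_finrank {A : Finset (Fin (n + 2))} {e : Fin (n + 2) → Ambient n}
    (he : IsPartialFrame A e) (h0 : 0 ∈ A) (hl : Fin.last (n + 1) ∈ A)
    {V : Submodule ℝ (Ambient n)} (hV : ∀ a ∈ A, e a ∈ V) : A.card ≤ Module.finrank ℝ V := by
  have h1 := he.linearIndependent h0 hl
  have h2 : LinearIndependent ℝ fun a : A => (⟨e a, hV a a.2⟩ : V) :=
    LinearIndependent.of_comp V.subtype h1
  simpa using h2.fintype_card_le_finrank

theorem IsPartialFrame.span_eq {A : Finset (Fin (n + 2))} {e : Fin (n + 2) → Ambient n}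
    (he : IsPartialFrame A e) (h0 : 0 ∈ A) (hl : Fin.last (n + 1) ∈ A)
    {V : Submodule ℝ (Ambient n)} (hV : ∀ a ∈ A, e a ∈ V) (hc : Module.finrank ℝ V = A.card) :
    Submodule.span ℝ (Set.range fun a : A => e a) = V := by
  refine Submodule.eq_of_le_of_finrank_eq (Submodule.span_le.2 ?_) ?_
  · rintro _ ⟨a, rfl⟩
    exact hV a a.2
  · rw [finrank_span_eq_card (he.linearIndependent h0 hl), hc, Fintype.card_coe]

/-- Gram–Schmidt inside V, starting from the hyperbolic pair u, w. As long as m < k, a frame of m +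
2 vectors leaves room in dimension k + 2 for a further unit normal. -/
theorem exists_partialFrame_of_submodule {V : Submodule ℝ (Ambient n)} {u w : Ambient n}
    (hu : u ∈ V) (hw : w ∈ V) (huu : lorentz u u = 0) (hww : lorentz w w = 0)
    (huw : lorentz u w = -1) {k : ℕ} (hV : Module.finrank ℝ V = k + 2) (hk : k ≤ n) {m : ℕ}
    (hm : m ≤ k) :
    ∃ (A : Finset (Fin (n + 2))) (e : Fin (n + 2) → Ambient n),
      (∀ a : Fin (n + 2), a ∈ A ↔ (a : ℕ) ≤ m ∨ a = Fin.last (n + 1)) ∧ A.card = m + 2 ∧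
      IsPartialFrame A e ∧ (∀ a ∈ A, e a ∈ V) ∧ e 0 = u ∧ e (Fin.last (n + 1)) = w := by
  induction m with
  | zero =>
    refine ⟨{0, Fin.last (n + 1)}, fun a => if a = 0 then u else w, fun a => ?_, ?_, ?_, ?_, ?_, ?_⟩
    · simp
    · rw [Finset.card_pair last_ne_zero.symm]
    · refine IsPartialFrame.of_le fun a ha b hb _ => ?_
      simp only [Finset.mem_insert, Finset.mem_singleton] at ha hb
      rcases ha with rfl | rfl <;> rcases hb with rfl | rfl <;>
        simp [huu, hww, huw, lorentz_comm w u, lorentzMatrix_zero_zero, lorentzMatrix_zero_last,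
          lorentzMatrix_last_zero, lorentzMatrix_last_last]
    · intro a _
      dsimp only
      split_ifs <;> assumption
    · simp
    · simp
  | succ m ih =>
    obtain ⟨A, e, hA, hcard, he, heV, h0, hl⟩ := ih (by omega)
    have h0A : 0 ∈ A := (hA 0).2 (Or.inl (by simp))
    have hlA : Fin.last (n + 1) ∈ A := (hA _).2 (Or.inr rfl)
    obtain ⟨v, hvV, hv, hvv⟩ := exists_unit_orthogonal V he h0A hlA (by omega)
    set j : Fin (n + 2) := ⟨m + 1, by omega⟩ with hj
    have hjA : j ∉ A := by
      rw [hA, Fin.ext_iff, hj, Fin.val_last]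
      simp only [not_or]
      omega
    have hj0 : j ≠ 0 := fun h => hjA (h ▸ h0A)
    have hjl : j ≠ Fin.last (n + 1) := fun h => hjA (h ▸ hlA)
    have hne : ∀ a ∈ A, a ≠ j := fun a ha h => hjA (h ▸ ha)
    refine ⟨insert j A, Function.update e j v, fun a => ?_, ?_, fun a ha b hb => ?_,
      fun a ha => ?_, ?_, ?_⟩
    · rw [Finset.mem_insert, hA, Fin.ext_iff, hj]
      simp only
      omega
    · rw [Finset.card_insert_of_notMem hjA, hcard]
    · rcases Finset.mem_insert.1 ha with rfl | ha' <;> rcases Finset.mem_insert.1 hb with hb' | hb'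
      · rw [hb', Function.update_self, hvv, lorentzMatrix_self hj0 hjl]
      · rw [Function.update_self, Function.update_of_ne (hne b hb'), lorentz_comm, hv b hb',
          lorentzMatrix_of_ne hj0 hjl (hne b hb').symm]
      · rw [hb', Function.update_self, Function.update_of_ne (hne a ha'), hv a ha',
          lorentzMatrix_symm, lorentzMatrix_of_ne hj0 hjl (hne a ha').symm]
      · rw [Function.update_of_ne (hne a ha'), Function.update_of_ne (hne b hb')]
        exact he a ha' b hb'
    · rcases Finset.mem_insert.1 ha with rfl | ha'
      · rwa [Function.update_self]
      · rw [Function.update_of_ne (hne a ha')]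
        exact heV a ha'
    · rw [Function.update_of_ne hj0.symm, h0]
    · rw [Function.update_of_ne hjl.symm, hl]

theorem isConformalSphere_of_map {k : ℕ} (hk : k ≤ n) {V : Submodule ℝ (Ambient n)} {G : Mat n}
    (hG : G ∈ moebius n) (hV : (standardSubspace n k).map G.mulVecLin = V) :
    IsConformalSphere n k (projectedCone V) := by
  refine ⟨hk, G, hG, ?_⟩
  ext p
  constructor
  · rintro ⟨w, hw, hwc, hp⟩
    rw [← hV] at hw
    obtain ⟨v, hv, rfl⟩ := hw
    rw [Matrix.mulVecLin_apply] at hwc hp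
    refine ⟨v, hv, ?_, hp⟩
    have h1 : lorentz v v = 0 := by
      rw [← lorentz_mulVec hG.1]; exact hwc.1
    have hv0 : v ≠ 0 := by
      rintro rfl
      rw [Matrix.mulVec_zero] at hwc
      exact lightCone_ne_zero hwc rfl
    -- The preimage of a positive light-like vector is positive: otherwise its negative would be,
    -- and G would send that to both halves of the cone.
    rcases lt_or_gt_of_ne (lorentz_timeAxis_ne_zero hv0 h1) with h | h
    · exact mem_lightCone_iff.2 ⟨h1, h⟩
    · have h2 : -v ∈ lightCone n := mem_lightCone_iff.2 ⟨by simpa using h1, by simpa using h⟩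
      have h3 := mem_lightCone_iff.1 (hG.2.2 _ h2)
      have h4 := mem_lightCone_iff.1 hwc
      have h5 := h3.2
      rw [Matrix.mulVec_neg, lorentz_neg_left] at h5
      linarith [h4.2]
  · rintro ⟨v, hv, hvc, hp⟩
    exact ⟨G.mulVec v, hV ▸ ⟨v, hv, rfl⟩, hG.2.2 v hvc, hp⟩

theorem one_mem_moebius : (1 : Mat n) ∈ moebius n :=
  ⟨by simp, by simp, fun v hv => by simpa using hv⟩

/-- A subspace that contains two vectors of the positive light cone with product `-1` projects to a
conformal sphere. -/
theorem isConformalSphere_of_mem {V : Submodule ℝ (Ambient n)} {u w : Ambient n}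
    (hu : u ∈ V) (hw : w ∈ V) (huc : u ∈ lightCone n) (hwc : w ∈ lightCone n)
    (huw : lorentz u w = -1) {k : ℕ} (hV : Module.finrank ℝ V = k + 2) :
    IsConformalSphere n k (projectedCone V) := by
  have hk : k ≤ n := by
    have := Submodule.finrank_le V
    rw [hV, Module.finrank_fin_fun] at this
    omega
  -- For k = n no index is left to adjust the orientation, but then V is the whole space and the
  -- identity matrix serves.
  rcases hk.eq_or_lt with rfl | hkn
  · refine isConformalSphere_of_map le_rfl one_mem_moebius ?_
    have hVt : V = ⊤ := Submodule.eq_top_of_finrank_eq (by rw [hV, Module.finrank_fin_fun])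
    rw [hVt, Matrix.mulVecLin_one, Submodule.map_id, eq_top_iff]
    intro v _
    rw [← Finset.univ_sum_single v]
    refine Submodule.sum_mem _ fun i _ => ?_
    rw [show (Pi.single i (v i) : Ambient k) = v i • Pi.single i 1 by
      rw [← Pi.single_smul, smul_eq_mul, mul_one]]
    refine Submodule.smul_mem _ _ (Submodule.subset_span ⟨i, ?_, rfl⟩)
    rw [Fin.ext_iff, Fin.val_last]
    omega
  obtain ⟨A, e, hA, hcard, he, heV, h0, hl⟩ :=
    exists_partialFrame_of_submodule hu hw huc.1 hwc.1 huw hV hk le_rfl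
  have h0A : 0 ∈ A := (hA 0).2 (Or.inl (by simp))
  have hlA : Fin.last (n + 1) ∈ A := (hA _).2 (Or.inr rfl)
  have hj : (⟨n, by omega⟩ : Fin (n + 2)) ∉ A := by
    rw [hA, Fin.ext_iff, Fin.val_last]
    simp only [not_or]
    omega
  obtain ⟨U, -, -, h0U, E, -, hE, hcol⟩ := exists_moebius_frame (x₀ := 0) h0A hlA hj isOpen_univ
    (Set.mem_univ _) (e := fun a _ => e a) (fun a => contDiffOn_const) (fun _ _ => he)
    (fun _ _ => h0 ▸ huc) (fun _ _ => hl ▸ hwc)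
  refine isConformalSphere_of_map hk (hE 0 h0U) ?_
  rw [← he.span_eq h0A hlA heV (hV.trans hcard.symm), standardSubspace, Submodule.map_span]
  congr 1
  ext v
  have hcol' : ∀ a ∈ A, (E 0).mulVecLin (Pi.single a 1) = e a := fun a ha => by
    rw [Matrix.mulVecLin_apply, Matrix.mulVec_single_one]
    exact congrFun (hcol a ha) 0
  constructor
  · rintro ⟨_, ⟨i, hi, rfl⟩, rfl⟩
    exact ⟨⟨i, (hA i).2 hi⟩, (hcol' i ((hA i).2 hi)).symm⟩
  · rintro ⟨a, rfl⟩
    exact ⟨_, ⟨a, (hA a).1 a.2, rfl⟩, hcol' a a.2⟩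

theorem isTimelike_of_mem {V : Submodule ℝ (Ambient n)} {u w : Ambient n}
    (hu : u ∈ V) (hw : w ∈ V) (huu : lorentz u u = 0) (hww : lorentz w w = 0)
    (huw : lorentz u w = -1) : IsTimelike V := by
  have h1 : lorentz (u + w) (u + w) < 0 := by
    simp only [lorentz_add_left, lorentz_add_right, huu, hww, huw, lorentz_comm w u]
    norm_num
  exact ⟨u + w, V.add_mem hu hw, h1, fun v _ hv hv0 => lorentz_self_pos_of_timelike h1 hv hv0⟩

/-! ### The osculating space of a normalized lift -/

section Osculating

variable {I : Set ℝ} {f : ℝ → Proj n} {F : ℝ → Ambient n}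

/-- The derivative with respect to the arclength given by the lift `F`. -/
noncomputable def arcDeriv {E : Type*} [NormedAddCommGroup E] [NormedSpace ℝ E]
    (F : ℝ → Ambient n) (G : ℝ → E) (x : ℝ) : E :=
  (speed F x)⁻¹ • deriv G x

/-- The adapted vectors of the lift `F`, followed by two derivatives of the principal normal. -/
noncomputable def oscChain (F : ℝ → Ambient n) : ℕ → ℝ → Ambient n
  | 0 => F
  | 1 => tangent F
  | 2 => polar F
  | 3 => principal F
  | 4 => arcDeriv F (principal F)
  | _ => arcDeriv F (arcDeriv F (principal F))

theorem IsConeLift.arcDeriv_smooth {E : Type*} [NormedAddCommGroup E] [NormedSpace ℝ E]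
    (h : IsConeLift I f F) {G : ℝ → E} (hG : ContDiffOn ℝ ∞ G I) :
    ContDiffOn ℝ ∞ (arcDeriv F G) I :=
  h.inv_speed_smooth.smul (hG.deriv_infty h.isOpen)

theorem IsConeLift.deriv_eq_arcDeriv {E : Type*} [NormedAddCommGroup E] [NormedSpace ℝ E]
    (h : IsConeLift I f F) (G : ℝ → E) {x : ℝ} (hx : x ∈ I) :
    deriv G x = speed F x • arcDeriv F G x := by
  rw [arcDeriv, smul_smul, mul_inv_cancel₀ (h.speed_pos hx).ne', one_smul]

theorem IsConeLift.isChain_osc (h : IsConeLift I f F) :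
    IsChain I (oscChain F) (fun _ => speed F) 5 := by
  refine ⟨h.isOpen, fun k hk => ?_, fun k hk => h.speed_smooth, fun k hk => ?_⟩
  · interval_cases k
    exacts [h.smooth, h.tangent_smooth, h.polar_smooth, h.principal_smooth,
      h.arcDeriv_smooth h.principal_smooth,
      h.arcDeriv_smooth (h.arcDeriv_smooth h.principal_smooth)]
  · interval_cases k
    · refine SmoothComb.zero.congr fun x hx => ?_
      simp [oscChain, h.deriv_lift hx]
    · refine (SmoothComb.smul_basis (Y := oscChain F) (j := 0) (by norm_num)
        (h.speed_smooth.mul h.curv_smooth)).congr fun x hx => ?_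
      simp [oscChain, h.deriv_tangent hx, mul_smul]
    · refine (SmoothComb.smul_basis (Y := oscChain F) (j := 1) (by norm_num)
        (h.speed_smooth.mul h.curv_smooth)).congr fun x hx => ?_
      simp [oscChain, h.deriv_polar hx, mul_smul]
    · refine SmoothComb.zero.congr fun x hx => ?_
      simp [oscChain, h.deriv_eq_arcDeriv (principal F) hx]
    · refine SmoothComb.zero.congr fun x hx => ?_
      simp [oscChain, h.deriv_eq_arcDeriv (arcDeriv F (principal F)) hx]

/-- The osculating space of order five of a lift. -/
noncomputable def oscSpace (F : ℝ → Ambient n) (x : ℝ) : Submodule ℝ (Ambient n) :=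
  Submodule.span ℝ ((fun k => oscChain F k x) '' Set.Iio 6)

theorem oscChain_mem (F : ℝ → Ambient n) (x : ℝ) {k : ℕ} (hk : k < 6) :
    oscChain F k x ∈ oscSpace F x :=
  Submodule.subset_span ⟨k, hk, rfl⟩

/-- Both spaces are spanned by the derivatives of order at most five of one and the same map,
because e_0 is a normalized lift and such a lift is unique. -/
theorem IsConfLift.spaceV_eq_oscSpace (hn : 3 ≤ n) (hf : IsImmersion I f)
    (hF : IsConfLift I f F) {U : Set ℝ} {e : ℝ → Mat n} (h : IsSpecialThirdOrderFrame I f U e)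
    {x : ℝ} (hx : x ∈ U) : spaceV e x = oscSpace F x := by
  have hxI := h.subset hx
  have hE := IsConfLift.of_specialThirdOrderFrame hn hf h
  have h1 := (h.isChain hn hf).span_eq hx fun k _ => h.toIsDarbouxFrame.coeff_ne_zero hn hf hx
  have h2 := hF.toIsConeLift.isChain_osc.span_eq hxI fun k _ =>
    (hF.toIsConeLift.speed_pos hxI).ne'
  rw [spaceV_eq, oscSpace, ← h1, ← h2]
  congr 2
  funext k
  exact iteratedDeriv_congr_of_isOpen h.isOpen
    (fun y hy => hF.eqOn hE (h.subset hy) hy) hx k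

theorem IsConfLift.finrank_oscSpace (hn : 3 ≤ n) (hF : IsConfLift I f F) {x : ℝ} (hx : x ∈ I) :
    ∃ k ∈ ({2, 3, 4} : Set ℕ), Module.finrank ℝ (oscSpace F x) = k + 2 := by
  have hle : Module.finrank ℝ (oscSpace F x) ≤ 6 := by
    have h1 : (fun k => oscChain F k x) '' Set.Iio 6 =
        ((Finset.range 6).image fun k => oscChain F k x : Finset (Ambient n)) := by
      ext v; simp
    rw [oscSpace, h1]
    exact (finrank_span_finset_le_card _).trans (Finset.card_image_le.trans (by simp))
  have hge : 4 ≤ Module.finrank ℝ (oscSpace F x) := by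
    have h1 := hF.toIsConeLift.isPartialFrame' hn hx (hF.principal_principal hx)
    have h2 : ({0, 1, 2, Fin.last (n + 1)} : Finset (Fin (n + 2))).card = 4 := by
      have a := one_ne_last hn
      have b := two_ne_last hn
      have c := two_ne_one hn
      have d := two_ne_zero' hn
      rw [Finset.card_insert_of_notMem, Finset.card_insert_of_notMem, Finset.card_pair b]
      · simp [a, c.symm]
      · simp [d.symm]
    rw [← h2]
    refine h1.card_le_finrank (by simp) (by simp) fun a ha => ?_
    simp only [Finset.mem_insert, Finset.mem_singleton] at ha
    rcases ha with rfl | rfl | rfl | rfl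
    · simp only [adapted_zero]; exact oscChain_mem F x (k := 0) (by norm_num)
    · simp only [adapted_one]; exact oscChain_mem F x (k := 1) (by norm_num)
    · simp only [adapted_two hn]; exact oscChain_mem F x (k := 3) (by norm_num)
    · simp only [adapted_last hn]; exact oscChain_mem F x (k := 2) (by norm_num)
  refine ⟨Module.finrank ℝ (oscSpace F x) - 2, ?_, by omega⟩
  simp only [Set.mem_insert_iff, Set.mem_singleton_iff]
  omega

/-- The conclusion for a curve whose osculating space of order five is stationary. -/
theorem IsConfLift.conclusion (hn : 3 ≤ n) (hI : I.OrdConnected) (hne : I.Nonempty)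
    (hf : IsImmersion I f) (hF : IsConfLift I f F)
    (hEL : SmoothComb I (oscChain F) 6 (deriv (oscChain F 5))) :
    (∀ x ∈ I, ∃ (U : Set ℝ) (e : ℝ → Mat n), x ∈ U ∧ IsSpecialThirdOrderFrame I f U e) ∧
    ∃ V : Submodule ℝ (Ambient n),
      (∀ (U : Set ℝ) (e : ℝ → Mat n), IsSpecialThirdOrderFrame I f U e →
        ∀ x ∈ U, spaceV e x = V) ∧
      IsTimelike V ∧
      ∃ k : ℕ, k ∈ ({2, 3, 4} : Set ℕ) ∧ Module.finrank ℝ V = k + 2 ∧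
        IsConformalSphere n k (projectedCone V) ∧ ∀ x ∈ I, f x ∈ projectedCone V := by
  obtain ⟨x₀, hx₀⟩ := hne
  have hC := hF.toIsConeLift
  have hch := hC.isChain_osc
  -- The first five derivatives stay in the span by the chain; the sixth is the Euler–Lagrange
  -- hypothesis `hEL`.
  have hle : ∀ x ∈ I, ∀ y ∈ I, oscSpace F y ≤ oscSpace F x := fun x hx y hy =>
    span_le_of_deriv_mem hF.isOpen hI (fun j hj => hch.smooth j (by omega)) (fun j hj => by
      rcases (by omega : j < 5 ∨ j = 5) with h | rfl
      · exact (hch.deriv_mem h).mono (by omega)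
      · exact hEL) hx hy
  have heq : ∀ x ∈ I, oscSpace F x = oscSpace F x₀ := fun x hx =>
    le_antisymm (hle x₀ hx₀ x hx) (hle x hx x₀ hx₀)
  have h0 : F x₀ ∈ oscSpace F x₀ := oscChain_mem F x₀ (k := 0) (by norm_num)
  have h2 : polar F x₀ ∈ oscSpace F x₀ := oscChain_mem F x₀ (k := 2) (by norm_num)
  obtain ⟨k, hk, hfr⟩ := hF.finrank_oscSpace hn hx₀
  refine ⟨fun x hx => hF.exists_specialThirdOrderFrame hn subset_rfl hx, oscSpace F x₀,
    fun U e he x hx => ?_, isTimelike_of_mem h0 h2 (hF.null x₀ hx₀) (hC.polar_polar hx₀)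
      (hC.lift_polar hx₀), k, hk, hfr, isConformalSphere_of_mem h0 h2 (hF.cone x₀ hx₀)
      (hC.polar_mem hx₀) (hC.lift_polar hx₀) hfr, fun x hx => ?_⟩
  · rw [hF.spaceV_eq_oscSpace hn hf he hx, heq x (he.subset hx)]
  · refine ⟨F x, ?_, hF.cone x hx, hF.represents x hx⟩
    rw [← heq x hx]
    exact oscChain_mem F x (k := 0) (by norm_num)

end Osculating

/-! ### Derivatives of determinants and of parametric integrals -/

theorem hasDerivAt_det {m : ℕ} {M : ℝ → Matrix (Fin m) (Fin m) ℝ} {M' : Matrix (Fin m) (Fin m) ℝ}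
    {t₀ : ℝ} (h : ∀ i j, HasDerivAt (fun t => M t i j) (M' i j) t₀) :
    HasDerivAt (fun t => (M t).det) (∑ k, ((M t₀).updateCol k fun i => M' i k).det) t₀ := by
  have h1 : HasDerivAt (fun t => ∑ σ : Equiv.Perm (Fin m),
      ((Equiv.Perm.sign σ : ℤ) : ℝ) * ∏ i, M t (σ i) i)
      (∑ σ : Equiv.Perm (Fin m), ((Equiv.Perm.sign σ : ℤ) : ℝ) *
        ∑ k, (∏ i ∈ Finset.univ.erase k, M t₀ (σ i) i) * M' (σ k) k) t₀ := by
    refine HasDerivAt.fun_sum fun σ _ => HasDerivAt.const_mul _ ?_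
    simpa using HasDerivAt.fun_finsetProd fun i _ => h (σ i) i
  simp only [← Matrix.det_apply'] at h1
  refine h1.congr_deriv ?_
  simp only [Matrix.det_apply', Finset.mul_sum]
  rw [Finset.sum_comm]
  refine Finset.sum_congr rfl fun k _ => Finset.sum_congr rfl fun σ _ => ?_
  congr 1
  rw [← Finset.prod_erase_mul _ _ (Finset.mem_univ k), Matrix.updateCol_self]
  congr 1
  refine Finset.prod_congr rfl fun i hi => ?_
  rw [Matrix.updateCol_ne (Finset.ne_of_mem_erase hi)]

/-- At t = 0 the Gram matrix J has J² = 1 and det J = -1, so the derivative of -det is the trace of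
J times the first-order change of the matrix. The t² terms do not contribute; they only keep the
variation light-like. -/
theorem hasDerivAt_gramDet {u w b : ℕ → Ambient n}
    (h00 : lorentz (u 0) (u 0) = 0) (h01 : lorentz (u 0) (u 1) = 0)
    (h02 : lorentz (u 0) (u 2) = -1) (h03 : lorentz (u 0) (u 3) = 0)
    (h11 : lorentz (u 1) (u 1) = 1) (h12 : lorentz (u 1) (u 2) = 0)
    (h13 : lorentz (u 1) (u 3) = 0) (h22 : lorentz (u 2) (u 2) = 0)
    (h23 : lorentz (u 2) (u 3) = 0) (h33 : lorentz (u 3) (u 3) = 1) :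
    HasDerivAt (fun t : ℝ => -gramDet fun k => u k + t • w k + t ^ 2 • b k)
      (2 * (lorentz (u 1) (w 1) + lorentz (u 3) (w 3) - lorentz (u 0) (w 2) -
        lorentz (u 2) (w 0))) 0 := by
  have hj : ∀ k, HasDerivAt (fun t : ℝ => u k + t • w k + t ^ 2 • b k) (w k) 0 := fun k => by
    have := ((hasDerivAt_const (0 : ℝ) (u k)).add ((hasDerivAt_id (0 : ℝ)).smul_const (w k))).add
      (((hasDerivAt_id (0 : ℝ)).pow 2).smul_const (b k))
    exact HasDerivAt.congr_deriv this (by simp)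
  have h := hasDerivAt_det (t₀ := 0)
    (M := fun t => Matrix.of fun i j : Fin 4 => lorentz (u i + t • w i + t ^ 2 • b i)
      (u j + t • w j + t ^ 2 • b j))
    (M' := Matrix.of fun i j : Fin 4 => lorentz (u i) (w j) + lorentz (w i) (u j))
    (fun i j => by simpa using (hj i).lorentz (hj j))
  refine h.neg.congr_deriv ?_
  have hJ : (Matrix.of fun i j : Fin 4 => lorentz (u i + (0 : ℝ) • w i + (0 : ℝ) ^ 2 • b i)
      (u j + (0 : ℝ) • w j + (0 : ℝ) ^ 2 • b j)) =
      !![0, 0, -1, 0; 0, 1, 0, 0; -1, 0, 0, 0; 0, 0, 0, 1] := by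
    ext i j
    fin_cases i <;> fin_cases j <;>
      simp [h00, h01, h02, h03, h11, h12, h13, h22, h23, h33, lorentz_comm (u 1) (u 0),
        lorentz_comm (u 2) (u 0), lorentz_comm (u 3) (u 0), lorentz_comm (u 2) (u 1),
        lorentz_comm (u 3) (u 1), lorentz_comm (u 3) (u 2)]
  rw [hJ]
  simp [Matrix.det_succ_row_zero, Fin.sum_univ_succ, Matrix.updateCol_apply, Fin.succAbove,
    lorentz_comm (w _) (u _)]
  ring

open MeasureTheory in
/-- Differentiation of an integral of a smooth function with respect to a parameter. -/
theorem hasDerivAt_integral_of_contDiffOn {I : Set ℝ} (hI : IsOpen I) {a b ε : ℝ}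
    (hab : a ≤ b) (hIab : Set.Icc a b ⊆ I) (hε : 0 < ε) {h : ℝ × ℝ → ℝ}
    (hh : ContDiffOn ℝ ∞ h (I ×ˢ Set.Ioo (-ε) ε)) :
    HasDerivAt (fun t => ∫ x in a..b, h (x, t)) (∫ x in a..b, deriv (fun t => h (x, t)) 0) 0 := by
  have hO : IsOpen (I ×ˢ Set.Ioo (-ε) ε) := hI.prod isOpen_Ioo
  have hd : ∀ x ∈ I, ∀ t ∈ Set.Ioo (-ε) ε,
      HasDerivAt (fun t => h (x, t)) (fderiv ℝ h (x, t) (0, 1)) t := fun x hx t ht => by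
    have h1 : HasFDerivAt h (fderiv ℝ h (x, t)) (x, t) :=
      ((hh.contDiffAt (hO.mem_nhds ⟨hx, ht⟩)).differentiableAt (by simp)).hasFDerivAt
    exact h1.comp_hasDerivAt t ((hasDerivAt_const t x).prodMk (hasDerivAt_id t))
  have hc : ContinuousOn (fun p => fderiv ℝ h p (0, 1)) (I ×ˢ Set.Ioo (-ε) ε) :=
    (hh.continuousOn_fderiv_of_isOpen hO (by simp)).clm_apply continuousOn_const
  have hsub : Set.Icc a b ×ˢ Set.Icc (-(ε / 2)) (ε / 2) ⊆ I ×ˢ Set.Ioo (-ε) ε :=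
    Set.prod_mono hIab (Set.Icc_subset_Ioo (by linarith) (by linarith))
  obtain ⟨C, hC⟩ := (isCompact_Icc.prod isCompact_Icc).exists_bound_of_continuousOn (hc.mono hsub)
  have hcx : ∀ t ∈ Set.Ioo (-ε) ε, ContinuousOn (fun x => h (x, t)) (Set.uIcc a b) :=
    fun t ht => hh.continuousOn.comp (by fun_prop) fun x hx =>
      ⟨hIab (Set.uIcc_of_le hab ▸ hx), ht⟩
  have h0 : (0 : ℝ) ∈ Set.Ioo (-ε) ε := ⟨by linarith, hε⟩
  have hdx : ContinuousOn (fun x => fderiv ℝ h (x, (0 : ℝ)) (0, 1)) (Set.uIcc a b) :=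
    hc.comp (by fun_prop) fun x hx => ⟨hIab (Set.uIcc_of_le hab ▸ hx), h0⟩
  have hι : ∀ x ∈ Set.uIoc a b, x ∈ Set.Icc a b := fun x hx => by
    rw [Set.uIoc_of_le hab] at hx; exact Set.Ioc_subset_Icc_self hx
  have key := intervalIntegral.hasDerivAt_integral_of_dominated_loc_of_deriv_le (μ := volume)
    (F := fun t x => h (x, t)) (F' := fun t x => fderiv ℝ h (x, t) (0, 1)) (x₀ := 0) (a := a)
    (b := b) (s := Set.Icc (-(ε / 2)) (ε / 2)) (bound := fun _ => C)
    (Icc_mem_nhds (by linarith) (by linarith))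
    (Filter.eventually_of_mem (Ioo_mem_nhds h0.1 h0.2) fun t ht =>
      ((hcx t ht).mono Set.uIoc_subset_uIcc).aestronglyMeasurable measurableSet_uIoc)
    (hcx 0 h0).intervalIntegrable
    ((hdx.mono Set.uIoc_subset_uIcc).aestronglyMeasurable measurableSet_uIoc)
    (Filter.Eventually.of_forall fun x hx t ht => hC (x, t) ⟨hι x hx, ht⟩)
    intervalIntegrable_const
    (Filter.Eventually.of_forall fun x hx t ht =>
      hd x (hIab (hι x hx)) t (Set.Icc_subset_Ioo (by linarith) (by linarith) ht))
  refine key.2.congr_deriv (intervalIntegral.integral_congr fun x hx => ?_)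
  exact ((hd x (hIab (Set.uIcc_of_le hab ▸ hx)) 0 h0).deriv).symm

/-! ### The jets of a variation of a lift -/

section LiftOp

variable {I : Set ℝ} {f : ℝ → Proj n} {F G H : ℝ → Ambient n}

theorem arcDeriv_congr (hI : IsOpen I) (h : ∀ x ∈ I, G x = H x) {x : ℝ} (hx : x ∈ I) :
    arcDeriv F G x = arcDeriv F H x := by
  rw [arcDeriv, arcDeriv, deriv_congr_of_isOpen hI h hx]

theorem arcDeriv_add_smul (hI : IsOpen I) (hG : ContDiffOn ℝ ∞ G I) (hH : ContDiffOn ℝ ∞ H I)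
    (c : ℝ) {x : ℝ} (hx : x ∈ I) :
    arcDeriv F (fun x => G x + c • H x) x = arcDeriv F G x + c • arcDeriv F H x := by
  have h := ((hG.hasDerivAt_of_isOpen hI hx).add
    ((hH.hasDerivAt_of_isOpen hI hx).const_smul c)).deriv
  rw [arcDeriv, show deriv (fun x => G x + c • H x) x = _ from h, smul_add, smul_comm]
  rfl

theorem arcDeriv_eq_zero (hI : IsOpen I) (h : ∀ x ∈ I, G x = 0) {x : ℝ} (hx : x ∈ I) :
    arcDeriv F G x = 0 := by
  rw [arcDeriv, deriv_congr_of_isOpen hI h hx, deriv_const, smul_zero]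

/-- The second order operator `G ↦ D (D G) - K G`. -/
noncomputable def curvDeriv (F G : ℝ → Ambient n) (x : ℝ) : Ambient n :=
  arcDeriv F (arcDeriv F G) x - curv F x • G x

/-- The operators that send a lift to its adapted vectors, applied to an arbitrary map. -/
noncomputable def liftOp (F G : ℝ → Ambient n) : ℕ → ℝ → Ambient n
  | 0 => G
  | 1 => arcDeriv F G
  | 2 => curvDeriv F G
  | _ => fun x => arcDeriv F (curvDeriv F G) x - curv F x • arcDeriv F G x

theorem liftOp_self (F : ℝ → Ambient n) : liftOp F F = liftChain F := by
  funext k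
  match k with
  | 0 => rfl
  | 1 => rfl
  | 2 => rfl
  | _ + 3 => rfl

theorem IsConeLift.curvDeriv_smooth (h : IsConeLift I f F) (hG : ContDiffOn ℝ ∞ G I) :
    ContDiffOn ℝ ∞ (curvDeriv F G) I :=
  (h.arcDeriv_smooth (h.arcDeriv_smooth hG)).sub (h.curv_smooth.smul hG)

theorem IsConeLift.liftOp_smooth (h : IsConeLift I f F) (hG : ContDiffOn ℝ ∞ G I) (k : ℕ) :
    ContDiffOn ℝ ∞ (liftOp F G k) I :=
  match k with
  | 0 => hG
  | 1 => h.arcDeriv_smooth hG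
  | 2 => h.curvDeriv_smooth hG
  | _ + 3 => (h.arcDeriv_smooth (h.curvDeriv_smooth hG)).sub
      (h.curv_smooth.smul (h.arcDeriv_smooth hG))

theorem IsConeLift.curvDeriv_add_smul (h : IsConeLift I f F) (hG : ContDiffOn ℝ ∞ G I)
    (hH : ContDiffOn ℝ ∞ H I) (c : ℝ) {x : ℝ} (hx : x ∈ I) :
    curvDeriv F (fun x => G x + c • H x) x = curvDeriv F G x + c • curvDeriv F H x := by
  rw [curvDeriv, curvDeriv, curvDeriv,
    arcDeriv_congr h.isOpen (fun y hy => arcDeriv_add_smul h.isOpen hG hH c hy) hx,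
    arcDeriv_add_smul h.isOpen (h.arcDeriv_smooth hG) (h.arcDeriv_smooth hH) c hx]
  module

theorem IsConeLift.liftOp_add_smul (h : IsConeLift I f F) (hG : ContDiffOn ℝ ∞ G I)
    (hH : ContDiffOn ℝ ∞ H I) (c : ℝ) (k : ℕ) {x : ℝ} (hx : x ∈ I) :
    liftOp F (fun x => G x + c • H x) k x = liftOp F G k x + c • liftOp F H k x := by
  match k with
  | 0 => rfl
  | 1 => exact arcDeriv_add_smul h.isOpen hG hH c hx
  | 2 => exact h.curvDeriv_add_smul hG hH c hx
  | _ + 3 =>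
    simp only [liftOp]
    rw [arcDeriv_congr h.isOpen (fun y hy => h.curvDeriv_add_smul hG hH c hy) hx,
      arcDeriv_add_smul h.isOpen (h.curvDeriv_smooth hG) (h.curvDeriv_smooth hH) c hx,
      arcDeriv_add_smul h.isOpen hG hH c hx]
    module

theorem liftOp_eq_zero (hI : IsOpen I) (h : ∀ x ∈ I, G x = 0) (k : ℕ) {x : ℝ} (hx : x ∈ I) :
    liftOp F G k x = 0 := by
  have h1 : ∀ y ∈ I, arcDeriv F G y = 0 := fun y hy => arcDeriv_eq_zero hI h hy
  have h2 : ∀ y ∈ I, curvDeriv F G y = 0 := fun y hy => by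
    rw [curvDeriv, arcDeriv_eq_zero hI h1 hy, h y hy, smul_zero, sub_zero]
  match k with
  | 0 => exact h x hx
  | 1 => exact h1 x hx
  | 2 => exact h2 x hx
  | _ + 3 =>
    simp only [liftOp]
    rw [arcDeriv_eq_zero hI h2 hx, h1 x hx, smul_zero, sub_zero]

/-- The operators use the speed and curvature of F, not of G, so they are linear in G, and still
they are triangular over the jet of G. This makes the Gram determinant of a variation the
determinant of a matrix polynomial in t. -/
theorem IsConeLift.isChain_liftOp (h : IsConeLift I f F) (hG : ContDiffOn ℝ ∞ G I) :
    IsChain I (liftOp F G) (fun _ => speed F) 3 := by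
  refine ⟨h.isOpen, fun k _ => h.liftOp_smooth hG k, fun _ _ => h.speed_smooth, fun k hk => ?_⟩
  interval_cases k
  · refine SmoothComb.zero.congr fun x hx => ?_
    simp [liftOp, h.deriv_eq_arcDeriv G hx]
  · refine (SmoothComb.smul_basis (Y := liftOp F G) (j := 0) (by norm_num)
      (h.speed_smooth.mul h.curv_smooth)).congr fun x hx => ?_
    simp [liftOp, curvDeriv, h.deriv_eq_arcDeriv (arcDeriv F G) hx, mul_smul, smul_sub]
  · refine (SmoothComb.smul_basis (Y := liftOp F G) (j := 1) (by norm_num)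
      (h.speed_smooth.mul h.curv_smooth)).congr fun x hx => ?_
    simp [liftOp, h.deriv_eq_arcDeriv (curvDeriv F G) hx, mul_smul, smul_sub]

theorem IsConeLift.liftElement_eq_liftOp (h : IsConeLift I f F) (hG : ContDiffOn ℝ ∞ G I) {x : ℝ}
    (hx : x ∈ I) : liftElement G x = speed F x * ((-gramDet fun k => liftOp F G k x) ^ (1 / 4 : ℝ) /
      lorentz (liftOp F G 1 x) (liftOp F G 1 x)) := by
  have hr := h.speed_pos hx
  have key := (h.isChain_liftOp hG).gramDet_eq hx
  rw [show liftOp F G 0 = G from rfl] at key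
  rw [liftElement, key, h.deriv_eq_arcDeriv G hx, show liftOp F G 1 = arcDeriv F G from rfl,
    show (speed F x ^ 3 * speed F x ^ 2 * speed F x) ^ 2 = (speed F x ^ 3) ^ 4 by ring,
    neg_rpow_quarter_mul (pow_pos hr 3), lorentz_smul_left, lorentz_smul_right]
  field_simp

theorem _root_.ContDiffOn.gramDet {E : Type*} [NormedAddCommGroup E] [NormedSpace ℝ E]
    {v : E → ℕ → Ambient n} {s : Set E} (h : ∀ k, ContDiffOn ℝ ∞ (fun p => v p k) s) :
    ContDiffOn ℝ ∞ (fun p => gramDet (v p)) s := by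
  simp only [ConfGeo.gramDet, Matrix.det_apply']
  refine ContDiffOn.sum fun σ _ => contDiffOn_const.mul (contDiffOn_prod fun i _ => ?_)
  exact (h _).lorentz (h _)

end LiftOp

/-! ### The variation of a lift along a transverse field -/

section Variation

variable {I Z : Set ℝ} {f : ℝ → Proj n} {F W : ℝ → Ambient n}

/-- A smooth field along the lift `F`, orthogonal to `F` and to its polar, that vanishes outside of
the compact set `Z`. -/
structure IsTransverse (I : Set ℝ) (F : ℝ → Ambient n) (Z : Set ℝ) (W : ℝ → Ambient n) :
    Prop where
  isCompact : IsCompact Z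
  subset : Z ⊆ I
  smooth : ContDiffOn ℝ ∞ W I
  lift_eq : ∀ x ∈ I, lorentz (F x) (W x) = 0
  polar_eq : ∀ x ∈ I, lorentz (polar F x) (W x) = 0
  outside : ∀ x ∈ I \ Z, W x = 0

/-- The second order term that keeps a variation in the light cone. -/
noncomputable def lightCorrection (F W : ℝ → Ambient n) (x : ℝ) : Ambient n :=
  (1 / 2 * lorentz (W x) (W x)) • polar F x

/-- The lift of the variation along the field `W`. -/
noncomputable def variationLift (F W : ℝ → Ambient n) (t x : ℝ) : Ambient n :=
  F x + t • W x + t ^ 2 • lightCorrection F W x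

/-- The adapted vectors of the variation along the field `W`, with respect to the operators of the
original lift. -/
noncomputable def variationJet (F W : ℝ → Ambient n) (p : ℝ × ℝ) (k : ℕ) : Ambient n :=
  liftChain F k p.1 + p.2 • liftOp F W k p.1 + p.2 ^ 2 • liftOp F (lightCorrection F W) k p.1

theorem IsConeLift.lightCorrection_smooth (hF : IsConeLift I f F) (hW : ContDiffOn ℝ ∞ W I) :
    ContDiffOn ℝ ∞ (lightCorrection F W) I :=
  (contDiffOn_const.mul (hW.lorentz hW)).smul hF.polar_smooth

theorem IsConeLift.variationLift_smooth (hF : IsConeLift I f F) (hW : ContDiffOn ℝ ∞ W I) (t : ℝ) :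
    ContDiffOn ℝ ∞ (variationLift F W t) I :=
  (hF.smooth.add (hW.const_smul t)).add ((hF.lightCorrection_smooth hW).const_smul (t ^ 2))

theorem IsConeLift.liftOp_variationLift (hF : IsConeLift I f F) (hW : ContDiffOn ℝ ∞ W I) (t : ℝ)
    (k : ℕ) {x : ℝ} (hx : x ∈ I) :
    liftOp F (variationLift F W t) k x = variationJet F W (x, t) k := by
  have h1 : ContDiffOn ℝ ∞ (fun x => F x + t • W x) I :=
    hF.smooth.add (hW.const_smul t)
  have h2 := hF.liftOp_add_smul h1 (hF.lightCorrection_smooth hW) (t ^ 2) k hx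
  rw [hF.liftOp_add_smul hF.smooth hW t k hx, liftOp_self] at h2
  exact h2

theorem IsConeLift.variationJet_smooth (hF : IsConeLift I f F) (hW : ContDiffOn ℝ ∞ W I) (k : ℕ) :
    ContDiffOn ℝ ∞ (fun p => variationJet F W p k) (I ×ˢ Set.univ) := by
  have hfst : ∀ {G : ℝ → Ambient n}, ContDiffOn ℝ ∞ G I →
      ContDiffOn ℝ ∞ (fun p : ℝ × ℝ => G p.1) (I ×ˢ Set.univ) := fun hG =>
    hG.comp contDiffOn_fst fun p hp => hp.1
  have h0 := hF.liftOp_smooth hF.smooth k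
  rw [liftOp_self] at h0
  exact ((hfst h0).add (contDiffOn_snd.smul (hfst (hF.liftOp_smooth hW k)))).add
    ((contDiffOn_snd.pow 2).smul (hfst (hF.liftOp_smooth (hF.lightCorrection_smooth hW) k)))

/-- The coefficient 1/2 in the correction cancels t²⟨W,W⟩ against 2t²⟨F, correction⟩, and
orthogonality of W to F and N kills every other term. The curve is light-like for all t, not merely
to second order. -/
theorem IsTransverse.lorentz_variationLift (h : IsTransverse I F Z W) (hF : IsConeLift I f F)
    (t : ℝ) {x : ℝ} (hx : x ∈ I) :
    lorentz (variationLift F W t x) (variationLift F W t x) = 0 := by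
  simp only [variationLift, lightCorrection, lorentz_add_left, lorentz_add_right,
    lorentz_smul_left, lorentz_smul_right, hF.null x hx, h.lift_eq x hx, h.polar_eq x hx,
    lorentz_comm (W x) (F x), lorentz_comm (W x) (polar F x),
    lorentz_comm (polar F x) (F x), hF.lift_polar hx, hF.polar_polar hx]
  ring

/-- The product with N keeps the value -1 along the variation. -/
theorem IsTransverse.variationLift_ne_zero (h : IsTransverse I F Z W) (hF : IsConeLift I f F)
    (t : ℝ) {x : ℝ} (hx : x ∈ I) : variationLift F W t x ≠ 0 := by
  intro h0
  have h1 : lorentz (variationLift F W t x) (polar F x) = -1 := by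
    simp only [variationLift, lightCorrection, lorentz_add_left, lorentz_smul_left,
      hF.lift_polar hx, hF.polar_polar hx, lorentz_comm (W x), h.polar_eq x hx]
    ring
  rw [h0, lorentz_zero_left] at h1
  norm_num at h1

theorem IsTransverse.isOpen_diff (h : IsTransverse I F Z W) (hI : IsOpen I) : IsOpen (I \ Z) :=
  hI.sdiff h.isCompact.isClosed

theorem IsTransverse.liftOp_outside (h : IsTransverse I F Z W) (hI : IsOpen I) (k : ℕ) {x : ℝ}
    (hx : x ∈ I \ Z) : liftOp F W k x = 0 :=
  liftOp_eq_zero (h.isOpen_diff hI) h.outside k hx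

theorem IsTransverse.lightCorrection_outside (h : IsTransverse I F Z W) {x : ℝ}
    (hx : x ∈ I \ Z) : lightCorrection F W x = 0 := by
  rw [lightCorrection, h.outside x hx, lorentz_zero_left, mul_zero, zero_smul]

theorem IsTransverse.variationJet_outside (h : IsTransverse I F Z W) (hI : IsOpen I) (k : ℕ)
    {x : ℝ} (hx : x ∈ I \ Z) (t : ℝ) : variationJet F W (x, t) k = liftChain F k x := by
  simp only [variationJet, h.liftOp_outside hI k hx, smul_zero, add_zero,
    liftOp_eq_zero (h.isOpen_diff hI) (fun y hy => h.lightCorrection_outside hy) k hx]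

theorem IsConfLift.gramDet_liftChain (hF : IsConfLift I f F) {x : ℝ} (hx : x ∈ I) :
    gramDet (fun k => liftChain F k x) = -1 := by
  have hC := hF.toIsConeLift
  rw [gramDet_of_orthogonal (v := fun k => liftChain F k x) (hC.null x hx) (hC.lift_tangent hx)
    (hC.lift_polar hx) (hC.lift_principal hx) (hC.tangent_tangent hx) (hC.tangent_polar hx)
    (hC.tangent_principal hx) (hC.polar_polar hx) (hC.polar_principal hx)]
  simp [liftChain, hF.principal_principal hx]

/-- A transverse field can be followed for a short time without losing regularity. -/
theorem IsTransverse.exists_pos (h : IsTransverse I F Z W) (hF : IsConfLift I f F) :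
    ∃ ε > 0, ∀ x ∈ I, ∀ t ∈ Set.Ioo (-ε) ε, 0 < -gramDet (variationJet F W (x, t)) ∧
      0 < lorentz (variationJet F W (x, t) 1) (variationJet F W (x, t) 1) := by
  have hC := hF.toIsConeLift
  have hO : IsOpen (I ×ˢ (Set.univ : Set ℝ)) := hF.isOpen.prod isOpen_univ
  have hs := hC.variationJet_smooth h.smooth
  have h1 := (ContDiffOn.gramDet hs).neg.continuousOn.isOpen_inter_preimage hO
    (isOpen_Ioi (a := (0 : ℝ)))
  have h2 := ((hs 1).lorentz (hs 1)).continuousOn.isOpen_inter_preimage hO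
    (isOpen_Ioi (a := (0 : ℝ)))
  have hbase : ∀ x ∈ I, 0 < -gramDet (fun k => liftChain F k x) ∧
      0 < lorentz (liftChain F 1 x) (liftChain F 1 x) := fun x hx => by
    rw [hF.gramDet_liftChain hx]
    exact ⟨by norm_num, (hC.tangent_tangent hx).symm ▸ one_pos⟩
  -- Both inequalities are open conditions that hold at t = 0, so compactness of Z gives one ε over
  -- Z; off Z the variation does not move.
  obtain ⟨u, v, -, hv, hu, hv0, huv⟩ := generalized_tube_lemma h.isCompact
    (isCompact_singleton (x := (0 : ℝ))) (h1.inter h2) (by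
      rintro ⟨x, t⟩ ⟨hx, ht⟩
      obtain rfl : t = 0 := ht
      have hxI := h.subset hx
      have e : ∀ k, variationJet F W (x, 0) k = liftChain F k x := fun k => by simp [variationJet]
      refine ⟨⟨⟨hxI, trivial⟩, ?_⟩, ⟨⟨hxI, trivial⟩, ?_⟩⟩
      · change 0 < -gramDet (variationJet F W (x, 0))
        rw [funext e]
        exact (hbase x hxI).1
      · change 0 < lorentz (variationJet F W (x, 0) 1) (variationJet F W (x, 0) 1)
        rw [e]
        exact (hbase x hxI).2)
  obtain ⟨ε, hε, hball⟩ := Metric.isOpen_iff.1 hv 0 (hv0 rfl)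
  refine ⟨ε, hε, fun x hx t ht => ?_⟩
  by_cases hxZ : x ∈ Z
  · have htv : t ∈ v := hball (by simpa [Real.ball_eq_Ioo] using ht)
    exact ⟨(huv ⟨hu hxZ, htv⟩).1.2, (huv ⟨hu hxZ, htv⟩).2.2⟩
  · rw [funext fun k => h.variationJet_outside hF.isOpen k ⟨hx, hxZ⟩ t]
    exact hbase x hx

open Classical in
/-- The variation of `f` along the field `W`. -/
noncomputable def variationMap (f : ℝ → Proj n) (F W : ℝ → Ambient n) (p : ℝ × ℝ) : Proj n :=
  if h : variationLift F W p.2 p.1 ≠ 0 then Projectivization.mk ℝ _ h else f p.1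

theorem IsTransverse.represents (h : IsTransverse I F Z W) (hF : IsConeLift I f F) (t : ℝ) {x : ℝ}
    (hx : x ∈ I) : Represents (variationLift F W t x) (variationMap f F W (x, t)) := by
  refine ⟨h.variationLift_ne_zero hF t hx, ?_⟩
  rw [variationMap, dif_pos]

theorem IsTransverse.isNullLift (h : IsTransverse I F Z W) (hF : IsConeLift I f F) (t : ℝ) :
    IsNullLift I (fun x => variationMap f F W (x, t)) (variationLift F W t) :=
  ⟨hF.isOpen, hF.variationLift_smooth h.smooth t, fun _ hx => h.represents hF t hx,
    fun _ hx => h.lorentz_variationLift hF t hx⟩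

theorem IsTransverse.isImmersion (h : IsTransverse I F Z W) (hF : IsConeLift I f F) {t : ℝ}
    (ht : ∀ x ∈ I, 0 < lorentz (variationJet F W (x, t) 1) (variationJet F W (x, t) 1)) :
    IsImmersion I fun x => variationMap f F W (x, t) := by
  refine IsNullLift.isImmersion (fun x hx => mem_quadric_of_represents (h.represents hF t hx)
    (h.lorentz_variationLift hF t hx)) fun x hx =>
      ⟨I, _, hx, subset_rfl, h.isNullLift hF t, ?_⟩
  have h1 := ht x hx
  rw [← hF.liftOp_variationLift h.smooth t 1 hx] at h1
  rw [hF.deriv_eq_arcDeriv _ hx, lorentz_smul_left, lorentz_smul_right]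
  exact mul_pos (hF.speed_pos hx) (mul_pos (hF.speed_pos hx) h1)

theorem IsTransverse.isAdmissibleVariation (h : IsTransverse I F Z W) (hF : IsConeLift I f F)
    {ε : ℝ} (hε : 0 < ε) (ht : ∀ x ∈ I, ∀ t ∈ Set.Ioo (-ε) ε,
      0 < lorentz (variationJet F W (x, t) 1) (variationJet F W (x, t) 1)) :
    IsAdmissibleVariation I f ε Z (variationMap f F W) where
  pos := hε
  isCompact := h.isCompact
  subset := h.subset
  smooth := fun p hp => by
    refine ⟨I ×ˢ Set.Ioo (-ε) ε, hF.isOpen.prod isOpen_Ioo, hp, subset_rfl,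
      fun q => variationJet F W q 0, (hF.variationJet_smooth h.smooth 0).mono
        (Set.prod_mono_right (Set.subset_univ _)), fun q hq => ?_⟩
    exact h.represents hF q.2 hq.1
  immersion := fun t ht' => h.isImmersion hF fun x hx => ht x hx t ht'
  initial := fun x hx => by
    have h1 := h.represents hF 0 hx
    obtain ⟨h2, h3⟩ := hF.represents x hx
    have h4 : variationLift F W 0 x = F x := by simp [variationLift]
    rw [← h3, ← h1.2]
    congr 1
  outside := fun x hx t _ => by
    have h1 := h.represents hF t hx.1
    obtain ⟨h2, h3⟩ := hF.represents x hx.1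
    have h4 : variationLift F W t x = F x := by
      simp [variationLift, h.outside x hx, h.lightCorrection_outside hx]
    rw [← h3, ← h1.2]
    congr 1

/-- The conformal arclength element of the variation along the field `W`. -/
noncomputable def variationElement (F W : ℝ → Ambient n) (p : ℝ × ℝ) : ℝ :=
  speed F p.1 * ((-gramDet (variationJet F W p)) ^ (1 / 4 : ℝ) /
    lorentz (variationJet F W p 1) (variationJet F W p 1))

theorem IsTransverse.arclengthElement_eq (hn : 3 ≤ n) (h : IsTransverse I F Z W)
    (hF : IsConeLift I f F) {t : ℝ}
    (ht : ∀ x ∈ I, 0 < lorentz (variationJet F W (x, t) 1) (variationJet F W (x, t) 1)) {x : ℝ}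
    (hx : x ∈ I) :
    arclengthElement I (fun x => variationMap f F W (x, t)) x = variationElement F W (x, t) := by
  rw [(h.isNullLift hF t).arclengthElement_eq hn (h.isImmersion hF ht) subset_rfl hx,
    hF.liftElement_eq_liftOp (hF.variationLift_smooth h.smooth t) hx, variationElement,
    hF.liftOp_variationLift h.smooth t 1 hx,
    funext fun k => hF.liftOp_variationLift h.smooth t k hx]

/-- At t = 0 both -Gram and the squared norm equal 1, so the derivative is a quarter of the first
minus the second. The coefficient of ⟨T,DW⟩ is thus 1/2 - 2 = -3/2. -/
theorem IsConfLift.deriv_variationElement (hF : IsConfLift I f F) {x : ℝ} (hx : x ∈ I) :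
    deriv (fun t => variationElement F W (x, t)) 0 =
      speed F x * (1 / 2 * (lorentz (principal F x) (liftOp F W 3 x) -
        lorentz (F x) (liftOp F W 2 x) - lorentz (polar F x) (W x)) -
        3 / 2 * lorentz (tangent F x) (liftOp F W 1 x)) := by
  have hC := hF.toIsConeLift
  have hP := hasDerivAt_gramDet (u := fun k => liftChain F k x) (w := fun k => liftOp F W k x)
    (b := fun k => liftOp F (lightCorrection F W) k x) (hC.null x hx) (hC.lift_tangent hx)
    (hC.lift_polar hx) (hC.lift_principal hx) (hC.tangent_tangent hx) (hC.tangent_polar hx)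
    (hC.tangent_principal hx) (hC.polar_polar hx) (hC.polar_principal hx)
    (hF.principal_principal hx)
  have hj : HasDerivAt (fun t => variationJet F W (x, t) 1) (liftOp F W 1 x) 0 := by
    have := ((hasDerivAt_const (0 : ℝ) (liftChain F 1 x)).add
      ((hasDerivAt_id (0 : ℝ)).smul_const (liftOp F W 1 x))).add
      (((hasDerivAt_id (0 : ℝ)).pow 2).smul_const (liftOp F (lightCorrection F W) 1 x))
    exact HasDerivAt.congr_deriv this (by simp)
  have h0 : ∀ k, variationJet F W (x, 0) k = liftChain F k x := fun k => by simp [variationJet]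
  have hP0 : -gramDet (variationJet F W (x, 0)) = 1 := by
    rw [funext h0, hF.gramDet_liftChain hx, neg_neg]
  have hS0 : lorentz (variationJet F W (x, 0) 1) (variationJet F W (x, 0) 1) = 1 := by
    rw [h0]; exact hC.tangent_tangent hx
  have hP' : HasDerivAt (fun t => -gramDet (variationJet F W (x, t))) _ 0 := hP
  have hq := hP'.rpow_const (p := (1 / 4 : ℝ)) (Or.inl (by rw [hP0]; exact one_ne_zero))
  have h := (hq.div (hj.lorentz hj) (by rw [hS0]; exact one_ne_zero)).const_mul (speed F x)
  refine (show deriv (fun t => variationElement F W (x, t)) 0 = _ from h.deriv).trans ?_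
  rw [hP0, hS0, h0, lorentz_comm (liftOp F W 1 x)]
  simp only [Real.one_rpow, liftChain, liftOp]
  ring

/-- The first variation of the conformal arclength along a transverse field vanishes. -/
theorem IsTransverse.integral_eq_zero (hn : 3 ≤ n) (h : IsTransverse I F Z W)
    (hF : IsConfLift I f F) (hgeo : IsConformalGeodesic I f) {a b : ℝ} (hab : a ≤ b)
    (hI : Set.Icc a b ⊆ I) (hZ : Z ⊆ Set.Icc a b) :
    ∫ x in a..b, speed F x * (1 / 2 * (lorentz (principal F x) (liftOp F W 3 x) -
        lorentz (F x) (liftOp F W 2 x) - lorentz (polar F x) (W x)) -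
        3 / 2 * lorentz (tangent F x) (liftOp F W 1 x)) = 0 := by
  have hC := hF.toIsConeLift
  obtain ⟨ε, hε, hpos⟩ := h.exists_pos hF
  have hadm := h.isAdmissibleVariation hC hε fun x hx t ht => (hpos x hx t ht).2
  have h1 := hgeo a b hab hI ε Z _ hadm hZ
  have hs : ∀ k, ContDiffOn ℝ ∞ (fun p => variationJet F W p k) (I ×ˢ Set.Ioo (-ε) ε) :=
    fun k => (hC.variationJet_smooth h.smooth k).mono (Set.prod_mono_right (Set.subset_univ _))
  have hsm : ContDiffOn ℝ ∞ (variationElement F W) (I ×ˢ Set.Ioo (-ε) ε) :=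
    (hC.speed_smooth.comp contDiffOn_fst fun p hp => hp.1).mul
      (((ContDiffOn.gramDet hs).neg.rpow_const_of_ne fun p hp =>
        (hpos p.1 hp.1 p.2 hp.2).1.ne').div ((hs 1).lorentz (hs 1)) fun p hp =>
        (hpos p.1 hp.1 p.2 hp.2).2.ne')
  have h2 := hasDerivAt_integral_of_contDiffOn hF.isOpen hab hI hε hsm
  -- The explicit integrand represents the arclength element only for |t| < ε, which is enough for
  -- the derivative at 0.
  have h3 : (fun t => conformalArclength I a b fun x => variationMap f F W (x, t)) =ᶠ[nhds 0]
      fun t => ∫ x in a..b, variationElement F W (x, t) := by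
    filter_upwards [Ioo_mem_nhds (neg_lt_zero.2 hε) hε] with t ht
    refine intervalIntegral.integral_congr fun x hx => ?_
    exact h.arclengthElement_eq hn hC (fun y hy => (hpos y hy t ht).2)
      (hI (Set.uIcc_of_le hab ▸ hx))
  rw [← (h2.congr_of_eventuallyEq h3).unique h1]
  refine intervalIntegral.integral_congr fun x hx => ?_
  exact (hF.deriv_variationElement (hI (Set.uIcc_of_le hab ▸ hx))).symm

end Variation

/-! ### The Euler-Lagrange equation -/

section EulerLagrange

variable {I Z : Set ℝ} {f : ℝ → Proj n} {F W : ℝ → Ambient n}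

/-- The Euler-Lagrange field of a lift, up to components along the lift and its polar. -/
noncomputable def eulerField (F : ℝ → Ambient n) (x : ℝ) : Ambient n :=
  arcDeriv F (arcDeriv F (arcDeriv F (principal F))) x -
    (2 * curv F x) • arcDeriv F (principal F) x - arcDeriv F (curv F) x • principal F x

/-- The component of the Euler-Lagrange field orthogonal to the lift and its polar. -/
noncomputable def transverseEulerField (F : ℝ → Ambient n) (x : ℝ) : Ambient n :=
  eulerField F x + lorentz (eulerField F x) (polar F x) • F x +
    lorentz (eulerField F x) (F x) • polar F x

theorem IsConeLift.eulerField_smooth (hF : IsConeLift I f F) : ContDiffOn ℝ ∞ (eulerField F) I :=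
  ((hF.arcDeriv_smooth (hF.arcDeriv_smooth (hF.arcDeriv_smooth hF.principal_smooth))).sub
    ((contDiffOn_const.mul hF.curv_smooth).smul (hF.arcDeriv_smooth hF.principal_smooth))).sub
    ((hF.arcDeriv_smooth hF.curv_smooth).smul hF.principal_smooth)

theorem IsConeLift.transverseEulerField_smooth (hF : IsConeLift I f F) :
    ContDiffOn ℝ ∞ (transverseEulerField F) I :=
  (hF.eulerField_smooth.add ((hF.eulerField_smooth.lorentz hF.polar_smooth).smul hF.smooth)).add
    ((hF.eulerField_smooth.lorentz hF.smooth).smul hF.polar_smooth)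

theorem IsConeLift.lift_transverseEulerField (hF : IsConeLift I f F) {x : ℝ} (hx : x ∈ I) :
    lorentz (F x) (transverseEulerField F x) = 0 := by
  simp only [transverseEulerField, lorentz_add_right, lorentz_smul_right, hF.null x hx,
    hF.lift_polar hx, lorentz_comm (eulerField F x) (F x)]
  ring

theorem IsConeLift.polar_transverseEulerField (hF : IsConeLift I f F) {x : ℝ} (hx : x ∈ I) :
    lorentz (polar F x) (transverseEulerField F x) = 0 := by
  simp only [transverseEulerField, lorentz_add_right, lorentz_smul_right, hF.polar_polar hx,
    lorentz_comm (polar F x) (F x), hF.lift_polar hx, lorentz_comm (eulerField F x) (polar F x)]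
  ring

/-- The orthogonal complement of F and N is positive definite, since F + N is time-like. Hence this
field can test itself. -/
theorem IsConeLift.transverseEulerField_pos (hF : IsConeLift I f F) {x : ℝ} (hx : x ∈ I)
    (h0 : transverseEulerField F x ≠ 0) :
    0 < lorentz (transverseEulerField F x) (transverseEulerField F x) := by
  refine lorentz_self_pos_of_timelike (u := F x + polar F x) ?_ ?_ h0
  · simp only [lorentz_add_left, lorentz_add_right, hF.null x hx, hF.lift_polar hx,
      hF.polar_polar hx, lorentz_comm (polar F x) (F x)]
    norm_num
  · rw [lorentz_add_left, hF.lift_transverseEulerField hx, hF.polar_transverseEulerField hx,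
      add_zero]

theorem IsConeLift.eulerField_transverseEulerField (hF : IsConeLift I f F) {x : ℝ} (hx : x ∈ I) :
    lorentz (eulerField F x) (transverseEulerField F x) =
      lorentz (transverseEulerField F x) (transverseEulerField F x) := by
  conv_rhs => arg 1; rw [transverseEulerField]
  rw [lorentz_add_left, lorentz_add_left, lorentz_smul_left, lorentz_smul_left,
    hF.lift_transverseEulerField hx, hF.polar_transverseEulerField hx, mul_zero, mul_zero,
    add_zero, add_zero]

/-- The boundary term of the first variation. -/
noncomputable def boundaryTerm (F W : ℝ → Ambient n) (x : ℝ) : ℝ :=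
  1 / 2 * lorentz (principal F x) (curvDeriv F W x) -
    1 / 2 * lorentz (arcDeriv F (principal F) x) (arcDeriv F W x) +
    1 / 2 * lorentz (arcDeriv F (arcDeriv F (principal F)) x) (W x) -
    1 / 2 * (curv F x * lorentz (principal F x) (W x)) -
    1 / 2 * lorentz (F x) (arcDeriv F W x) - lorentz (tangent F x) (W x)

theorem IsTransverse.boundaryTerm_outside (h : IsTransverse I F Z W) (hI : IsOpen I) {x : ℝ}
    (hx : x ∈ I \ Z) : boundaryTerm F W x = 0 := by
  have h0 : W x = 0 := h.outside x hx
  have h1 : arcDeriv F W x = 0 := h.liftOp_outside hI 1 hx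
  have h2 : curvDeriv F W x = 0 := h.liftOp_outside hI 2 hx
  simp [boundaryTerm, h0, h1, h2]

/-- Integration by parts in differential form. All derivatives on W in ⟨P, (D³ - DK - KD)W⟩ are
moved to P, which produces the Euler–Lagrange field; the terms with F, T and N form a total
derivative because ⟨F,W⟩ = ⟨N,W⟩ = 0. -/
theorem IsTransverse.hasDerivAt_boundaryTerm (h : IsTransverse I F Z W) (hF : IsConeLift I f F)
    {x : ℝ} (hx : x ∈ I) :
    HasDerivAt (boundaryTerm F W)
      (speed F x * (1 / 2 * (lorentz (principal F x) (liftOp F W 3 x) -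
        lorentz (F x) (liftOp F W 2 x) - lorentz (polar F x) (W x)) -
        3 / 2 * lorentz (tangent F x) (liftOp F W 1 x)) +
        1 / 2 * (speed F x * lorentz (eulerField F x) (W x))) x := by
  have hd : ∀ {G : ℝ → Ambient n}, ContDiffOn ℝ ∞ G I →
      HasDerivAt G (speed F x • arcDeriv F G x) x := fun {G} hG => by
    rw [← hF.deriv_eq_arcDeriv G hx]
    exact hG.hasDerivAt_of_isOpen hF.isOpen hx
  have hK : HasDerivAt (curv F) (speed F x • arcDeriv F (curv F) x) x := by
    rw [← hF.deriv_eq_arcDeriv (curv F) hx]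
    exact hF.curv_smooth.hasDerivAt_of_isOpen hF.isOpen hx
  have h0 : HasDerivAt F (speed F x • tangent F x) x := hd hF.smooth
  have h1 : HasDerivAt (tangent F) (speed F x • (curv F x • F x + polar F x)) x := by
    rw [← hF.deriv_tangent hx]
    exact hF.tangent_smooth.hasDerivAt_of_isOpen hF.isOpen hx
  have p0 := hd hF.principal_smooth
  have p1 := hd (hF.arcDeriv_smooth hF.principal_smooth)
  have p2 := hd (hF.arcDeriv_smooth (hF.arcDeriv_smooth hF.principal_smooth))
  have w0 := hd h.smooth
  have w1 := hd (hF.arcDeriv_smooth h.smooth)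
  have w2 := hd (hF.curvDeriv_smooth h.smooth)
  have key := (((((p0.lorentz w2).const_mul (1 / 2)).sub ((p1.lorentz w1).const_mul (1 / 2))).add
    ((p2.lorentz w0).const_mul (1 / 2))).sub ((hK.mul (p0.lorentz w0)).const_mul (1 / 2))).sub
    ((h0.lorentz w1).const_mul (1 / 2)) |>.sub (h1.lorentz w0)
  refine HasDerivAt.congr_deriv (f := boundaryTerm F W) key ?_
  have e2 : arcDeriv F (arcDeriv F W) x = curvDeriv F W x + curv F x • W x := by
    rw [curvDeriv, sub_add_cancel]
  have e3 : arcDeriv F (curvDeriv F W) x = liftOp F W 3 x + curv F x • arcDeriv F W x := by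
    simp only [liftOp, sub_add_cancel]
  rw [e2, e3]
  simp only [eulerField, lorentz_add_left, lorentz_add_right, lorentz_sub_left, lorentz_smul_left,
    lorentz_smul_right, smul_eq_mul, h.lift_eq x hx, h.polar_eq x hx,
    show liftOp F W 1 = arcDeriv F W from rfl, show liftOp F W 2 = curvDeriv F W from rfl]
  ring

theorem IsTransverse.integral_eulerField (hn : 3 ≤ n) (h : IsTransverse I F Z W)
    (hF : IsConfLift I f F) (hgeo : IsConformalGeodesic I f) {a b : ℝ} (hab : a ≤ b)
    (hI : Set.Icc a b ⊆ I) (hZ : Z ⊆ Set.Icc a b) (ha : a ∉ Z) (hb : b ∉ Z) :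
    ∫ x in a..b, speed F x * lorentz (eulerField F x) (W x) = 0 := by
  have hC := hF.toIsConeLift
  have hI' : Set.uIcc a b ⊆ I := Set.uIcc_of_le hab ▸ hI
  have hw := fun k => hC.liftOp_smooth h.smooth k
  have c1 : ContinuousOn (fun x => speed F x * (1 / 2 * (lorentz (principal F x) (liftOp F W 3 x) -
      lorentz (F x) (liftOp F W 2 x) - lorentz (polar F x) (W x)) -
      3 / 2 * lorentz (tangent F x) (liftOp F W 1 x))) (Set.uIcc a b) :=
    (hC.speed_smooth.mul ((contDiffOn_const.mul (((hC.principal_smooth.lorentz (hw 3)).sub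
      (hC.smooth.lorentz (hw 2))).sub (hC.polar_smooth.lorentz h.smooth))).sub
      (contDiffOn_const.mul (hC.tangent_smooth.lorentz (hw 1))))).continuousOn.mono hI'
  have c2 : ContinuousOn (fun x => 1 / 2 * (speed F x * lorentz (eulerField F x) (W x)))
      (Set.uIcc a b) :=
    (contDiffOn_const.mul (hC.speed_smooth.mul
      (hC.eulerField_smooth.lorentz h.smooth))).continuousOn.mono hI'
  have h1 := intervalIntegral.integral_eq_sub_of_hasDerivAt
    (fun x hx => h.hasDerivAt_boundaryTerm hC (hI' hx))
    (c1.add c2).intervalIntegrable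
  rw [intervalIntegral.integral_add c1.intervalIntegrable c2.intervalIntegrable,
    h.integral_eq_zero hn hF hgeo hab hI hZ,
    h.boundaryTerm_outside hF.isOpen ⟨hI (Set.right_mem_Icc.2 hab), hb⟩,
    h.boundaryTerm_outside hF.isOpen ⟨hI (Set.left_mem_Icc.2 hab), ha⟩,
    intervalIntegral.integral_const_mul] at h1
  linarith

/-- The fundamental lemma of the calculus of variations. Only the projection of the Euler–Lagrange
field is detected, since admissible W are orthogonal to F and N. -/
theorem IsConfLift.transverseEulerField_eq_zero (hn : 3 ≤ n) (hF : IsConfLift I f F)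
    (hgeo : IsConformalGeodesic I f) {x₀ : ℝ} (hx₀ : x₀ ∈ I) : transverseEulerField F x₀ = 0 := by
  have hC := hF.toIsConeLift
  by_contra h0
  obtain ⟨δ, hδ, hball⟩ := Metric.nhds_basis_closedBall.mem_iff.1 (hF.isOpen.mem_nhds hx₀)
  rw [Real.closedBall_eq_Icc] at hball
  -- The outer radius δ/2 keeps the endpoints x₀ ± δ off the support, so the boundary terms vanish.
  let χ : ContDiffBump x₀ := ⟨δ / 3, δ / 2, by linarith, by linarith⟩
  have hsub : Metric.closedBall x₀ (δ / 2) ⊆ Set.Ioo (x₀ - δ) (x₀ + δ) := by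
    rw [Real.closedBall_eq_Icc]
    exact Set.Icc_subset_Ioo (by linarith) (by linarith)
  have hχ : ContDiffOn ℝ ∞ χ I := χ.contDiff.contDiffOn
  have hW : IsTransverse I F (Metric.closedBall x₀ (δ / 2))
      fun x => χ x • transverseEulerField F x := by
    refine ⟨isCompact_closedBall _ _, (hsub.trans Set.Ioo_subset_Icc_self).trans hball,
      hχ.smul hC.transverseEulerField_smooth, fun x hx => ?_, fun x hx => ?_, fun x hx => ?_⟩
    · rw [lorentz_smul_right, hC.lift_transverseEulerField hx, mul_zero]
    · rw [lorentz_smul_right, hC.polar_transverseEulerField hx, mul_zero]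
    · have : χ x = 0 := χ.zero_of_le_dist (not_lt.1 fun h => hx.2 (Metric.mem_closedBall.2 h.le))
      rw [this, zero_smul]
  have h1 := hW.integral_eulerField hn hF hgeo (by linarith : x₀ - δ ≤ x₀ + δ) hball
    (hsub.trans Set.Ioo_subset_Icc_self) (fun h => lt_irrefl _ (hsub h).1)
    fun h => lt_irrefl _ (hsub h).2
  have hval : ∀ x ∈ I, speed F x * lorentz (eulerField F x) (χ x • transverseEulerField F x) =
      speed F x * (χ x * lorentz (transverseEulerField F x) (transverseEulerField F x)) :=
    fun x hx => by rw [lorentz_smul_right, hC.eulerField_transverseEulerField hx]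
  refine (intervalIntegral.integral_pos (by linarith : x₀ - δ < x₀ + δ)
    ((hC.speed_smooth.mul (hC.eulerField_smooth.lorentz hW.smooth)).continuousOn.mono hball)
    (fun x hx => ?_) ⟨x₀, ⟨by linarith, by linarith⟩, ?_⟩).ne' h1
  · have hxI := hball (Set.Ioc_subset_Icc_self hx)
    rw [hval x hxI]
    refine mul_nonneg (hC.speed_pos hxI).le (mul_nonneg χ.nonneg ?_)
    by_cases h : transverseEulerField F x = 0
    · rw [h, lorentz_zero_left]
    · exact (hC.transverseEulerField_pos hxI h).le
  · rw [hval x₀ hx₀, χ.one_of_mem_closedBall (Metric.mem_closedBall_self (by positivity)), one_mul]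
    exact mul_pos (hC.speed_pos hx₀) (hC.transverseEulerField_pos hx₀ h0)

/-- The Euler-Lagrange equation of the conformal arclength. -/
theorem IsConfLift.smoothComb_deriv (hn : 3 ≤ n) (hF : IsConfLift I f F)
    (hgeo : IsConformalGeodesic I f) :
    SmoothComb I (oscChain F) 6 (deriv (oscChain F 5)) := by
  have hC := hF.toIsConeLift
  have b : ∀ {j : ℕ}, j < 6 → SmoothComb I (oscChain F) 6 (oscChain F j) := SmoothComb.basis
  have h := (((((b (j := 4) (by norm_num)).smul (contDiffOn_const (c := (2 : ℝ)).mul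
    hC.curv_smooth)).add ((b (j := 3) (by norm_num)).smul (hC.arcDeriv_smooth hC.curv_smooth))).sub
    ((b (j := 0) (by norm_num)).smul (hC.eulerField_smooth.lorentz hC.polar_smooth))).sub
    ((b (j := 2) (by norm_num)).smul (hC.eulerField_smooth.lorentz hC.smooth))).smul hC.speed_smooth
  refine h.congr fun x hx => ?_
  rw [hC.deriv_eq_arcDeriv (oscChain F 5) hx]
  congr 1
  have h0 := hF.transverseEulerField_eq_zero hn hgeo hx
  rw [transverseEulerField] at h0
  -- Vanishing of the projection puts the Euler–Lagrange field in the span of F and N, both in the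
  -- chain; solving for D³P closes the linear system.
  have h1 : eulerField F x = -(lorentz (eulerField F x) (polar F x) • F x) -
      lorentz (eulerField F x) (F x) • polar F x := by
    rw [add_assoc] at h0
    exact (eq_neg_of_add_eq_zero_left h0).trans (by rw [neg_add, sub_eq_add_neg])
  have h2 : arcDeriv F (oscChain F 5) x = eulerField F x +
      (2 * curv F x) • arcDeriv F (principal F) x + arcDeriv F (curv F) x • principal F x := by
    rw [eulerField]
    simp only [oscChain]
    abel
  rw [h2]
  simp only [oscChain]
  conv_lhs => rw [h1]
  module

end EulerLagrange

end ConfGeo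

/-! ### The theorem on conformal geodesics. -/

theorem mainTheorem3 (n : ℕ) (hn : 3 ≤ n) (I : Set ℝ) (hIopen : IsOpen I)
    (hIconn : I.OrdConnected) (hIne : I.Nonempty) (f : ℝ → ConfGeo.Proj n)
    (himm : ConfGeo.IsImmersion I f) (hgen : ConfGeo.IsOneGeneric I f)
    (hgeo : ConfGeo.IsConformalGeodesic I f) :
    (∀ x ∈ I, ∃ (U : Set ℝ) (e : ℝ → ConfGeo.Mat n),
      x ∈ U ∧ ConfGeo.IsSpecialThirdOrderFrame I f U e) ∧
    ∃ V : Submodule ℝ (ConfGeo.Ambient n),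
      (∀ (U : Set ℝ) (e : ℝ → ConfGeo.Mat n), ConfGeo.IsSpecialThirdOrderFrame I f U e →
        ∀ x ∈ U, ConfGeo.spaceV e x = V) ∧
      ConfGeo.IsTimelike V ∧
      ∃ k : ℕ, k ∈ ({2, 3, 4} : Set ℕ) ∧ Module.finrank ℝ V = k + 2 ∧
        ConfGeo.IsConformalSphere n k (ConfGeo.projectedCone V) ∧
        ∀ x ∈ I, f x ∈ ConfGeo.projectedCone V := by
  obtain ⟨F, hF⟩ := hgen.exists_global_confLift hn hIopen himm
  exact hF.conclusion hn hIconn hIne himm (hF.smoothComb_deriv hn hgeo)
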